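/- Let $G$ be a (finite-dimensional) Lie group acting smoothly, freely and properly from the left on a smooth manifold $M$, and let $E\to M$ be a smooth complex vector bundle of finite rank with a smooth action of $G$ on the total space that covers the action on $M$ and is complex linear on the fibers. Let $h$ be a smooth $G$-invariant hermitian metric on $E$, and let $\nabla$ be a smooth complex-linear connection on $E$ that is $G$-invariant, compatible with $h$, and flat, i.e. its curvature $R^\nabla$ vanishes. For $X\in\mathfrak g$ let $X^\sharp_m=\frac{d}{dt}\big|_{t=0}\exp(tX)m$ be the fundamental vector field, let $(L_X\varphi)(m)=\frac{d}{dt}\big|_{t=0}\exp(tX)\,\varphi(\exp(-tX)m)$ for sections $\varphi$ of $E$, and let the moment map $\mu^\nabla(X)\in\Gamma(\operatorname{End}E)$ be the endomorphism $\mu^\nabla(X)\varphi=\nabla_{X^\sharp}\varphi+L_X\varphi$. The total equivariant Chern form of $\nabla$ is $$c(\nabla)(X)=\det\Bigl(1+\tfrac{1}{2\pi i}R^\nabla+\mu^\nabla(X)\Bigr)\in\Omega^{*}(M;\mathbb C),\qquad X\in\mathfrak g .$$ Then the orbit space $M/G$ carries a smooth manifold structure, compatible with the quotient topology, for which $q\colon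 M\to M/G$ is a submersion, and $E/G\to M/G$ carries the structure of a smooth complex vector bundle for which $E\to E/G$ is smooth and linear on fibers. For any such structure, the following are equivalent: 1. $\nabla$ descends to $E/G\to M/G$: there is a smooth complex-linear connection $\overline\nabla$ on $E/G\to M/G$ with $q^*\overline\nabla=\nabla$ under the canonical identification $E\cong q^*(E/G)$; 2. the total equivariant Chern form vanishes in positive degree, i.e. $c(\nabla)(X)=1$ for all $X\in\mathfrak g$. -/

import Mathlib

open Bundle
open scoped Manifold ContDiff

noncomputable section

namespace EquivariantChern

/-! ### Complex vector bundles over real manifolds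

A smooth complex vector bundle over a real manifold `M` is a fiber bundle `E` whose trivializations
are complex linear (`VectorBundle ℂ F E`, `VectorBundle ℝ F E`) and have real-smooth transition
functions (`ContMDiffVectorBundle ∞ F E 𝓘(ℝ, EM)`). A connection is Mathlib's `CovariantDerivative`
over `ℝ`, where `cov φ m v` is `∇_v φ (m)`, that is smooth and commutes with complex scalars. -/

section Connection

variable {EM : Type*} [NormedAddCommGroup EM] [NormedSpace ℝ EM]
  {M : Type*} [TopologicalSpace M] [ChartedSpace EM M] [IsManifold 𝓘(ℝ, EM) ∞ M]
  {F : Type*} [NormedAddCommGroup F] [NormedSpace ℂ F]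
  {V : M → Type*} [TopologicalSpace (TotalSpace F V)]
  [∀ x, AddCommGroup (V x)] [∀ x, Module ℂ (V x)] [∀ x, TopologicalSpace (V x)]
  [∀ x, IsTopologicalAddGroup (V x)] [∀ x, ContinuousSMul ℝ (V x)]
  [FiberBundle F V] [VectorBundle ℝ F V]

/-- `∇` is a smooth connection on a complex vector bundle. Together with the real Leibniz rule,
complex homogeneity gives `∇(f φ) = df ⊗ φ + f ∇φ` for complex-valued functions `f`. -/
structure IsSmoothComplexConnection (cov : CovariantDerivative 𝓘(ℝ, EM) F V) : Prop where
  smooth : CovariantDerivative.ContMDiffCovariantDerivative cov ∞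
  complex_smul : ∀ (c : ℂ) (φ : Π x, V x) (m : M),
    MDifferentiableAt 𝓘(ℝ, EM) (𝓘(ℝ, EM).prod 𝓘(ℝ, F))
      (fun x ↦ (⟨x, φ x⟩ : TotalSpace F V)) m →
    ∀ v : TangentSpace 𝓘(ℝ, EM) m, cov (fun x ↦ c • φ x) m v = c • cov φ m v

/-- `R(X, Y) φ = ∇_X ∇_Y φ - ∇_Y ∇_X φ - ∇_[X, Y] φ`. -/
def curvatureOp (cov : CovariantDerivative 𝓘(ℝ, EM) F V)
    (X Y : Π x : M, TangentSpace 𝓘(ℝ, EM) x) (φ : Π x, V x) (m : M) : V m :=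
  cov (fun y ↦ cov φ y (Y y)) m (X m) - cov (fun y ↦ cov φ y (X y)) m (Y m)
    - cov φ m (VectorField.mlieBracket 𝓘(ℝ, EM) X Y m)

end Connection

/-! ### Equivariant bundles and orbit spaces -/

section Algebraic

variable (G : Type*) [Group G] {M : Type*} [MulAction G M]
  (F : Type*) (E : M → Type*) [∀ x, AddCommGroup (E x)] [∀ x, Module ℂ (E x)]
  [MulAction G (TotalSpace F E)]

/-- The action of `G` on the total space covers the action on the base and is complex linear on
the fibers. -/
class IsEquivariantBundle : Prop where
  exists_linearMap : ∀ (g : G) (x : M), ∃ A : E x →ₗ[ℂ] E (g • x),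
    ∀ v : E x, g • (⟨x, v⟩ : TotalSpace F E) = ⟨g • x, A v⟩

variable {F E}

theorem proj_smul [IsEquivariantBundle G F E] (g : G) (p : TotalSpace F E) :
    (g • p).proj = g • p.proj := by
  obtain ⟨A, hA⟩ := IsEquivariantBundle.exists_linearMap (F := F) (E := E) g p.proj
  have h : g • p = ⟨g • p.proj, A p.snd⟩ := hA p.snd
  rw [h]

variable {G}

/-- The translated section `(g φ)(x) = g · φ(g⁻¹ x)`. -/
def sectionAct [IsEquivariantBundle G F E] (g : G) (φ : Π x, E x) (x : M) : E x :=
  have h : (g • (⟨g⁻¹ • x, φ (g⁻¹ • x)⟩ : TotalSpace F E)).proj = x := by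
    rw [proj_smul, smul_inv_smul]
  h ▸ (g • (⟨g⁻¹ • x, φ (g⁻¹ • x)⟩ : TotalSpace F E)).snd

variable (G F E)

/-- The bundle projection `E/G → M/G`. -/
def orbitProj [IsEquivariantBundle G F E] :
    MulAction.orbitRel.Quotient G (TotalSpace F E) → MulAction.orbitRel.Quotient G M :=
  Quotient.map' TotalSpace.proj (by
    rintro _ p ⟨g, rfl⟩
    exact ⟨g, (proj_smul G g p).symm⟩)

/-- The fiber of `E/G → M/G` over `b`. -/
def OrbitFiber [IsEquivariantBundle G F E] (b : MulAction.orbitRel.Quotient G M) : Type _ :=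
  {e : MulAction.orbitRel.Quotient G (TotalSpace F E) // orbitProj G F E e = b}

/-- The quotient map `q : M → M/G`. -/
def orbitMk (m : M) : MulAction.orbitRel.Quotient G M := Quotient.mk'' m

variable {E} in
/-- The quotient map `E → E/G` on the fiber over `m`. -/
def fiberMk [IsEquivariantBundle G F E] {m : M} (v : E m) : OrbitFiber G F E (orbitMk G m) :=
  ⟨Quotient.mk'' (⟨m, v⟩ : TotalSpace F E), rfl⟩

end Algebraic

section Group

variable {EG : Type*} [NormedAddCommGroup EG] [NormedSpace ℝ EG]
  (G : Type*) [TopologicalSpace G] [ChartedSpace EG G] [Group G]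
  {EM : Type*} [NormedAddCommGroup EM] [NormedSpace ℝ EM]
  {M : Type*} [TopologicalSpace M] [ChartedSpace EM M] [MulAction G M]

variable {G} in
/-- The fundamental vector field `X^♯(m) = d/dt|₀ exp(tX) m`, i.e. the differential at `1` of the
orbit map of `m`, applied to `X`. -/
def fundamentalField (X : GroupLieAlgebra 𝓘(ℝ, EG) G) (m : M) : TangentSpace 𝓘(ℝ, EM) m :=
  (show EM from mfderiv 𝓘(ℝ, EG) 𝓘(ℝ, EM) (fun g : G ↦ g • m) 1 X)

section Quotient

variable (EG EM)
  (F : Type*) [NormedAddCommGroup F] [NormedSpace ℂ F]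
  (E : M → Type*) [∀ x, AddCommGroup (E x)] [∀ x, Module ℂ (E x)]
  [TopologicalSpace (TotalSpace F E)] [∀ x, TopologicalSpace (E x)] [FiberBundle F E]
  [MulAction G (TotalSpace F E)] [IsEquivariantBundle G F E]

/-- The structure of a smooth complex vector bundle on the orbit spaces `E/G → M/G`: a smooth
manifold structure on the topological quotient `M/G` for which `M → M/G` is a submersion, and a
smooth complex vector bundle structure on the fibers of `E/G → M/G` for which `E → E/G` is smooth
and linear on fibers. For a free action, these data are unique up to the choice of atlases. -/
structure QuotientBundle where
  [chartedSpace : ChartedSpace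
    (EuclideanSpace ℝ (Fin (Module.finrank ℝ EM - Module.finrank ℝ EG)))
    (MulAction.orbitRel.Quotient G M)]
  [isManifold : IsManifold
    𝓘(ℝ, EuclideanSpace ℝ (Fin (Module.finrank ℝ EM - Module.finrank ℝ EG))) ∞
    (MulAction.orbitRel.Quotient G M)]
  [addCommGroup : ∀ b, AddCommGroup (OrbitFiber G F E b)]
  [module : ∀ b, Module ℂ (OrbitFiber G F E b)]
  [topologicalSpace : ∀ b, TopologicalSpace (OrbitFiber G F E b)]
  [isTopologicalAddGroup : ∀ b, IsTopologicalAddGroup (OrbitFiber G F E b)]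
  [continuousSMul : ∀ b, ContinuousSMul ℝ (OrbitFiber G F E b)]
  [totalTopology : TopologicalSpace (TotalSpace F (OrbitFiber G F E))]
  [fiberBundle : FiberBundle F (OrbitFiber G F E)]
  [vectorBundleComplex : VectorBundle ℂ F (OrbitFiber G F E)]
  [vectorBundleReal : VectorBundle ℝ F (OrbitFiber G F E)]
  [smoothBundle : ContMDiffVectorBundle ∞ F (OrbitFiber G F E)
    𝓘(ℝ, EuclideanSpace ℝ (Fin (Module.finrank ℝ EM - Module.finrank ℝ EG)))]
  isSubmersion : Manifold.IsSubmersion 𝓘(ℝ, EM)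
    𝓘(ℝ, EuclideanSpace ℝ (Fin (Module.finrank ℝ EM - Module.finrank ℝ EG))) ∞
    (orbitMk G : M → MulAction.orbitRel.Quotient G M)
  fiberMk_add : ∀ (m : M) (v w : E m), fiberMk G F (v + w) = fiberMk G F v + fiberMk G F w
  fiberMk_smul : ∀ (m : M) (c : ℂ) (v : E m), fiberMk G F (c • v) = c • fiberMk G F v
  contMDiff_fiberMk : ContMDiff (𝓘(ℝ, EM).prod 𝓘(ℝ, F))
    (𝓘(ℝ, EuclideanSpace ℝ (Fin (Module.finrank ℝ EM - Module.finrank ℝ EG))).prod 𝓘(ℝ, F)) ∞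
    (fun p : TotalSpace F E ↦
      (⟨orbitMk G p.proj, fiberMk G F p.snd⟩ : TotalSpace F (OrbitFiber G F E)))

end Quotient

section Descent

variable {F : Type*} [NormedAddCommGroup F] [NormedSpace ℂ F]
  {E : M → Type*} [∀ x, AddCommGroup (E x)] [∀ x, Module ℂ (E x)]
  [TopologicalSpace (TotalSpace F E)] [∀ x, TopologicalSpace (E x)]
  [∀ x, IsTopologicalAddGroup (E x)] [∀ x, ContinuousSMul ℝ (E x)] [FiberBundle F E]
  [MulAction G (TotalSpace F E)] [IsEquivariantBundle G F E]

variable {G} in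
/-- `∇` descends: there is a connection `∇'` on `E/G → M/G` whose pullback along `q : M → M/G`
is `∇`, i.e. `∇_v (q^* s) = (∇'_{dq(v)} s)` under `E_m ≅ (E/G)_{q(m)}` for every local smooth
section `s` of `E/G`. -/
def Descends (Q : QuotientBundle EG G EM F E) (cov : CovariantDerivative 𝓘(ℝ, EM) F E) : Prop :=
  letI := Q.chartedSpace
  letI := Q.addCommGroup
  letI := Q.module
  letI := Q.topologicalSpace
  letI := Q.totalTopology
  letI := Q.fiberBundle
  haveI := Q.isManifold
  haveI := Q.isTopologicalAddGroup
  haveI := Q.continuousSMul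
  haveI := Q.vectorBundleReal
  ∃ cov' : CovariantDerivative
      𝓘(ℝ, EuclideanSpace ℝ (Fin (Module.finrank ℝ EM - Module.finrank ℝ EG))) F
      (OrbitFiber G F E),
    IsSmoothComplexConnection cov' ∧
    ∀ (U : Set (MulAction.orbitRel.Quotient G M)) (s : Π b, OrbitFiber G F E b) (σ : Π m, E m),
      IsOpen U →
      ContMDiffOn 𝓘(ℝ, EuclideanSpace ℝ (Fin (Module.finrank ℝ EM - Module.finrank ℝ EG)))
        (𝓘(ℝ, EuclideanSpace ℝ (Fin (Module.finrank ℝ EM - Module.finrank ℝ EG))).prod 𝓘(ℝ, F)) ∞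
        (fun b ↦ (⟨b, s b⟩ : TotalSpace F (OrbitFiber G F E))) U →
      (∀ m, fiberMk G F (σ m) = s (orbitMk G m)) →
      ∀ (m : M) (v : TangentSpace 𝓘(ℝ, EM) m), orbitMk G m ∈ U →
        fiberMk G F (cov σ m v) = cov' s (orbitMk G m)
          (mfderiv 𝓘(ℝ, EM)
            𝓘(ℝ, EuclideanSpace ℝ (Fin (Module.finrank ℝ EM - Module.finrank ℝ EG)))
            (orbitMk G : M → MulAction.orbitRel.Quotient G M) m v)

variable (F E) in
/-- `G`-invariance of `∇`: `∇_{dg(v)} (g φ) = g · ∇_v φ`. -/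
def IsInvariantConnection (cov : CovariantDerivative 𝓘(ℝ, EM) F E) : Prop :=
  ∀ (g : G) (φ : Π x, E x) (m : M),
    MDifferentiableAt 𝓘(ℝ, EM) (𝓘(ℝ, EM).prod 𝓘(ℝ, F))
      (fun x ↦ (⟨x, φ x⟩ : TotalSpace F E)) m →
    ∀ v : TangentSpace 𝓘(ℝ, EM) m,
      (⟨g • m, cov (sectionAct (F := F) g φ) (g • m)
        (mfderiv 𝓘(ℝ, EM) 𝓘(ℝ, EM) (fun x : M ↦ g • x) m v)⟩ : TotalSpace F E)
      = g • (⟨m, cov φ m v⟩ : TotalSpace F E)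

end Descent

/-! ### Hermitian bundles -/

section Hermitian

variable {F : Type*} [NormedAddCommGroup F] [NormedSpace ℂ F]
  {E : M → Type*} [∀ x, NormedAddCommGroup (E x)] [∀ x, InnerProductSpace ℂ (E x)]
  [TopologicalSpace (TotalSpace F E)] [FiberBundle F E]

variable (EM F E) in
/-- The fiberwise hermitian inner product is smooth. -/
def IsSmoothHermitian : Prop :=
  ∀ (U : Set M) (φ ψ : Π x, E x), IsOpen U →
    ContMDiffOn 𝓘(ℝ, EM) (𝓘(ℝ, EM).prod 𝓘(ℝ, F)) ∞
      (fun x ↦ (⟨x, φ x⟩ : TotalSpace F E)) U →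
    ContMDiffOn 𝓘(ℝ, EM) (𝓘(ℝ, EM).prod 𝓘(ℝ, F)) ∞
      (fun x ↦ (⟨x, ψ x⟩ : TotalSpace F E)) U →
    ContMDiffOn 𝓘(ℝ, EM) 𝓘(ℝ, ℂ) ∞ (fun x ↦ inner ℂ (φ x) (ψ x)) U

variable (F E) in
/-- `G` acts by fiberwise isometries. -/
def IsInvariantHermitian [MulAction G (TotalSpace F E)] : Prop :=
  ∀ (g : G) (x : M) (v w : E x) (v' w' : E (g • x)),
    g • (⟨x, v⟩ : TotalSpace F E) = ⟨g • x, v'⟩ → g • (⟨x, w⟩ : TotalSpace F E) = ⟨g • x, w'⟩ →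
    inner ℂ v' w' = inner ℂ v w

/-- `∇` is hermitian: `d⟨φ, ψ⟩ = ⟨∇φ, ψ⟩ + ⟨φ, ∇ψ⟩`. -/
def IsHermitianConnection (cov : CovariantDerivative 𝓘(ℝ, EM) F E) : Prop :=
  ∀ (φ ψ : Π x, E x) (m : M),
    MDifferentiableAt 𝓘(ℝ, EM) (𝓘(ℝ, EM).prod 𝓘(ℝ, F))
      (fun x ↦ (⟨x, φ x⟩ : TotalSpace F E)) m →
    MDifferentiableAt 𝓘(ℝ, EM) (𝓘(ℝ, EM).prod 𝓘(ℝ, F))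
      (fun x ↦ (⟨x, ψ x⟩ : TotalSpace F E)) m →
    ∀ v : TangentSpace 𝓘(ℝ, EM) m,
      mvfderiv 𝓘(ℝ, EM) (fun x ↦ inner ℂ (φ x) (ψ x)) m v
        = inner ℂ (cov φ m v) (ψ m) + inner ℂ (φ m) (cov ψ m v)

/-! ### Curvature, moment map and the total equivariant Chern form -/

variable {G} in
/-- `∇_{X^♯} φ + L_X φ`, where `L_X φ = d/dt|₀ exp(tX) φ` is written as the differential at `1`
of `g ↦ (g φ)(m) ∈ E_m`, applied to `X`. -/
def momentOp [MulAction G (TotalSpace F E)] [IsEquivariantBundle G F E]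
    (cov : CovariantDerivative 𝓘(ℝ, EM) F E) (X : GroupLieAlgebra 𝓘(ℝ, EG) G)
    (φ : Π x, E x) (m : M) : E m :=
  cov φ m (fundamentalField X m)
    + mvfderiv 𝓘(ℝ, EG) (fun g : G ↦ sectionAct (F := F) g φ m) 1 X

variable [FiniteDimensional ℝ EM] [FiniteDimensional ℂ F] [IsManifold 𝓘(ℝ, EM) ∞ M]
  [VectorBundle ℂ F E]

variable (F E) in
/-- A basis of the fiber `E_m`, given by the preferred trivialization at `m`. -/
def fiberBasis (m : M) : Module.Basis (Fin (Module.finrank ℂ F)) ℂ (E m) :=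
  (Module.finBasis ℂ F).map
    ((trivializationAt F E m).continuousLinearEquivAt ℂ m
      (mem_baseSet_trivializationAt F E m)).toLinearEquiv.symm

/-- The curvature endomorphism `R_m(u, v) ∈ End(E_m)`. By tensoriality of `R`, it may be computed
on a basis of `E_m` with arbitrary local smooth extensions of the vectors involved. -/
def curvature (cov : CovariantDerivative 𝓘(ℝ, EM) F E) (m : M)
    (u v : TangentSpace 𝓘(ℝ, EM) m) : E m →ₗ[ℂ] E m :=
  (fiberBasis F E m).constr ℂ fun j ↦
    curvatureOp cov (FiberBundle.extend EM u) (FiberBundle.extend EM v)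
      (FiberBundle.extend F (fiberBasis F E m j)) m

variable {G} in
/-- The moment map `μ(X)_m ∈ End(E_m)`, characterized by `μ(X) φ = ∇_{X^♯} φ + L_X φ`. By
tensoriality, it may be computed on a basis of `E_m` with arbitrary local smooth extensions. -/
def momentMap [MulAction G (TotalSpace F E)] [IsEquivariantBundle G F E]
    (cov : CovariantDerivative 𝓘(ℝ, EM) F E) (X : GroupLieAlgebra 𝓘(ℝ, EG) G) (m : M) :
    E m →ₗ[ℂ] E m :=
  (fiberBasis F E m).constr ℂ fun j ↦
    momentOp cov X (FiberBundle.extend F (fiberBasis F E m j)) m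

end Hermitian

end Group

/-! ### The total equivariant Chern form -/

section Forms

/-- The algebra of complex-valued exterior forms on a real vector space `T`. -/
abbrev Forms (T : Type*) [AddCommGroup T] [Module ℝ T] : Type _ :=
  ExteriorAlgebra ℂ (T →ₗ[ℝ] ℂ)

variable {T : Type*} [AddCommGroup T] [Module ℝ T]

theorem ι_mul_ι_mem_center (a b : T →ₗ[ℝ] ℂ) :
    ExteriorAlgebra.ι ℂ a * ExteriorAlgebra.ι ℂ b ∈ Subalgebra.center ℂ (Forms T) := by
  have anti : ∀ x y : T →ₗ[ℝ] ℂ, ExteriorAlgebra.ι ℂ x * ExteriorAlgebra.ι ℂ y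
      = -(ExteriorAlgebra.ι ℂ y * ExteriorAlgebra.ι ℂ x) := fun x y ↦
    eq_neg_of_add_eq_zero_left (ExteriorAlgebra.ι_add_mul_swap x y)
  rw [Subalgebra.mem_center_iff]
  intro w
  induction w using ExteriorAlgebra.induction with
  | algebraMap r => exact Algebra.commutes r _
  | ι c =>
    rw [← mul_assoc, anti c a, neg_mul, mul_assoc, anti c b, mul_neg, neg_neg, mul_assoc]
  | mul x y hx hy => rw [mul_assoc, hy, ← mul_assoc, hx, mul_assoc]
  | add x y hx hy => rw [add_mul, mul_add, hx, hy]

variable [Module.Finite ℝ T] [Module.Free ℝ T]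

/-- An alternating bilinear `B : T × T → ℂ`, as the element `½ ∑ B(e_k, e_l) e^k ∧ e^l` of the
exterior algebra. It lies in the center, which is a commutative ring containing all even forms. -/
def twoForm (B : T → T → ℂ) : Subalgebra.center ℂ (Forms T) :=
  (1 / 2 : ℂ) • ∑ k, ∑ l, B (Module.finBasis ℝ T k) (Module.finBasis ℝ T l) •
    ⟨ExteriorAlgebra.ι ℂ (Complex.ofRealCLM.toLinearMap ∘ₗ (Module.finBasis ℝ T).coord k) *
      ExteriorAlgebra.ι ℂ (Complex.ofRealCLM.toLinearMap ∘ₗ (Module.finBasis ℝ T).coord l),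
      ι_mul_ι_mem_center _ _⟩

end Forms

section ChernForm

variable {EG : Type*} [NormedAddCommGroup EG] [NormedSpace ℝ EG]
  {G : Type*} [TopologicalSpace G] [ChartedSpace EG G] [Group G]
  {EM : Type*} [NormedAddCommGroup EM] [NormedSpace ℝ EM] [FiniteDimensional ℝ EM]
  {M : Type*} [TopologicalSpace M] [ChartedSpace EM M] [IsManifold 𝓘(ℝ, EM) ∞ M] [MulAction G M]
  {F : Type*} [NormedAddCommGroup F] [NormedSpace ℂ F] [FiniteDimensional ℂ F]
  {E : M → Type*} [∀ x, NormedAddCommGroup (E x)] [∀ x, InnerProductSpace ℂ (E x)]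
  [TopologicalSpace (TotalSpace F E)] [FiberBundle F E] [VectorBundle ℂ F E]
  [MulAction G (TotalSpace F E)] [IsEquivariantBundle G F E]

instance (m : M) : FiniteDimensional ℝ (TangentSpace 𝓘(ℝ, EM) m) :=
  inferInstanceAs (FiniteDimensional ℝ EM)

/-- The total equivariant Chern form `det(1 + (2πi)⁻¹ R + μ(X))`, as a map from the Lie algebra to
(even, complex-valued, inhomogeneous) differential forms on `M`. The matrices of `R_m` and `μ(X)_m`
are taken in one basis of `E_m`, on which the determinant does not depend. -/
def totalEquivariantChernForm (cov : CovariantDerivative 𝓘(ℝ, EM) F E)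
    (X : GroupLieAlgebra 𝓘(ℝ, EG) G) (m : M) :
    Subalgebra.center ℂ (Forms (TangentSpace 𝓘(ℝ, EM) m)) :=
  Matrix.det (1
    + (Matrix.of fun i j ↦ (2 * Real.pi * Complex.I : ℂ)⁻¹ • twoForm fun u v ↦
        LinearMap.toMatrix (fiberBasis F E m) (fiberBasis F E m) (curvature cov m u v) i j)
    + (LinearMap.toMatrix (fiberBasis F E m) (fiberBasis F E m) (momentMap cov X m)).map
        (algebraMap ℂ (Subalgebra.center ℂ (Forms (TangentSpace 𝓘(ℝ, EM) m)))))

end ChernForm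

end EquivariantChern

end

/-! Flatness removes the curvature term, so the Chern form is the function `det (1 + μ(X))`
(`totalEquivariantChernForm_of_flat`). Since the metric is invariant and parallel, differentiating
it along an orbit in two ways, by the group and by the connection, shows that `μ(X)` is
skew-hermitian (`inner_momentMap`). For skew-hermitian `A` one has `(1 + A)(1 - A) = 1 + A*A`, whose
eigenvalues are at least 1. If `det (1 + A) = 1`, they multiply to 1, so all of them equal 1 and `A
= 0` (`eq_zero_of_det_one_add_eq_one`). Hence the Chern form is trivial exactly when the moment map
vanishes.

The moment map is also the obstruction to descent (`descends_iff_momentMap_eq_zero`). A section of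
`E/G` is an invariant section of `E`. On it the Lie derivative is zero, so `μ(X)` acts as `∇` in the
direction `X^♯`. Invariant local sections pass through every vector of `E`, so `μ = 0` says that
they are parallel along the orbits. For a free action the vectors tangent to the orbits are exactly
the kernel of `dq`, by a dimension count. So `μ = 0` makes the derivative of an invariant section
depend only on the image of the direction under `dq`, and invariance of `∇` makes it independent of
the point of the orbit. This is what `exists_descent` needs to define a connection below.

The quotient bundle is built from slices (`exists_slice`). The orbit map of a free action is an
immersion, so the inverse function theorem gives local coordinates `g • σ s`, and properness makes
them unique on a whole saturated open set. The parameter `s` is a chart of `M/G`. Moving vectors to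
the slice by the inverse of `g` turns a trivialization of `E` into one of `E/G`. -/

noncomputable section

set_option linter.unusedSectionVars false

namespace EquivariantChern

open Topology

/-! ### Orbit maps of a free action are immersions. -/

section OrbitMap

open Filter Topology

/-- A curve in a manifold whose velocity vanishes near `t₀` is constant near `t₀`. -/
theorem eventually_eq_of_hasMFDerivAt_zero
    {EM : Type*} [NormedAddCommGroup EM] [NormedSpace ℝ EM]
    {M : Type*} [TopologicalSpace M] [ChartedSpace EM M] [IsManifold 𝓘(ℝ, EM) ∞ M]
    {c : ℝ → M} {t₀ : ℝ}
    (hc : ∀ᶠ t in 𝓝 t₀, HasMFDerivAt 𝓘(ℝ, ℝ) 𝓘(ℝ, EM) c t 0) :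
    ∀ᶠ t in 𝓝 t₀, c t = c t₀ := by
  have hcont : ContinuousAt c t₀ := hc.self_of_nhds.continuousAt
  have hsrc : ∀ᶠ t in 𝓝 t₀, c t ∈ (chartAt EM (c t₀)).source :=
    hcont.eventually_mem ((chartAt EM (c t₀)).open_source.mem_nhds (mem_chart_source _ _))
  obtain ⟨ε, hε, hball⟩ := Metric.eventually_nhds_iff_ball.1 (hc.and hsrc)
  have hder : ∀ t ∈ Metric.ball t₀ ε,
      HasDerivAt (fun t ↦ extChartAt 𝓘(ℝ, EM) (c t₀) (c t)) 0 t := by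
    intro t ht
    obtain ⟨h1, h2⟩ := hball t ht
    have h3 : MDifferentiableAt 𝓘(ℝ, EM) 𝓘(ℝ, EM) (extChartAt 𝓘(ℝ, EM) (c t₀)) (c t) :=
      mdifferentiableAt_extChartAt h2
    have h4 := h3.hasMFDerivAt.comp t h1
    have h5 := hasMFDerivAt_iff_hasFDerivAt.1 h4
    have h6 : HasFDerivAt (fun t ↦ extChartAt 𝓘(ℝ, EM) (c t₀) (c t)) (0 : ℝ →L[ℝ] EM) t := by
      refine h5.congr_fderiv ?_
      exact ContinuousLinearMap.ext fun r ↦ map_zero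
        (mfderiv 𝓘(ℝ, EM) 𝓘(ℝ, EM) (extChartAt 𝓘(ℝ, EM) (c t₀)) (c t))
    simpa using h6.hasDerivAt
  filter_upwards [Metric.ball_mem_nhds t₀ hε] with t ht
  have hconst := (convex_ball t₀ ε).is_const_of_fderivWithin_eq_zero (𝕜 := ℝ)
    (f := fun t ↦ extChartAt 𝓘(ℝ, EM) (c t₀) (c t))
    (fun t ht ↦ (hder t ht).differentiableAt.differentiableWithinAt)
    (fun t ht ↦ by
      rw [fderivWithin_of_isOpen Metric.isOpen_ball ht]
      exact (hder t ht).hasFDerivAt.fderiv.trans (by ext; simp))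
    ht (Metric.mem_ball_self hε)
  exact (extChartAt 𝓘(ℝ, EM) (c t₀)).injOn
    (by simpa using (hball t ht).2) (by simp) hconst

variable {EG : Type*} [NormedAddCommGroup EG] [NormedSpace ℝ EG] [FiniteDimensional ℝ EG]
    {G : Type*} [TopologicalSpace G] [ChartedSpace EG G] [Group G] [LieGroup 𝓘(ℝ, EG) ∞ G]
    {EM : Type*} [NormedAddCommGroup EM] [NormedSpace ℝ EM]
    {M : Type*} [TopologicalSpace M] [ChartedSpace EM M] [IsManifold 𝓘(ℝ, EM) ∞ M]
    [MulAction G M] [ContMDiffSMul 𝓘(ℝ, EG) 𝓘(ℝ, EM) ∞ G M]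

variable (EG EM) in
theorem contMDiff_orbitMap (m : M) :
    ContMDiff 𝓘(ℝ, EG) 𝓘(ℝ, EM) ∞ (fun g : G ↦ g • m) :=
  contMDiff_id.smul contMDiff_const

/-- For a free action the differential of an orbit map is injective. -/
theorem mfderiv_orbitMap_injective [IsCancelSMul G M] (m : M) :
    Function.Injective (mfderiv 𝓘(ℝ, EG) 𝓘(ℝ, EM) (fun g : G ↦ g • m) 1) := by
  rw [injective_iff_map_eq_zero]
  intro X hX
  have : CompleteSpace EG := FiniteDimensional.complete ℝ EG
  have : LieGroup 𝓘(ℝ, EG) (minSmoothness ℝ 3) G :=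
    LieGroup.of_le (n := ∞) (by rw [minSmoothness_of_isRCLikeNormedField]; exact ENat.LEInfty.out)
  have : IsManifold 𝓘(ℝ, EG) 1 G := IsManifold.of_le (n := ∞) (by exact_mod_cast le_top)
  have hv : ContMDiffAt 𝓘(ℝ, EG) 𝓘(ℝ, EG).tangent 1
      (fun g : G ↦ (⟨g, mulInvariantVectorField X g⟩ : TangentBundle 𝓘(ℝ, EG) G)) 1 :=
    (contMDiff_mulInvariantVectorField (𝕜 := ℝ) X).contMDiffAt.of_le (by simp)
  -- The curve `γ` plays the role of `exp(tX)` near `t = 0`: an integral curve through 1 of the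
  -- left-invariant field of `X`.
  obtain ⟨γ, hγ0, hγ⟩ := exists_isMIntegralCurveAt_of_contMDiffAt_boundaryless (t₀ := (0 : ℝ)) hv
  have horb : ∀ g : G, MDifferentiableAt 𝓘(ℝ, EG) 𝓘(ℝ, EM) (fun g : G ↦ g • m) g := fun g ↦
    (contMDiff_orbitMap EG EM m).mdifferentiable (by simp) g
  -- Equivariance `(g * a) • m = g • (a • m)` carries the vanishing of the differential on `X` from
  -- 1 to every `g`.
  have key : ∀ g : G, mfderiv 𝓘(ℝ, EG) 𝓘(ℝ, EM) (fun g : G ↦ g • m) g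
      (mulInvariantVectorField X g) = 0 := by
    intro g
    have hL : MDifferentiableAt 𝓘(ℝ, EG) 𝓘(ℝ, EG) (fun a : G ↦ g * a) 1 :=
      (contMDiff_mul_left (n := ∞)).mdifferentiable (by simp) _
    have hA : MDifferentiableAt 𝓘(ℝ, EM) 𝓘(ℝ, EM) (fun x : M ↦ g • x) ((1 : G) • m) :=
      (ContMDiffSMul.contMDiff_const_smul (I := 𝓘(ℝ, EG)) (n := ∞) g).mdifferentiable (by simp) _
    have e1 : mfderiv 𝓘(ℝ, EG) 𝓘(ℝ, EM) (fun a : G ↦ (g * a) • m) 1 =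
        (mfderiv 𝓘(ℝ, EG) 𝓘(ℝ, EM) (fun g : G ↦ g • m) (g * 1)).comp
          (mfderiv 𝓘(ℝ, EG) 𝓘(ℝ, EG) (fun a : G ↦ g * a) 1) :=
      mfderiv_comp (1 : G) (horb (g * 1)) hL
    have e2 : mfderiv 𝓘(ℝ, EG) 𝓘(ℝ, EM) (fun a : G ↦ g • (a • m)) 1 =
        (mfderiv 𝓘(ℝ, EM) 𝓘(ℝ, EM) (fun x : M ↦ g • x) ((1 : G) • m)).comp
          (mfderiv 𝓘(ℝ, EG) 𝓘(ℝ, EM) (fun g : G ↦ g • m) 1) :=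
      mfderiv_comp (1 : G) hA (horb 1)
    have e3 : (fun a : G ↦ (g * a) • m) = fun a : G ↦ g • (a • m) := by
      funext a; rw [mul_smul]
    rw [e3, e2, mul_one] at e1
    have := congr($e1 X)
    simp only [ContinuousLinearMap.comp_apply, hX, map_zero] at this
    exact this.symm
  have hc : ∀ᶠ t in 𝓝 (0 : ℝ), HasMFDerivAt 𝓘(ℝ, ℝ) 𝓘(ℝ, EM) (fun t ↦ γ t • m) t 0 := by
    filter_upwards [hγ] with t ht
    have h1 := (horb (γ t)).hasMFDerivAt.comp t ht
    have h2 : (mfderiv 𝓘(ℝ, EG) 𝓘(ℝ, EM) (fun g : G ↦ g • m) (γ t)).comp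
        ((1 : ℝ →L[ℝ] ℝ).smulRight (mulInvariantVectorField X (γ t))) = 0 := by
      refine ContinuousLinearMap.ext fun r ↦ ?_
      exact (map_smul _ r _).trans ((congrArg (r • ·) (key (γ t))).trans (smul_zero _))
    exact h1.congr_mfderiv h2
  have hconst := eventually_eq_of_hasMFDerivAt_zero hc
  -- The orbit curve `γ t • m` stands still, so freeness forces `γ t = 1`. The velocity of `γ` at 0,
  -- which is `X`, is then zero.
  have hγ1 : ∀ᶠ t in 𝓝 (0 : ℝ), γ t = 1 := by
    filter_upwards [hconst] with t ht
    rw [hγ0] at ht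
    exact IsCancelSMul.right_cancel _ _ _ ht
  have h0 := hγ.self_of_nhds
  have h0' : HasMFDerivAt 𝓘(ℝ, ℝ) 𝓘(ℝ, EG) γ 0 (0 : ℝ →L[ℝ] EG) :=
    (hasMFDerivAt_const (1 : G) (0 : ℝ)).congr_of_eventuallyEq hγ1
  have h2 := congr($(hasMFDerivAt_unique h0 h0') (1 : ℝ))
  have h3 : mulInvariantVectorField X (γ 0) = 0 := (one_smul ℝ _).symm.trans h2
  rw [hγ0] at h3
  have h4 : mulInvariantVectorField X (1 : G) = X := by
    have h5 : (fun a : G ↦ 1 * a) = id := by funext a; simp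
    have h6 : mfderiv 𝓘(ℝ, EG) 𝓘(ℝ, EG) (fun a : G ↦ 1 * a) 1 =
        ContinuousLinearMap.id ℝ (TangentSpace 𝓘(ℝ, EG) (1 : G)) := by
      rw [h5]; exact mfderiv_id
    exact congr($h6 X)
  rw [← h4, h3]

end OrbitMap

/-! ### Inverse function theorem on an open set, and a linear complement. -/

section InverseFunction

open Topology

/-- The inverse function theorem for smooth maps, with a smooth inverse on an open set. -/
theorem exists_openPartialHomeomorph_of_contDiffOn
    {E F : Type*} [NormedAddCommGroup E] [NormedSpace ℝ E] [CompleteSpace E]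
    [NormedAddCommGroup F] [NormedSpace ℝ F]
    {f : E → F} {s : Set E} (hs : IsOpen s) (hf : ContDiffOn ℝ ∞ f s) {a : E} (ha : a ∈ s)
    (f' : E ≃L[ℝ] F) (hf' : HasFDerivAt f (f' : E →L[ℝ] F) a) :
    ∃ e : OpenPartialHomeomorph E F, a ∈ e.source ∧ e.source ⊆ s ∧ (∀ x, e x = f x) ∧
      ContDiffOn ℝ ∞ e.symm e.target := by
  have hat : ContDiffAt ℝ ∞ f a := hf.contDiffAt (hs.mem_nhds ha)
  set e₀ := hat.toOpenPartialHomeomorph f hf' (by simp) with he₀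
  have hcont : ContinuousOn (fderiv ℝ f) s := hf.continuousOn_fderiv_of_isOpen hs (by simp)
  -- Restricting to the points with invertible derivative makes the inverse smooth on the whole
  -- target, not only at the image of `a`.
  set t : Set E := s ∩ fderiv ℝ f ⁻¹' (Set.range ((↑) : (E ≃L[ℝ] F) → E →L[ℝ] F)) with ht
  have hto : IsOpen t := hcont.isOpen_inter_preimage hs ContinuousLinearEquiv.isOpen
  have hat' : a ∈ t := ⟨ha, f', hf'.fderiv.symm⟩
  refine ⟨e₀.restrOpen t hto, ?_, ?_, fun x ↦ ?_, ?_⟩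
  · exact ⟨hat.mem_toOpenPartialHomeomorph_source hf' (by simp), hat'⟩
  · exact fun x hx ↦ hx.2.1
  · rfl
  · intro y hy
    refine ContDiffAt.contDiffWithinAt ?_
    have hx := (e₀.restrOpen t hto).map_target hy
    obtain ⟨A, hA⟩ := hx.2.2
    refine (e₀.restrOpen t hto).contDiffAt_symm hy (f₀' := A) ?_ ?_
    · rw [hA]
      exact ((hf.contDiffAt (hs.mem_nhds hx.2.1)).differentiableAt (by simp)).hasFDerivAt
    · exact hf.contDiffAt (hs.mem_nhds hx.2.1)

/-- An injective linear map extends to an isomorphism from a product with a model of the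
complement. -/
theorem exists_continuousLinearEquiv_prod
    {E F W : Type*} [NormedAddCommGroup E] [NormedSpace ℝ E] [FiniteDimensional ℝ E]
    [NormedAddCommGroup F] [NormedSpace ℝ F] [FiniteDimensional ℝ F]
    [NormedAddCommGroup W] [NormedSpace ℝ W] [FiniteDimensional ℝ W]
    (hW : Module.finrank ℝ W = Module.finrank ℝ F - Module.finrank ℝ E)
    (T : E →L[ℝ] F) (hT : Function.Injective T) :
    ∃ L : (E × W) ≃L[ℝ] F, ∀ a, L (a, 0) = T a := by
  obtain ⟨C, hC⟩ := Submodule.exists_isCompl (LinearMap.range T.toLinearMap)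
  let e₁ := LinearEquiv.ofInjective T.toLinearMap hT
  have h1 : Module.finrank ℝ (LinearMap.range T.toLinearMap) = Module.finrank ℝ E :=
    e₁.finrank_eq.symm
  have h2 := Submodule.finrank_add_eq_of_isCompl hC
  -- Injectivity of `T` gives `finrank E ≤ finrank F`, so the truncated subtraction in `hW` is the
  -- true dimension of the complement.
  let e₂ : W ≃ₗ[ℝ] C := LinearEquiv.ofFinrankEq W C (by omega)
  refine ⟨((e₁.prodCongr e₂).trans (Submodule.prodEquivOfIsCompl _ C hC)).toContinuousLinearEquiv,
    fun a ↦ ?_⟩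
  simp [e₁]

end InverseFunction

/-! ### Slices of a free and proper action. -/

section Slice

open Topology

/-- A slice of a free action of `G` on `M`: a smooth family `σ` of points, parametrized by an open
set of `W`, such that `(g, s) ↦ g • σ s` is a diffeomorphism onto an open set, with inverse
`(γ, p)`. -/
structure Slice (EG G EM M W : Type*) [NormedAddCommGroup EG] [NormedSpace ℝ EG]
    [TopologicalSpace G] [ChartedSpace EG G] [Group G]
    [NormedAddCommGroup EM] [NormedSpace ℝ EM] [TopologicalSpace M] [ChartedSpace EM M]
    [MulAction G M] [NormedAddCommGroup W] [NormedSpace ℝ W] where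
  /-- the parameter domain -/
  domain : Set W
  /-- the parametrization -/
  σ : W → M
  /-- the transversal coordinate -/
  p : M → W
  /-- the coordinate along the orbits -/
  γ : M → G
  isOpen_domain : IsOpen domain
  contMDiffOn_σ : ContMDiffOn 𝓘(ℝ, W) 𝓘(ℝ, EM) ∞ σ domain
  isOpen_saturation : IsOpen {x | ∃ g : G, ∃ s ∈ domain, g • σ s = x}
  contMDiffOn_p : ContMDiffOn 𝓘(ℝ, EM) 𝓘(ℝ, W) ∞ p {x | ∃ g : G, ∃ s ∈ domain, g • σ s = x}
  contMDiffOn_γ : ContMDiffOn 𝓘(ℝ, EM) 𝓘(ℝ, EG) ∞ γ {x | ∃ g : G, ∃ s ∈ domain, g • σ s = x}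
  p_smul : ∀ (g : G), ∀ s ∈ domain, p (g • σ s) = s
  γ_smul : ∀ (g : G), ∀ s ∈ domain, γ (g • σ s) = g

variable {EG : Type*} [NormedAddCommGroup EG] [NormedSpace ℝ EG] [FiniteDimensional ℝ EG]
    {G : Type*} [TopologicalSpace G] [ChartedSpace EG G] [Group G] [LieGroup 𝓘(ℝ, EG) ∞ G]
    {EM : Type*} [NormedAddCommGroup EM] [NormedSpace ℝ EM] [FiniteDimensional ℝ EM]
    {M : Type*} [TopologicalSpace M] [ChartedSpace EM M] [IsManifold 𝓘(ℝ, EM) ∞ M]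
    [MulAction G M] [ContMDiffSMul 𝓘(ℝ, EG) 𝓘(ℝ, EM) ∞ G M]
    {W : Type*} [NormedAddCommGroup W] [NormedSpace ℝ W] [FiniteDimensional ℝ W]

/-- Points of `M` near `m` are uniquely `g • σ s` with `g` near `1` and `s` near `0`. -/
theorem exists_local_slice [IsCancelSMul G M] (m : M)
    (hW : Module.finrank ℝ W = Module.finrank ℝ EM - Module.finrank ℝ EG) :
    ∃ (σ : W → M) (γ : M → G) (p : M → W) (O : Set G) (S : Set W) (N : Set M),
      IsOpen O ∧ (1 : G) ∈ O ∧ IsOpen S ∧ (0 : W) ∈ S ∧ IsOpen N ∧ σ 0 = m ∧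
      ContMDiffOn 𝓘(ℝ, W) 𝓘(ℝ, EM) ∞ σ S ∧ ContMDiffOn 𝓘(ℝ, EM) 𝓘(ℝ, W) ∞ p N ∧
      ContMDiffOn 𝓘(ℝ, EM) 𝓘(ℝ, EG) ∞ γ N ∧
      (∀ x ∈ N, γ x • σ (p x) = x) ∧
      ∀ g ∈ O, ∀ s ∈ S, g • σ s ∈ N ∧ γ (g • σ s) = g ∧ p (g • σ s) = s := by
  obtain ⟨L, hL⟩ := exists_continuousLinearEquiv_prod (E := EG) (F := EM) (W := W) hW
    (mfderiv 𝓘(ℝ, EG) 𝓘(ℝ, EM) (fun g : G ↦ g • m) 1) (mfderiv_orbitMap_injective m)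
  have : ContinuousSMul G M := ContMDiffSMul.continuousSMul (I := 𝓘(ℝ, EG)) (I' := 𝓘(ℝ, EM)) ∞
  set cG := extChartAt 𝓘(ℝ, EG) (1 : G) with hcG
  set cM := extChartAt 𝓘(ℝ, EM) m with hcM
  have hcGt : IsOpen cG.target := isOpen_extChartAt_target 1
  have hcMt : IsOpen cM.target := isOpen_extChartAt_target m
  have hcMs : IsOpen cM.source := isOpen_extChartAt_source m
  have hcGs : IsOpen cG.source := isOpen_extChartAt_source 1
  -- The slice is affine in the chart at `m`, in the directions that `L` adds to the tangent space
  -- of the orbit.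
  set lin : W → EM := fun s ↦ cM m + L (0, s) with hlin
  have hlin_smooth : ContDiff ℝ ∞ lin :=
    contDiff_const.add (L.contDiff.comp (contDiff_const.prodMk contDiff_id))
  set S₀ : Set W := lin ⁻¹' cM.target with hS₀
  have hS₀o : IsOpen S₀ := hcMt.preimage hlin_smooth.continuous
  have hlin0 : lin 0 = cM m := by
    have : L ((0 : EG), (0 : W)) = 0 := map_zero L
    simp only [hlin, this, add_zero]
  have h0S : (0 : W) ∈ S₀ := by simp [hS₀, hlin0, hcM]
  set σ : W → M := fun s ↦ cM.symm (lin s) with hσ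
  have hσ0 : σ 0 = m := by simp [hσ, hlin0, hcM]
  have hσ_smooth : ContMDiffOn 𝓘(ℝ, W) 𝓘(ℝ, EM) ∞ σ S₀ :=
    (contMDiffOn_extChartAt_symm m).comp hlin_smooth.contMDiff.contMDiffOn fun s hs ↦ hs
  have hcGsymm : ContMDiffOn 𝓘(ℝ, EG) 𝓘(ℝ, EG) ∞ cG.symm cG.target :=
    contMDiffOn_extChartAt_symm (1 : G)
  have hcM_smooth : ContMDiffOn 𝓘(ℝ, EM) 𝓘(ℝ, EM) ∞ cM cM.source :=
    by simpa only [hcM, extChartAt_source] using contMDiffOn_extChartAt (x := m)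
  set Φ : EG × W → M := fun x ↦ cG.symm x.1 • σ x.2 with hΦ
  have hΦ_smooth : ContMDiffOn 𝓘(ℝ, EG × W) 𝓘(ℝ, EM) ∞ Φ (cG.target ×ˢ S₀) :=
    ContMDiffOn.smul (I := 𝓘(ℝ, EG))
      (hcGsymm.comp contDiff_fst.contMDiff.contMDiffOn fun x hx ↦ hx.1)
      (hσ_smooth.comp contDiff_snd.contMDiff.contMDiffOn fun x hx ↦ hx.2)
  set D : Set (EG × W) := (cG.target ×ˢ S₀) ∩ Φ ⁻¹' cM.source with hD
  have hDo : IsOpen D :=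
    hΦ_smooth.continuousOn.isOpen_inter_preimage (hcGt.prod hS₀o) hcMs
  have hf : ContDiffOn ℝ ∞ (fun x ↦ cM (Φ x)) D :=
    contMDiffOn_iff_contDiffOn.1
      (hcM_smooth.comp (hΦ_smooth.mono Set.inter_subset_left) fun x hx ↦ hx.2)
  have hΦ0 : Φ (cG 1, 0) = m := by simp [hΦ, hσ0, hcG]
  have haD : (cG 1, (0 : W)) ∈ D := ⟨⟨by simp [hcG], h0S⟩, by simp [hΦ0, hcM]⟩
  have hfd : DifferentiableAt ℝ (fun x ↦ cM (Φ x)) (cG 1, (0 : W)) :=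
    (hf.contDiffAt (hDo.mem_nhds haD)).differentiableAt (by simp)
  -- The derivative is compared with `L` on the two factors: along the group it is that of the orbit
  -- map, along the slice that of `lin`.
  have hf' : HasFDerivAt (fun x ↦ cM (Φ x)) (L : EG × W →L[ℝ] EM) (cG 1, (0 : W)) := by
    have h1 : HasFDerivAt (fun a : EG ↦ cM (Φ (a, 0)))
        ((fderiv ℝ (fun x ↦ cM (Φ x)) (cG 1, (0 : W))).comp (ContinuousLinearMap.inl ℝ EG W))
        (cG 1) :=
      HasFDerivAt.comp (f := fun a : EG ↦ (a, (0 : W))) (cG 1) hfd.hasFDerivAt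
        (hasFDerivAt_prodMk_left (𝕜 := ℝ) (cG 1) (0 : W))
    have h2 : HasFDerivAt (fun s : W ↦ cM (Φ (cG 1, s)))
        ((fderiv ℝ (fun x ↦ cM (Φ x)) (cG 1, (0 : W))).comp (ContinuousLinearMap.inr ℝ EG W))
        (0 : W) :=
      HasFDerivAt.comp (f := fun s : W ↦ (cG 1, s)) (0 : W) hfd.hasFDerivAt
        (hasFDerivAt_prodMk_right (𝕜 := ℝ) (cG 1) (0 : W))
    have h3 : HasFDerivAt (fun a : EG ↦ cM (Φ (a, 0)))
        (mfderiv 𝓘(ℝ, EG) 𝓘(ℝ, EM) (fun g : G ↦ g • m) 1 : EG →L[ℝ] EM) (cG 1) := by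
      have := ((contMDiff_orbitMap EG EM m).mdifferentiable (by simp) (1 : G)).hasMFDerivAt.2
      simp only [modelWithCornersSelf_coe, Set.range_id] at this
      have hw : writtenInExtChartAt 𝓘(ℝ, EG) 𝓘(ℝ, EM) 1 (fun g : G ↦ g • m) =
          fun a : EG ↦ cM (Φ (a, 0)) := by
        funext a
        simp [writtenInExtChartAt, hΦ, hσ0, hcM, hcG]
      rw [hw] at this
      exact HasFDerivWithinAt.hasFDerivAt this Filter.univ_mem
    have h4 : HasFDerivAt (fun s : W ↦ cM (Φ (cG 1, s)))
        ((L : EG × W →L[ℝ] EM).comp (ContinuousLinearMap.inr ℝ EG W)) (0 : W) := by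
      have h5 : HasFDerivAt lin
          ((L : EG × W →L[ℝ] EM).comp (ContinuousLinearMap.inr ℝ EG W)) (0 : W) :=
        ((L : EG × W →L[ℝ] EM).comp (ContinuousLinearMap.inr ℝ EG W)).hasFDerivAt.const_add (cM m)
      refine h5.congr_of_eventuallyEq ?_
      filter_upwards [hS₀o.mem_nhds h0S] with s hs
      simp only [hΦ, hσ]
      rw [hcG, extChartAt_to_inv, one_smul, cM.right_inv hs]
    convert hfd.hasFDerivAt using 1
    ext x
    · have := congr($(h1.unique h3) x)
      simp only [ContinuousLinearMap.comp_apply] at this ⊢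
      rw [this]
      exact hL x
    · have := congr($(h2.unique h4) x)
      exact this.symm
  have : CompleteSpace (EG × W) := FiniteDimensional.complete ℝ _
  obtain ⟨e, hae, heD, hef, hes⟩ :=
    exists_openPartialHomeomorph_of_contDiffOn hDo hf haD L hf'
  obtain ⟨A, S, hAo, hSo, haA, h0S', hAS⟩ :=
    isOpen_prod_iff.1 e.open_source _ _ hae
  have hASD : ∀ a ∈ A, ∀ s ∈ S, (a, s) ∈ D := fun a ha s hs ↦ heD (hAS ⟨ha, hs⟩)
  set N : Set M := cM.source ∩ cM ⁻¹' e.target with hN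
  have hNo : IsOpen N := (continuousOn_extChartAt m).isOpen_inter_preimage hcMs e.open_target
  have hρ : ContMDiffOn 𝓘(ℝ, EM) 𝓘(ℝ, EG × W) ∞ (fun x ↦ e.symm (cM x)) N :=
    hes.contMDiffOn.comp (hcM_smooth.mono Set.inter_subset_left) fun x hx ↦ hx.2
  have hρD : ∀ x ∈ N, e.symm (cM x) ∈ D := fun x hx ↦ heD (e.map_target hx.2)
  -- The coordinates `γ` and `p` are the two components of the local inverse of `(g, s) ↦ g • σ s`,
  -- read in the charts.
  refine ⟨σ, fun x ↦ cG.symm (e.symm (cM x)).1, fun x ↦ (e.symm (cM x)).2,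
    cG.source ∩ cG ⁻¹' A, S, N, (continuousOn_extChartAt (1 : G)).isOpen_inter_preimage hcGs hAo,
    ⟨by simp [hcG], haA⟩, hSo, h0S', hNo, hσ0,
    hσ_smooth.mono fun s hs ↦ (hASD _ haA s hs).1.2,
    contDiff_snd.contMDiff.comp_contMDiffOn hρ,
    hcGsymm.comp (contDiff_fst.contMDiff.comp_contMDiffOn hρ) fun x hx ↦ (hρD x hx).1.1,
    fun x hx ↦ ?_, fun g hg s hs ↦ ?_⟩
  · refine cM.injOn (hρD x hx).2 hx.1 ?_
    exact (hef _).symm.trans (e.right_inv hx.2)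
  · have hmem : (cG g, s) ∈ e.source := hAS ⟨hg.2, hs⟩
    have h1 : Φ (cG g, s) = g • σ s := by simp only [hΦ]; rw [cG.left_inv hg.1]
    have h2 : cM (g • σ s) = e (cG g, s) := by rw [hef, h1]
    have h3 : e.symm (cM (g • σ s)) = (cG g, s) := by rw [h2, e.left_inv hmem]
    refine ⟨⟨?_, ?_⟩, ?_, ?_⟩
    · rw [← h1]; exact (heD hmem).2
    · change cM (g • σ s) ∈ e.target
      rw [h2]; exact e.map_source hmem
    · exact (congrArg (fun x ↦ cG.symm x.1) h3).trans (cG.left_inv hg.1)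
    · exact congrArg Prod.snd h3

open Pointwise in
/-- A free and proper action has slices. -/
theorem exists_slice [T2Space M] [IsCancelSMul G M] [ProperSMul G M] (m : M)
    (hW : Module.finrank ℝ W = Module.finrank ℝ EM - Module.finrank ℝ EG)
    {V : Set M} (hV : V ∈ 𝓝 m) :
    ∃ S : Slice EG G EM M W, ∃ s ∈ S.domain, S.σ s = m ∧ ∀ s ∈ S.domain, S.σ s ∈ V := by
  classical
  obtain ⟨σ, γ, p, O, S, N, hO, h1O, hS, h0S, hN, hσ0, hσ, hp, hγ, hinv, hinv'⟩ :=
    exists_local_slice (EG := EG) (G := G) (W := W) m hW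
  -- by properness, group elements that move points near `m` to points near `m` are near `1`
  have hclosed : IsClosed ((fun gx : G × M ↦ (gx.1 • gx.2, gx.2)) '' (Oᶜ ×ˢ Set.univ)) :=
    (ProperSMul.isProperMap_smul_pair (G := G) (X := M)).isClosedMap _
      (hO.isClosed_compl.prod isClosed_univ)
  have hmm : (m, m) ∈ ((fun gx : G × M ↦ (gx.1 • gx.2, gx.2)) '' (Oᶜ ×ˢ Set.univ))ᶜ := by
    rintro ⟨⟨g, x⟩, ⟨hg, -⟩, hgx⟩
    simp only [Prod.mk.injEq] at hgx
    obtain ⟨h1, rfl⟩ := hgx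
    exact hg (IsCancelSMul.eq_one_of_smul h1 ▸ h1O)
  obtain ⟨N₁, N₂, hN₁, hN₂, hm₁, hm₂, hN₁₂⟩ := isOpen_prod_iff.1 hclosed.isOpen_compl m m hmm
  have hmove : ∀ (g : G) (x : M), g • x ∈ N₁ → x ∈ N₂ → g ∈ O := by
    intro g x h1 h2
    by_contra hg
    exact hN₁₂ (Set.mk_mem_prod h1 h2) ⟨(g, x), ⟨hg, trivial⟩, rfl⟩
  obtain ⟨V', hV'V, hV'o, hmV'⟩ := mem_nhds_iff.1 hV
  -- Slice points are kept in `N₁ ∩ N₂`, so that a group element moving one to another is in `O`,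
  -- where the local coordinates are unique.
  set B : Set W := S ∩ σ ⁻¹' (V' ∩ (N₁ ∩ N₂)) with hB
  have hBo : IsOpen B := hσ.continuousOn.isOpen_inter_preimage hS (hV'o.inter (hN₁.inter hN₂))
  have huniq : ∀ (g g' : G), ∀ s ∈ B, ∀ s' ∈ B, g • σ s = g' • σ s' → g = g' ∧ s = s' := by
    intro g g' s hs s' hs' h
    have h1 : (g'⁻¹ * g) • σ s = σ s' := by rw [mul_smul, h, inv_smul_smul]
    have h2 : g'⁻¹ * g ∈ O := hmove _ (σ s) (h1 ▸ hs'.2.2.1) hs.2.2.2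
    obtain ⟨-, h3, h4⟩ := hinv' _ h2 s hs.1
    obtain ⟨-, h5, h6⟩ := hinv' _ h1O s' hs'.1
    rw [one_smul] at h5 h6
    rw [h1] at h3 h4
    exact ⟨(inv_mul_eq_one.1 (h3.symm.trans h5)).symm, h4.symm.trans h6⟩
  set U : Set M := {x | ∃ g : G, ∃ s ∈ B, g • σ s = x} with hU
  -- The global coordinates are arbitrary choices. By `huniq` they are nevertheless determined,
  -- which lets them be compared with the smooth local ones.
  choose! γ' p' hp' hγp' using fun (x : M) (hx : x ∈ U) ↦ hx
  have hγp : ∀ (g : G), ∀ s ∈ B, γ' (g • σ s) = g ∧ p' (g • σ s) = s := fun g s hs ↦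
    huniq _ _ _ (hp' _ ⟨g, s, hs, rfl⟩) _ hs (hγp' _ ⟨g, s, hs, rfl⟩)
  have : ContinuousSMul G M := ContMDiffSMul.continuousSMul (I := 𝓘(ℝ, EG)) (I' := 𝓘(ℝ, EM)) ∞
  set P : Set M := N ∩ p ⁻¹' B with hP
  have hPo : IsOpen P := hp.continuousOn.isOpen_inter_preimage hN hBo
  have hPeq : ∀ x ∈ P, ∀ g : G, γ' (g • x) = g * γ x ∧ p' (g • x) = p x := by
    intro x hx g
    have := hγp (g * γ x) (p x) hx.2
    rwa [mul_smul, hinv x hx.1] at this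
  -- Every point of the saturation can be translated into `P`. There the local formulas apply, and
  -- `hPeq` transports their smoothness back.
  have hnear : ∀ x ∈ U, ∃ g : G, g⁻¹ • x ∈ P := by
    rintro x ⟨g, s, hs, rfl⟩
    refine ⟨g, ?_⟩
    have := hinv' 1 h1O s hs.1
    rw [one_smul] at this
    rw [inv_smul_smul]
    exact ⟨this.1, by rw [Set.mem_preimage, this.2.2]; exact hs⟩
  have hsub : ∀ g : G, (fun x : M ↦ g⁻¹ • x) ⁻¹' P ⊆ U := fun g x hx ↦
    ⟨g * γ (g⁻¹ • x), p (g⁻¹ • x), hx.2, by rw [mul_smul, hinv _ hx.1, smul_inv_smul]⟩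
  have hPg : ∀ g : G, IsOpen ((fun x : M ↦ g⁻¹ • x) ⁻¹' P) := fun g ↦
    hPo.preimage (continuous_const_smul _)
  have hsm : ∀ g : G, ContMDiff 𝓘(ℝ, EM) 𝓘(ℝ, EM) ∞ (fun x : M ↦ g • x) := fun g ↦
    ContMDiffSMul.contMDiff_const_smul (I := 𝓘(ℝ, EG)) g
  refine ⟨⟨B, σ, p', γ', hBo, hσ.mono Set.inter_subset_left, ?_, ?_, ?_,
    fun g s hs ↦ (hγp g s hs).2, fun g s hs ↦ (hγp g s hs).1⟩, 0, ?_, hσ0, ?_⟩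
  · rw [isOpen_iff_mem_nhds]
    intro x hx
    obtain ⟨g, hg⟩ := hnear x hx
    exact Filter.mem_of_superset ((hPg g).mem_nhds hg) (hsub g)
  · intro x hx
    obtain ⟨g, hg⟩ := hnear x hx
    refine ContMDiffAt.contMDiffWithinAt ?_
    have h1 : ContMDiffAt 𝓘(ℝ, EM) 𝓘(ℝ, W) ∞ (fun y ↦ p (g⁻¹ • y)) x :=
      (hp.contMDiffAt (hN.mem_nhds hg.1)).comp x (hsm g⁻¹ x)
    refine h1.congr_of_eventuallyEq ?_
    filter_upwards [(hPg g).mem_nhds hg] with y hy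
    have := (hPeq _ hy g).2
    rwa [smul_inv_smul] at this
  · intro x hx
    obtain ⟨g, hg⟩ := hnear x hx
    refine ContMDiffAt.contMDiffWithinAt ?_
    have h1 : ContMDiffAt 𝓘(ℝ, EM) 𝓘(ℝ, EG) ∞ (fun y ↦ g * γ (g⁻¹ • y)) x :=
      (contMDiff_mul_left (a := g)).contMDiffAt.comp x
        ((hγ.contMDiffAt (hN.mem_nhds hg.1)).comp x (hsm g⁻¹ x))
    refine h1.congr_of_eventuallyEq ?_
    filter_upwards [(hPg g).mem_nhds hg] with y hy
    have := (hPeq _ hy g).1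
    rwa [smul_inv_smul] at this
  · refine ⟨h0S, ?_⟩
    rw [Set.mem_preimage, hσ0]
    exact ⟨hmV', hm₁, hm₂⟩
  · exact fun s hs ↦ hV'V hs.2.1

end Slice

/-! ### Slice coordinates on the orbit space. -/

theorem orbitMk_out {G M : Type*} [Group G] [MulAction G M] (b : MulAction.orbitRel.Quotient G M) :
    orbitMk G (Quotient.out b) = b := Quotient.out_eq' b

theorem exists_smul_of_orbitMk_eq {G M : Type*} [Group G] [MulAction G M] {x y : M} (h : orbitMk G x = orbitMk G y) :
    ∃ g : G, g • y = x := Quotient.exact' h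

namespace Slice

variable {EG : Type*} [NormedAddCommGroup EG] [NormedSpace ℝ EG]
    {G : Type*} [TopologicalSpace G] [ChartedSpace EG G] [Group G]
    {EM : Type*} [NormedAddCommGroup EM] [NormedSpace ℝ EM]
    {M : Type*} [TopologicalSpace M] [ChartedSpace EM M]
    [MulAction G M]
    {W : Type*} [NormedAddCommGroup W] [NormedSpace ℝ W]
    (S : Slice EG G EM M W)

/-- The open invariant set of points whose orbit meets the slice. -/
def saturation : Set M := {x | ∃ g : G, ∃ s ∈ S.domain, g • S.σ s = x}

theorem σ_mem {s : W} (hs : s ∈ S.domain) : S.σ s ∈ S.saturation := ⟨1, s, hs, one_smul _ _⟩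

theorem smul_mem_iff (g : G) {x : M} : g • x ∈ S.saturation ↔ x ∈ S.saturation := by
  constructor
  · rintro ⟨h, s, hs, hx⟩
    exact ⟨g⁻¹ * h, s, hs, by rw [mul_smul, hx, inv_smul_smul]⟩
  · rintro ⟨h, s, hs, rfl⟩
    exact ⟨g * h, s, hs, mul_smul _ _ _⟩

theorem p_mem {x : M} (hx : x ∈ S.saturation) : S.p x ∈ S.domain := by
  obtain ⟨g, s, hs, rfl⟩ := hx
  rwa [S.p_smul g s hs]

theorem γ_smul_σ_p {x : M} (hx : x ∈ S.saturation) : S.γ x • S.σ (S.p x) = x := by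
  obtain ⟨g, s, hs, rfl⟩ := hx
  rw [S.p_smul g s hs, S.γ_smul g s hs]

theorem p_σ {s : W} (hs : s ∈ S.domain) : S.p (S.σ s) = s := by
  simpa using S.p_smul 1 s hs

theorem p_smul_of_mem (g : G) {x : M} (hx : x ∈ S.saturation) : S.p (g • x) = S.p x := by
  obtain ⟨h, s, hs, rfl⟩ := hx
  rw [← mul_smul, S.p_smul _ s hs, S.p_smul _ s hs]

theorem γ_smul_of_mem (g : G) {x : M} (hx : x ∈ S.saturation) : S.γ (g • x) = g * S.γ x := by
  obtain ⟨h, s, hs, rfl⟩ := hx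
  rw [← mul_smul, S.γ_smul _ s hs, S.γ_smul _ s hs]

theorem orbitMk_σ_p {x : M} (hx : x ∈ S.saturation) :
    orbitMk G (S.σ (S.p x)) = orbitMk G x := by
  refine Quotient.sound' ⟨(S.γ x)⁻¹, ?_⟩
  change (S.γ x)⁻¹ • x = _
  nth_rewrite 2 [← S.γ_smul_σ_p hx]
  exact inv_smul_smul _ _

/-- The transversal coordinate on the orbit space. -/
def orbitCoord (b : MulAction.orbitRel.Quotient G M) : W := S.p (Quotient.out b)

/-- The coordinate `p` is constant on orbits, so the representative chosen by `Quotient.out` does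
not matter. -/
theorem orbitCoord_orbitMk {x : M} (hx : x ∈ S.saturation) :
    S.orbitCoord (orbitMk G x) = S.p x := by
  obtain ⟨g, hg⟩ := exists_smul_of_orbitMk_eq (orbitMk_out (orbitMk G x))
  rw [orbitCoord, ← hg, S.p_smul_of_mem g hx]

/-- The saturation is a union of orbits. This turns membership in the source of an orbit chart into
a condition on points of `M`. -/
theorem orbitMk_preimage_image : (orbitMk G : M → _) ⁻¹' (orbitMk G '' S.saturation) =
    S.saturation := by
  refine Set.Subset.antisymm ?_ (Set.subset_preimage_image _ _)
  rintro x ⟨y, hy, hxy⟩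
  obtain ⟨g, rfl⟩ := exists_smul_of_orbitMk_eq hxy
  exact (S.smul_mem_iff g).1 hy

variable [ContinuousConstSMul G M]

theorem isOpen_orbitMk_image : IsOpen (orbitMk G '' S.saturation) :=
  isOpenMap_quotient_mk'_mul _ S.isOpen_saturation

/-- The chart of the orbit space given by a slice. -/
def orbitChart : OpenPartialHomeomorph (MulAction.orbitRel.Quotient G M) W where
  toFun := S.orbitCoord
  invFun s := orbitMk G (S.σ s)
  source := orbitMk G '' S.saturation
  target := S.domain
  map_source' := by
    rintro _ ⟨x, hx, rfl⟩
    rw [S.orbitCoord_orbitMk hx]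
    exact S.p_mem hx
  map_target' s hs := ⟨_, S.σ_mem hs, rfl⟩
  left_inv' := by
    rintro _ ⟨x, hx, rfl⟩
    rw [S.orbitCoord_orbitMk hx, S.orbitMk_σ_p hx]
  right_inv' s hs := by rw [S.orbitCoord_orbitMk (S.σ_mem hs), S.p_σ hs]
  open_source := S.isOpen_orbitMk_image
  open_target := S.isOpen_domain
  continuousOn_toFun := by
    -- Continuity on the quotient is tested after composing with `q`, where the coordinate becomes
    -- `p`.
    have hq : IsQuotientMap (orbitMk G : M → MulAction.orbitRel.Quotient G M) :=
      isQuotientMap_quotient_mk'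
    rw [hq.continuousOn_isOpen_iff S.isOpen_orbitMk_image, S.orbitMk_preimage_image]
    exact S.contMDiffOn_p.continuousOn.congr fun x hx ↦ S.orbitCoord_orbitMk hx
  continuousOn_invFun := continuous_quotient_mk'.comp_continuousOn S.contMDiffOn_σ.continuousOn

end Slice

/-! ### The manifold `M/G` and the submersion onto it. -/

section QuotientManifold

variable {EG : Type*} [NormedAddCommGroup EG] [NormedSpace ℝ EG] [FiniteDimensional ℝ EG]
    {G : Type*} [TopologicalSpace G] [ChartedSpace EG G] [Group G] [LieGroup 𝓘(ℝ, EG) ∞ G]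
    {EM : Type*} [NormedAddCommGroup EM] [NormedSpace ℝ EM] [FiniteDimensional ℝ EM]
    {M : Type*} [TopologicalSpace M] [T2Space M] [ChartedSpace EM M] [IsManifold 𝓘(ℝ, EM) ∞ M]
    [MulAction G M] [ContMDiffSMul 𝓘(ℝ, EG) 𝓘(ℝ, EM) ∞ G M] [ProperSMul G M] [IsCancelSMul G M]
    {W : Type*} [NormedAddCommGroup W] [NormedSpace ℝ W] [FiniteDimensional ℝ W]

variable (EG G EM M W) in
/-- The manifold structure on the orbit space of a free and proper action. -/
@[reducible]
def orbitChartedSpace (hW : Module.finrank ℝ W = Module.finrank ℝ EM - Module.finrank ℝ EG) :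
    ChartedSpace W (MulAction.orbitRel.Quotient G M) where
  atlas := Set.range fun S : Slice EG G EM M W ↦ S.orbitChart
  chartAt b := (exists_slice (EG := EG) (G := G) (EM := EM) (W := W) (Quotient.out b) hW
    Filter.univ_mem).choose.orbitChart
  mem_chart_source b := by
    obtain ⟨s, hs, hsb, -⟩ := (exists_slice (EG := EG) (G := G) (EM := EM) (W := W) (Quotient.out b) hW
      Filter.univ_mem).choose_spec
    exact ⟨_, Slice.σ_mem _ hs, by rw [hsb, orbitMk_out]⟩
  chart_mem_atlas b := ⟨_, rfl⟩

/-- The chart change from `S` to `S'` is `s ↦ S'.p (S.σ s)`, a composite of smooth maps through `M`.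
-/
theorem isManifold_orbitChartedSpace
    (hW : Module.finrank ℝ W = Module.finrank ℝ EM - Module.finrank ℝ EG) :
    letI := orbitChartedSpace EG G EM M W hW
    IsManifold 𝓘(ℝ, W) ∞ (MulAction.orbitRel.Quotient G M) := by
  let _ := orbitChartedSpace EG G EM M W hW
  refine isManifold_of_contDiffOn _ _ _ ?_
  rintro _ _ ⟨S, rfl⟩ ⟨S', rfl⟩
  simp only [modelWithCornersSelf_coe, modelWithCornersSelf_coe_symm, Function.comp_id,
    Function.id_comp, Set.range_id, Set.inter_univ, Set.preimage_id]
  have hmem : ∀ s ∈ (S.orbitChart.symm.trans S'.orbitChart).source,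
      s ∈ S.domain ∧ S.σ s ∈ S'.saturation := by
    rintro s ⟨hs, hs'⟩
    refine ⟨hs, ?_⟩
    rw [← S'.orbitMk_preimage_image]
    exact hs'
  have h1 : ContMDiffOn 𝓘(ℝ, W) 𝓘(ℝ, W) ∞ (fun s ↦ S'.p (S.σ s))
      (S.orbitChart.symm.trans S'.orbitChart).source :=
    S'.contMDiffOn_p.comp (S.contMDiffOn_σ.mono fun s hs ↦ (hmem s hs).1)
      fun s hs ↦ (hmem s hs).2
  exact (contMDiffOn_iff_contDiffOn.1 h1).congr fun s hs ↦
    S'.orbitCoord_orbitMk (hmem s hs).2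

/-- The chart of `M` adapted to a slice and a chart of `G`. -/
def Slice.adaptedChart (S : Slice EG G EM M W) (L : EM ≃L[ℝ] W × EG) (g : G) :
    OpenPartialHomeomorph M EM where
  toFun x := L.symm (S.p x, chartAt EG g (S.γ x))
  invFun y := (chartAt EG g).symm (L y).2 • S.σ (L y).1
  source := S.saturation ∩ S.γ ⁻¹' (chartAt EG g).source
  target := L ⁻¹' (S.domain ×ˢ (chartAt EG g).target)
  map_source' x hx := by
    simpa using ⟨S.p_mem hx.1, (chartAt EG g).map_source hx.2⟩
  map_target' y hy := by
    refine ⟨⟨_, _, hy.1, rfl⟩, ?_⟩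
    rw [Set.mem_preimage, S.γ_smul _ _ hy.1]
    exact (chartAt EG g).map_target hy.2
  left_inv' x hx := by
    simp [(chartAt EG g).left_inv hx.2, S.γ_smul_σ_p hx.1]
  right_inv' y hy := by
    rw [S.γ_smul _ _ hy.1, S.p_smul _ _ hy.1, (chartAt EG g).right_inv hy.2]
    simp
  open_source := S.contMDiffOn_γ.continuousOn.isOpen_inter_preimage S.isOpen_saturation
    (chartAt EG g).open_source
  open_target := (S.isOpen_domain.prod (chartAt EG g).open_target).preimage L.continuous
  continuousOn_toFun := by
    refine L.symm.continuous.comp_continuousOn (ContinuousOn.prodMk ?_ ?_)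
    · exact S.contMDiffOn_p.continuousOn.mono Set.inter_subset_left
    · exact (chartAt EG g).continuousOn.comp
        (S.contMDiffOn_γ.continuousOn.mono Set.inter_subset_left) fun x hx ↦ hx.2
  continuousOn_invFun := by
    refine ContinuousOn.smul ?_ ?_
    · exact (chartAt EG g).continuousOn_symm.comp
        (continuous_snd.comp L.continuous).continuousOn fun y hy ↦ hy.2
    · exact S.contMDiffOn_σ.continuousOn.comp
        (continuous_fst.comp L.continuous).continuousOn fun y hy ↦ hy.1

theorem Slice.adaptedChart_mem_maximalAtlas (S : Slice EG G EM M W) (L : EM ≃L[ℝ] W × EG) (g : G) :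
    S.adaptedChart L g ∈ IsManifold.maximalAtlas 𝓘(ℝ, EM) ∞ M := by
  have : IsManifold 𝓘(ℝ, EG) ∞ G := inferInstance
  refine (S.adaptedChart L g).mem_maximalAtlas_of_contMDiffOn ?_ ?_
  · refine L.symm.contDiff.contMDiff.comp_contMDiffOn (ContMDiffOn.prodMk_space ?_ ?_)
    · exact S.contMDiffOn_p.mono Set.inter_subset_left
    · exact (contMDiffOn_chart (x := g)).comp
        (S.contMDiffOn_γ.mono Set.inter_subset_left) fun x hx ↦ hx.2
  · refine ContMDiffOn.smul (I := 𝓘(ℝ, EG)) (f := fun y ↦ (chartAt EG g).symm (L y).2)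
      (g := fun y ↦ S.σ (L y).1) ?_ ?_
    · exact (contMDiffOn_chart_symm (x := g)).comp
        (contDiff_snd.comp L.contDiff).contMDiff.contMDiffOn fun y hy ↦ hy.2
    · exact S.contMDiffOn_σ.comp
        (contDiff_fst.comp L.contDiff).contMDiff.contMDiffOn fun y hy ↦ hy.1

/-- In the adapted chart of `M` and the chart of the same slice on `M/G`, the quotient map is the
projection `W × EG → W`. -/
theorem isSubmersion_orbitMk
    (hW : Module.finrank ℝ W = Module.finrank ℝ EM - Module.finrank ℝ EG) :
    letI := orbitChartedSpace EG G EM M W hW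
    Manifold.IsSubmersion 𝓘(ℝ, EM) 𝓘(ℝ, W) ∞
      (orbitMk G : M → MulAction.orbitRel.Quotient G M) := by
  let _ := orbitChartedSpace EG G EM M W hW
  have := isManifold_orbitChartedSpace (EG := EG) (G := G) (EM := EM) (M := M) hW
  refine Manifold.IsSubmersionOfComplement.isSubmersion (F := EG) fun m ↦ ?_
  -- The orbit map being an immersion bounds the dimension of `G`. Without this bound the
  -- subtraction in `hW` could truncate and `EM ≃ W × EG` would fail.
  have hle : Module.finrank ℝ EG ≤ Module.finrank ℝ EM :=
    LinearMap.finrank_le_finrank_of_injective (R := ℝ) (M := EG) (M' := EM)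
      (f := (mfderiv 𝓘(ℝ, EG) 𝓘(ℝ, EM) (fun g : G ↦ g • m) 1 : EG →L[ℝ] EM).toLinearMap)
      (mfderiv_orbitMap_injective m)
  let L : EM ≃L[ℝ] W × EG := ContinuousLinearEquiv.ofFinrankEq (by
    rw [Module.finrank_prod]; omega)
  obtain ⟨S, s, hs, rfl, -⟩ := exists_slice (EG := EG) (G := G) (EM := EM) (W := W) m hW
    Filter.univ_mem
  refine Manifold.IsSubmersionAtOfComplement.mk_of_continuousAt
    (continuous_quotient_mk'.continuousAt) L (S.adaptedChart L (S.γ (S.σ s))) S.orbitChart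
    ⟨S.σ_mem hs, mem_chart_source _ _⟩ ⟨_, S.σ_mem hs, rfl⟩
    (S.adaptedChart_mem_maximalAtlas L _)
    (IsManifold.subset_maximalAtlas ⟨S, rfl⟩) ?_
  intro y hy
  have hy' : y ∈ (S.adaptedChart L (S.γ (S.σ s))).target := by simpa using hy
  have h1 : S.orbitCoord (orbitMk G ((chartAt EG (S.γ (S.σ s))).symm (L y).2 • S.σ (L y).1)) =
      (L y).1 := by
    rw [S.orbitCoord_orbitMk ⟨_, _, hy'.1, rfl⟩, S.p_smul _ _ hy'.1]
  simpa using! h1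

end QuotientManifold

/-! ### Linear structure on the fibers of `E/G`. -/

section OrbitFiberAlgebra

variable {G : Type*} [Group G] {M : Type*} [MulAction G M]
  {F : Type*} {E : M → Type*} [∀ x, AddCommGroup (E x)] [∀ x, Module ℂ (E x)]
  [MulAction G (TotalSpace F E)] [IsEquivariantBundle G F E]

variable (G F E) in
/-- The action of `g` as a linear map from the fiber over `x` to the fiber over `g • x`. -/
def fiberAct (g : G) (x : M) : E x →ₗ[ℂ] E (g • x) :=
  (IsEquivariantBundle.exists_linearMap (F := F) (E := E) g x).choose

theorem smul_mk_eq (g : G) (x : M) (v : E x) :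
    g • (⟨x, v⟩ : TotalSpace F E) = ⟨g • x, fiberAct G F E g x v⟩ :=
  (IsEquivariantBundle.exists_linearMap (F := F) (E := E) g x).choose_spec v

/-- The orbit of a vector over `m`, as a point of the fiber of `E/G` over the orbit `b` of `m`. -/
def fiberMkAt (F : Type*) [MulAction G (TotalSpace F E)] [IsEquivariantBundle G F E]
    {m : M} {b : MulAction.orbitRel.Quotient G M} (h : orbitMk G m = b) (v : E m) :
    OrbitFiber G F E b :=
  ⟨Quotient.mk'' (⟨m, v⟩ : TotalSpace F E), h⟩

theorem fiberMkAt_fiberAct (g : G) {m : M} {b : MulAction.orbitRel.Quotient G M}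
    (h : orbitMk G m = b) (h' : orbitMk G (g • m) = b) (v : E m) :
    fiberMkAt F h' (fiberAct G F E g m v) = fiberMkAt F h v :=
  Subtype.ext (Quotient.sound' ⟨g, smul_mk_eq g m v⟩)

/-- The action of a group element taking `m` to `m'` serves as `A`. Its linearity makes the
structures on the fiber independent of the representative. -/
theorem exists_linearMap_fiberMkAt {m m' : M} {b : MulAction.orbitRel.Quotient G M}
    (h : orbitMk G m = b) (h' : orbitMk G m' = b) :
    ∃ A : E m →ₗ[ℂ] E m', ∀ v, fiberMkAt F h' (A v) = fiberMkAt F h v := by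
  obtain ⟨g, rfl⟩ := exists_smul_of_orbitMk_eq (h'.trans h.symm)
  exact ⟨fiberAct G F E g m, fun v ↦ fiberMkAt_fiberAct g h h' v⟩

theorem fiberMkAt_surjective {m : M} {b : MulAction.orbitRel.Quotient G M}
    (h : orbitMk G m = b) : Function.Surjective (fiberMkAt (E := E) F h) := by
  rintro ⟨e, he⟩
  induction e using Quotient.inductionOn' with
  | h p =>
    obtain ⟨x, v⟩ := p
    obtain ⟨A, hA⟩ := exists_linearMap_fiberMkAt (F := F) (E := E) (m := x) he h
    exact ⟨A v, hA v⟩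

/-- A group element relating two vectors over `m` fixes `m`, so by freeness it is 1. -/
theorem fiberMkAt_injective [IsCancelSMul G M] {m : M} {b : MulAction.orbitRel.Quotient G M}
    (h : orbitMk G m = b) : Function.Injective (fiberMkAt (E := E) F h) := by
  intro v w hvw
  obtain ⟨g, hg⟩ : ∃ g : G, g • (⟨m, w⟩ : TotalSpace F E) = ⟨m, v⟩ :=
    Quotient.exact' (congrArg Subtype.val hvw)
  have h1 : g • m = m := by
    have := congrArg TotalSpace.proj hg
    rwa [proj_smul] at this
  obtain rfl := IsCancelSMul.eq_one_of_smul h1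
  rw [one_smul] at hg
  exact (TotalSpace.mk_inj.1 hg).symm

/-- The points of the total space of `E/G` are orbits of `G` in the total space of `E`. -/
theorem orbitTotalSpace_ext {p q : TotalSpace F (OrbitFiber G F E)} (h : p.2.1 = q.2.1) :
    p = q := by
  obtain ⟨b, e, he⟩ := p
  obtain ⟨b', e', he'⟩ := q
  obtain rfl : e = e' := h
  obtain rfl : b = b' := he.symm.trans he'
  rfl

variable [IsCancelSMul G M]

variable (F E) in
/-- The fiber of `E/G` over an orbit is the fiber of `E` over any representative. -/
def fiberMkEquiv {m : M} {b : MulAction.orbitRel.Quotient G M} (h : orbitMk G m = b) :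
    E m ≃ OrbitFiber G F E b :=
  Equiv.ofBijective (fiberMkAt F h) ⟨fiberMkAt_injective h, fiberMkAt_surjective h⟩

variable (G F E) in
/-- The vector space structure on the fibers of `E/G`. -/
@[reducible]
def orbitFiberAddCommGroup (b : MulAction.orbitRel.Quotient G M) :
    AddCommGroup (OrbitFiber G F E b) :=
  (fiberMkEquiv F E (orbitMk_out b)).symm.addCommGroup

attribute [local instance] orbitFiberAddCommGroup

variable (G F E) in
/-- The complex vector space structure on the fibers of `E/G`. -/
@[reducible]
def orbitFiberModule (b : MulAction.orbitRel.Quotient G M) :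
    Module ℂ (OrbitFiber G F E b) :=
  (fiberMkEquiv F E (orbitMk_out b)).symm.module ℂ

attribute [local instance] orbitFiberModule

/-- Addition is defined by transport from the fiber over `Quotient.out b`. The linear map `A` moves
the fiber over `m` there. -/
theorem fiberMkAt_add {m : M} {b : MulAction.orbitRel.Quotient G M} (h : orbitMk G m = b)
    (v w : E m) : fiberMkAt F h (v + w) = fiberMkAt F h v + fiberMkAt F h w := by
  obtain ⟨A, hA⟩ := exists_linearMap_fiberMkAt (F := F) (E := E) h (orbitMk_out b)
  let e := (fiberMkEquiv F E (orbitMk_out b)).symm.linearEquiv ℂ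
  have he : ∀ u, e.symm u = fiberMkAt F (orbitMk_out b) u := fun u ↦ rfl
  rw [← hA, ← hA, ← hA, ← he, ← he, ← he, map_add, map_add]

theorem fiberMkAt_smul {m : M} {b : MulAction.orbitRel.Quotient G M} (h : orbitMk G m = b)
    (c : ℂ) (v : E m) : fiberMkAt F h (c • v) = c • fiberMkAt F h v := by
  obtain ⟨A, hA⟩ := exists_linearMap_fiberMkAt (F := F) (E := E) h (orbitMk_out b)
  let e := (fiberMkEquiv F E (orbitMk_out b)).symm.linearEquiv ℂ
  have he : ∀ u, e.symm u = fiberMkAt F (orbitMk_out b) u := fun u ↦ rfl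
  rw [← hA, ← hA, ← he, ← he, map_smul, map_smul]

end OrbitFiberAlgebra

/-! ### Trivializations of `E/G` from slices. -/

section OrbitBundle

attribute [local instance] orbitFiberAddCommGroup orbitFiberModule

variable {EG : Type*} [NormedAddCommGroup EG] [NormedSpace ℝ EG]
    {G : Type*} [TopologicalSpace G] [ChartedSpace EG G] [Group G]
    {EM : Type*} [NormedAddCommGroup EM] [NormedSpace ℝ EM]
    {M : Type*} [TopologicalSpace M] [ChartedSpace EM M]
    [MulAction G M] [IsCancelSMul G M] [ContinuousConstSMul G M]
    {W : Type*} [NormedAddCommGroup W] [NormedSpace ℝ W]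
    {F : Type*} [NormedAddCommGroup F] [NormedSpace ℂ F]
    {E : M → Type*} [∀ x, AddCommGroup (E x)] [∀ x, Module ℂ (E x)]
    [∀ x, TopologicalSpace (E x)]
    [TopologicalSpace (TotalSpace F E)] [FiberBundle F E]
    [MulAction G (TotalSpace F E)] [IsEquivariantBundle G F E]

/-- The fiber coordinate of a vector, after moving it to the slice. -/
def Slice.fiberCoord (S : Slice EG G EM M W) (t : Trivialization F (π F E))
    (p : TotalSpace F E) : F :=
  (t ((S.γ p.proj)⁻¹ • p)).2

/-- Since `γ (g • x) = g * γ x`, the element `g` cancels. Hence the coordinate descends to orbits in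
the total space. -/
theorem Slice.fiberCoord_smul (S : Slice EG G EM M W) (t : Trivialization F (π F E))
    (g : G) {p : TotalSpace F E} (hp : p.proj ∈ S.saturation) :
    S.fiberCoord t (g • p) = S.fiberCoord t p := by
  rw [Slice.fiberCoord, Slice.fiberCoord, proj_smul, S.γ_smul_of_mem g hp, mul_inv_rev, mul_smul,
    inv_smul_smul]

theorem Slice.fiberCoord_σ (S : Slice EG G EM M W) (t : Trivialization F (π F E))
    {s : W} (hs : s ∈ S.domain) (v : E (S.σ s)) :
    S.fiberCoord t ⟨S.σ s, v⟩ = (t ⟨S.σ s, v⟩).2 := by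
  have : S.γ (S.σ s) = 1 := by simpa using S.γ_smul 1 s hs
  rw [Slice.fiberCoord, this, inv_one, one_smul]

/-- The fiber coordinate on the orbit space of the total space. -/
def Slice.orbitFiberCoord (S : Slice EG G EM M W) (t : Trivialization F (π F E))
    (w : MulAction.orbitRel.Quotient G (TotalSpace F E)) : F :=
  S.fiberCoord t (Quotient.out w)

theorem Slice.orbitFiberCoord_mk (S : Slice EG G EM M W) (t : Trivialization F (π F E))
    {p : TotalSpace F E} (hp : p.proj ∈ S.saturation) :
    S.orbitFiberCoord t (Quotient.mk'' p) = S.fiberCoord t p := by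
  obtain ⟨g, hg⟩ := exists_smul_of_orbitMk_eq (orbitMk_out (orbitMk G p))
  change S.fiberCoord t (Quotient.out (orbitMk G p)) = _
  rw [← hg, S.fiberCoord_smul t g hp]

theorem Slice.orbitMk_σ_orbitCoord (S : Slice EG G EM M W)
    {b : MulAction.orbitRel.Quotient G M} (hb : b ∈ S.orbitChart.source) :
    orbitMk G (S.σ (S.orbitCoord b)) = b := S.orbitChart.left_inv hb

theorem Slice.orbitCoord_mem (S : Slice EG G EM M W)
    {b : MulAction.orbitRel.Quotient G M} (hb : b ∈ S.orbitChart.source) :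
    S.orbitCoord b ∈ S.domain := S.orbitChart.map_source hb

/-- The trivialization of `E/G` given by a slice and a trivialization of `E`. -/
def Slice.pretrivialization (S : Slice EG G EM M W) (t : Trivialization F (π F E))
    (hS : ∀ s ∈ S.domain, S.σ s ∈ t.baseSet) :
    Pretrivialization F (π F (OrbitFiber G F E)) where
  toFun p := (p.proj, S.orbitFiberCoord t p.2.1)
  invFun x := ⟨orbitMk G (S.σ (S.orbitCoord x.1)),
    fiberMk G F (t.symm (S.σ (S.orbitCoord x.1)) x.2)⟩
  source := π F (OrbitFiber G F E) ⁻¹' S.orbitChart.source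
  target := S.orbitChart.source ×ˢ Set.univ
  baseSet := S.orbitChart.source
  map_source' p hp := ⟨hp, trivial⟩
  map_target' x hx := by
    change orbitMk G (S.σ (S.orbitCoord x.1)) ∈ S.orbitChart.source
    rw [S.orbitMk_σ_orbitCoord hx.1]
    exact hx.1
  left_inv' := by
    rintro ⟨b, e⟩ hb
    replace hb : b ∈ S.orbitChart.source := hb
    -- Each vector of `E/G` is represented over the slice, where `γ = 1` and the fiber coordinate is
    -- that of `t` itself.
    obtain ⟨v, rfl⟩ := fiberMkAt_surjective (S.orbitMk_σ_orbitCoord hb) e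
    refine orbitTotalSpace_ext ?_
    have h1 := S.orbitFiberCoord_mk t (p := ⟨S.σ (S.orbitCoord b), v⟩)
      (S.σ_mem (S.orbitCoord_mem hb))
    rw [S.fiberCoord_σ t (S.orbitCoord_mem hb)] at h1
    have h2 : t.symm (S.σ (S.orbitCoord b)) (t ⟨S.σ (S.orbitCoord b), v⟩).2 = v :=
      t.symm_apply_apply_mk (hS _ (S.orbitCoord_mem hb)) v
    change (Quotient.mk'' (⟨_, t.symm (S.σ (S.orbitCoord b)) (S.orbitFiberCoord t (Quotient.mk'' _))⟩
      : TotalSpace F E) : MulAction.orbitRel.Quotient G (TotalSpace F E)) = Quotient.mk'' _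
    rw [h1, h2]
  right_inv' := by
    rintro ⟨b, v⟩ ⟨hb, -⟩
    replace hb : b ∈ S.orbitChart.source := hb
    refine Prod.ext (S.orbitMk_σ_orbitCoord hb) ?_
    change S.orbitFiberCoord t (Quotient.mk'' _) = v
    rw [S.orbitFiberCoord_mk t (S.σ_mem (S.orbitCoord_mem hb)),
      S.fiberCoord_σ t (S.orbitCoord_mem hb)]
    exact congrArg Prod.snd (t.apply_mk_symm (hS _ (S.orbitCoord_mem hb)) v)
  open_target := S.orbitChart.open_source.prod isOpen_univ
  open_baseSet := S.orbitChart.open_source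
  source_eq := rfl
  target_eq := rfl
  proj_toFun p hp := rfl

variable (S : Slice EG G EM M W) (t : Trivialization F (π F E))
    (hS : ∀ s ∈ S.domain, S.σ s ∈ t.baseSet)

/-- The coordinate may be computed on any representative in the saturation. Points off the slice are
needed for smoothness of transitions and of `E → E/G`. -/
theorem Slice.pretrivialization_mk {m : M} (hm : m ∈ S.saturation) (v : E m)
    {b : MulAction.orbitRel.Quotient G M} (h : orbitMk G m = b) :
    (S.pretrivialization t hS ⟨b, fiberMkAt F h v⟩).2 = S.fiberCoord t ⟨m, v⟩ :=
  S.orbitFiberCoord_mk t (p := ⟨m, v⟩) hm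

/-- Over a slice point the coordinate is that of `t`, so linearity is inherited from `t`. -/
theorem Slice.pretrivialization_isLinear_complex [t.IsLinear ℂ] :
    (S.pretrivialization t hS).IsLinear ℂ where
  linear b hb := by
    replace hb : b ∈ S.orbitChart.source := hb
    have hs := S.orbitCoord_mem hb
    have hb' := S.orbitMk_σ_orbitCoord hb
    have hlin := t.linear ℂ (hS _ hs)
    have key : ∀ v : E (S.σ (S.orbitCoord b)),
        (S.pretrivialization t hS ⟨b, fiberMkAt F hb' v⟩).2 =
        (t ⟨S.σ (S.orbitCoord b), v⟩).2 := fun v ↦ by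
      rw [S.pretrivialization_mk t hS (S.σ_mem hs), S.fiberCoord_σ t hs]
    constructor
    · intro e e'
      obtain ⟨v, rfl⟩ := fiberMkAt_surjective hb' e
      obtain ⟨v', rfl⟩ := fiberMkAt_surjective hb' e'
      rw [← fiberMkAt_add, key, key, key, hlin.map_add]
    · intro c e
      obtain ⟨v, rfl⟩ := fiberMkAt_surjective hb' e
      rw [← fiberMkAt_smul, key, key, hlin.map_smul]

theorem Slice.pretrivialization_isLinear_real [t.IsLinear ℂ] :
    (S.pretrivialization t hS).IsLinear ℝ where
  linear b hb := by
    have h := (S.pretrivialization_isLinear_complex t hS).linear b hb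
    exact ⟨h.map_add, fun c x ↦ h.map_smul (c : ℂ) x⟩

theorem Slice.pretrivialization_symm {b : MulAction.orbitRel.Quotient G M}
    (hb : b ∈ S.orbitChart.source) (v : F) :
    (S.pretrivialization t hS).symm b v =
      fiberMkAt F (S.orbitMk_σ_orbitCoord hb) (t.symm (S.σ (S.orbitCoord b)) v) := by
  have h1 := (S.pretrivialization t hS).mk_symm (b := b) hb v
  have h2 : (S.pretrivialization t hS).toPartialEquiv.symm (b, v) =
      ⟨b, fiberMkAt F (S.orbitMk_σ_orbitCoord hb) (t.symm (S.σ (S.orbitCoord b)) v)⟩ :=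
    orbitTotalSpace_ext rfl
  exact TotalSpace.mk_inj.1 (h1.trans h2)

end OrbitBundle

/-- A family of linear maps on a finite-dimensional space is smooth if it is pointwise smooth. -/
theorem contMDiffWithinAt_clm_of_apply
    {EB : Type*} [NormedAddCommGroup EB] [NormedSpace ℝ EB]
    {H : Type*} [TopologicalSpace H] {I : ModelWithCorners ℝ EB H}
    {B : Type*} [TopologicalSpace B] [ChartedSpace H B]
    {F F' : Type*} [NormedAddCommGroup F] [NormedSpace ℝ F] [FiniteDimensional ℝ F]
    [NormedAddCommGroup F'] [NormedSpace ℝ F'] {n : ℕ∞ω}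
    {f : B → F →L[ℝ] F'} {s : Set B} {x : B}
    (hf : ∀ v, ContMDiffWithinAt I 𝓘(ℝ, F') n (fun b ↦ f b v) s x) :
    ContMDiffWithinAt I 𝓘(ℝ, F →L[ℝ] F') n f s x := by
  -- The family is a finite sum of the rank-one maps `b.coord i ⊗ f (b i)`, each smooth because `f
  -- (b i)` is.
  let b := Module.finBasis ℝ F
  have h1 : ∀ y, f y = ∑ i, ContinuousLinearMap.smulRightL ℝ F F'
      (LinearMap.toContinuousLinearMap (b.coord i)) (f y (b i)) := by
    intro y
    ext v
    conv_lhs => rw [← b.sum_repr v, map_sum]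
    simp
  have h2 : f = fun y ↦ ∑ i, ContinuousLinearMap.smulRightL ℝ F F'
      (LinearMap.toContinuousLinearMap (b.coord i)) (f y (b i)) := funext h1
  rw [h2]
  refine ContMDiffWithinAt.sum fun i _ ↦ ?_
  exact (ContinuousLinearMap.contDiff _).contMDiff.contMDiffAt.comp_contMDiffWithinAt x (hf (b i))

/-! ### Smooth transition functions and fiber topologies of `E/G`. -/

section OrbitBundle

attribute [local instance] orbitFiberAddCommGroup orbitFiberModule

variable {EG : Type*} [NormedAddCommGroup EG] [NormedSpace ℝ EG] [FiniteDimensional ℝ EG]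
    {G : Type*} [TopologicalSpace G] [ChartedSpace EG G] [Group G] [LieGroup 𝓘(ℝ, EG) ∞ G]
    {EM : Type*} [NormedAddCommGroup EM] [NormedSpace ℝ EM] [FiniteDimensional ℝ EM]
    {M : Type*} [TopologicalSpace M] [T2Space M] [ChartedSpace EM M] [IsManifold 𝓘(ℝ, EM) ∞ M]
    [MulAction G M] [ContMDiffSMul 𝓘(ℝ, EG) 𝓘(ℝ, EM) ∞ G M] [ProperSMul G M] [IsCancelSMul G M]
    {W : Type*} [NormedAddCommGroup W] [NormedSpace ℝ W] [FiniteDimensional ℝ W]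
    {F : Type*} [NormedAddCommGroup F] [NormedSpace ℂ F] [FiniteDimensional ℂ F]
    {E : M → Type*} [∀ x, AddCommGroup (E x)] [∀ x, Module ℂ (E x)]
    [∀ x, TopologicalSpace (E x)]
    [TopologicalSpace (TotalSpace F E)] [FiberBundle F E]
    [VectorBundle ℂ F E] [VectorBundle ℝ F E] [ContMDiffVectorBundle ∞ F E 𝓘(ℝ, EM)]
    [MulAction G (TotalSpace F E)] [IsEquivariantBundle G F E]
    [ContMDiffSMul 𝓘(ℝ, EG) (𝓘(ℝ, EM).prod 𝓘(ℝ, F)) ∞ G (TotalSpace F E)]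

/-- Moving `p` by the inverse of `γ` is smooth and lands over the slice, inside the source of the
smooth trivialization `t`. -/
theorem Slice.contMDiffOn_fiberCoord (S : Slice EG G EM M W) (t : Trivialization F (π F E))
    [MemTrivializationAtlas t] (hS : ∀ s ∈ S.domain, S.σ s ∈ t.baseSet) :
    ContMDiffOn (𝓘(ℝ, EM).prod 𝓘(ℝ, F)) 𝓘(ℝ, F) ∞ (S.fiberCoord t)
      (π F E ⁻¹' S.saturation) := by
  have h1 : ContMDiffOn (𝓘(ℝ, EM).prod 𝓘(ℝ, F)) 𝓘(ℝ, EG) ∞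
      (fun p : TotalSpace F E ↦ (S.γ p.proj)⁻¹) (π F E ⁻¹' S.saturation) :=
    (S.contMDiffOn_γ.comp (contMDiff_proj E).contMDiffOn fun p hp ↦ hp).inv
  have h2 : ContMDiffOn (𝓘(ℝ, EM).prod 𝓘(ℝ, F)) (𝓘(ℝ, EM).prod 𝓘(ℝ, F)) ∞
      (fun p : TotalSpace F E ↦ (S.γ p.proj)⁻¹ • p) (π F E ⁻¹' S.saturation) :=
    h1.smul contMDiffOn_id
  have h3 : Set.MapsTo (fun p : TotalSpace F E ↦ (S.γ p.proj)⁻¹ • p) (π F E ⁻¹' S.saturation)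
      t.source := by
    intro p hp
    rw [t.mem_source, proj_smul]
    have := S.γ_smul_σ_p hp
    nth_rewrite 2 [← this]
    rw [inv_smul_smul]
    exact hS _ (S.p_mem hp)
  exact contMDiff_snd.comp_contMDiffOn (t.contMDiffOn.comp h2 h3)

/-- The transition functions of `E/G` are smooth. -/
theorem Slice.contMDiffOn_transition (S S' : Slice EG G EM M W) (t t' : Trivialization F (π F E))
    [MemTrivializationAtlas t] [MemTrivializationAtlas t']
    (hS : ∀ s ∈ S.domain, S.σ s ∈ t.baseSet) (hS' : ∀ s ∈ S'.domain, S'.σ s ∈ t'.baseSet)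
    [ChartedSpace W (MulAction.orbitRel.Quotient G M)]
    [IsManifold 𝓘(ℝ, W) ∞ (MulAction.orbitRel.Quotient G M)]
    (hchart : S.orbitChart ∈
      IsManifold.maximalAtlas 𝓘(ℝ, W) ∞ (MulAction.orbitRel.Quotient G M)) (v : F) :
    ContMDiffOn 𝓘(ℝ, W) 𝓘(ℝ, F) ∞
      (fun b ↦ (S'.pretrivialization t' hS' ⟨b, (S.pretrivialization t hS).symm b v⟩).2)
      (S.orbitChart.source ∩ S'.orbitChart.source) := by
  -- The orbit `b` is lifted smoothly to the slice `S`. The vector with `t`-coordinate `v` over that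
  -- lift is then read by the fiber coordinate of `S'`.
  have h1 : ContMDiffOn 𝓘(ℝ, W) 𝓘(ℝ, EM) ∞ (fun b ↦ S.σ (S.orbitCoord b))
      (S.orbitChart.source ∩ S'.orbitChart.source) :=
    S.contMDiffOn_σ.comp ((contMDiffOn_of_mem_maximalAtlas hchart).mono Set.inter_subset_left)
      fun b hb ↦ S.orbitCoord_mem hb.1
  have h2 : ContMDiffOn 𝓘(ℝ, W) (𝓘(ℝ, EM).prod 𝓘(ℝ, F)) ∞
      (fun b ↦ t.toOpenPartialHomeomorph.symm (S.σ (S.orbitCoord b), v))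
      (S.orbitChart.source ∩ S'.orbitChart.source) :=
    t.contMDiffOn_symm.comp (h1.prodMk contMDiffOn_const) fun b hb ↦
      t.mem_target.2 (hS _ (S.orbitCoord_mem hb.1))
  have hsat : ∀ b ∈ S.orbitChart.source ∩ S'.orbitChart.source,
      S.σ (S.orbitCoord b) ∈ S'.saturation := by
    intro b hb
    rw [← S'.orbitMk_preimage_image, Set.mem_preimage, S.orbitMk_σ_orbitCoord hb.1]
    exact hb.2
  have h3 := (S'.contMDiffOn_fiberCoord t' hS').comp h2 fun b hb ↦ by
    change (t.toOpenPartialHomeomorph.symm (S.σ (S.orbitCoord b), v)).proj ∈ S'.saturation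
    rw [t.proj_symm_apply' (hS _ (S.orbitCoord_mem hb.1))]
    exact hsat b hb
  refine h3.congr fun b hb ↦ ?_
  rw [S.pretrivialization_symm t hS hb.1, S'.pretrivialization_mk t' hS' (hsat b hb)]
  simp only [Function.comp_apply]
  congr 1
  exact t.mk_symm (hS _ (S.orbitCoord_mem hb.1)) v

variable (EG EM W F E) in
/-- The trivializations of `E/G` coming from slices. -/
def orbitPretrivializations : Set (Pretrivialization F (π F (OrbitFiber G F E))) :=
  {e | ∃ (S : Slice EG G EM M W) (m : M)
    (hS : ∀ s ∈ S.domain, S.σ s ∈ (trivializationAt F E m).baseSet),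
    e = S.pretrivialization (trivializationAt F E m) hS}

variable (EG EM F E) in
-- The neighbourhood argument of `exists_slice` allows a slice inside the domain of a single
-- trivialization of `E`.
theorem exists_orbitPretrivialization
    (hW : Module.finrank ℝ W = Module.finrank ℝ EM - Module.finrank ℝ EG)
    (b : MulAction.orbitRel.Quotient G M) :
    ∃ e ∈ orbitPretrivializations EG EM W F E, b ∈ e.baseSet := by
  obtain ⟨S, s, hs, hsb, hS⟩ := exists_slice (EG := EG) (G := G) (EM := EM) (W := W)
    (Quotient.out b) hW ((trivializationAt F E (Quotient.out b)).open_baseSet.mem_nhds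
      (mem_baseSet_trivializationAt F E _))
  exact ⟨_, ⟨S, _, hS, rfl⟩, ⟨_, S.σ_mem hs, by rw [hsb, orbitMk_out]⟩⟩

variable (EG EM F E) in
/-- A trivialization of `E/G` near a given orbit. -/
def orbitPretrivializationAt
    (hW : Module.finrank ℝ W = Module.finrank ℝ EM - Module.finrank ℝ EG)
    (b : MulAction.orbitRel.Quotient G M) : Pretrivialization F (π F (OrbitFiber G F E)) :=
  (exists_orbitPretrivialization EG EM F E hW b).choose

theorem orbitPretrivializationAt_mem
    (hW : Module.finrank ℝ W = Module.finrank ℝ EM - Module.finrank ℝ EG)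
    (b : MulAction.orbitRel.Quotient G M) :
    orbitPretrivializationAt EG EM F E hW b ∈ orbitPretrivializations EG EM W F E :=
  (exists_orbitPretrivialization EG EM F E hW b).choose_spec.1

theorem mem_baseSet_orbitPretrivializationAt
    (hW : Module.finrank ℝ W = Module.finrank ℝ EM - Module.finrank ℝ EG)
    (b : MulAction.orbitRel.Quotient G M) :
    b ∈ (orbitPretrivializationAt EG EM F E hW b).baseSet :=
  (exists_orbitPretrivialization EG EM F E hW b).choose_spec.2

theorem isLinear_complex_of_mem {e : Pretrivialization F (π F (OrbitFiber G F E))}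
    (he : e ∈ orbitPretrivializations EG EM W F E) : e.IsLinear ℂ := by
  obtain ⟨S, m, hS, rfl⟩ := he
  exact S.pretrivialization_isLinear_complex _ hS

theorem isLinear_real_of_mem {e : Pretrivialization F (π F (OrbitFiber G F E))}
    (he : e ∈ orbitPretrivializations EG EM W F E) : e.IsLinear ℝ := by
  obtain ⟨S, m, hS, rfl⟩ := he
  exact S.pretrivialization_isLinear_real _ hS

theorem contMDiffOn_transition_of_mem
    [ChartedSpace W (MulAction.orbitRel.Quotient G M)]
    [IsManifold 𝓘(ℝ, W) ∞ (MulAction.orbitRel.Quotient G M)]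
    (hchart : ∀ S : Slice EG G EM M W, S.orbitChart ∈
      IsManifold.maximalAtlas 𝓘(ℝ, W) ∞ (MulAction.orbitRel.Quotient G M))
    {e e' : Pretrivialization F (π F (OrbitFiber G F E))}
    (he : e ∈ orbitPretrivializations EG EM W F E)
    (he' : e' ∈ orbitPretrivializations EG EM W F E) (v : F) :
    ContMDiffOn 𝓘(ℝ, W) 𝓘(ℝ, F) ∞ (fun b ↦ (e' ⟨b, e.symm b v⟩).2)
      (e.baseSet ∩ e'.baseSet) := by
  obtain ⟨S, m, hS, rfl⟩ := he
  obtain ⟨S', m', hS', rfl⟩ := he'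
  exact S.contMDiffOn_transition S' _ _ hS hS' (hchart S) v

variable (EG EM F E) in
/-- The topology on the fibers of `E/G`. -/
@[reducible]
def orbitFiberTopology
    (hW : Module.finrank ℝ W = Module.finrank ℝ EM - Module.finrank ℝ EG)
    (b : MulAction.orbitRel.Quotient G M) : TopologicalSpace (OrbitFiber G F E b) :=
  .induced (fun y ↦ (orbitPretrivializationAt EG EM F E hW b ⟨b, y⟩).2) inferInstance

theorem orbitFiber_isTopologicalAddGroup
    (hW : Module.finrank ℝ W = Module.finrank ℝ EM - Module.finrank ℝ EG)
    (b : MulAction.orbitRel.Quotient G M) :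
    letI := orbitFiberTopology EG EM F E hW b
    IsTopologicalAddGroup (OrbitFiber G F E b) :=
  have := isLinear_complex_of_mem (orbitPretrivializationAt_mem (E := E) (F := F) hW b)
  topologicalAddGroup_induced ((orbitPretrivializationAt EG EM F E hW b).linearEquivAt ℂ b
    (mem_baseSet_orbitPretrivializationAt hW b)).toLinearMap

theorem orbitFiber_continuousSMul
    (hW : Module.finrank ℝ W = Module.finrank ℝ EM - Module.finrank ℝ EG)
    (b : MulAction.orbitRel.Quotient G M) :
    letI := orbitFiberTopology EG EM F E hW b
    ContinuousSMul ℝ (OrbitFiber G F E b) :=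
  have := isLinear_real_of_mem (orbitPretrivializationAt_mem (E := E) (F := F) hW b)
  continuousSMul_induced ((orbitPretrivializationAt EG EM F E hW b).linearEquivAt ℝ b
    (mem_baseSet_orbitPretrivializationAt hW b)).toLinearMap

theorem isInducing_orbitPretrivializationAt
    (hW : Module.finrank ℝ W = Module.finrank ℝ EM - Module.finrank ℝ EG)
    (b : MulAction.orbitRel.Quotient G M) :
    letI := orbitFiberTopology EG EM F E hW b
    IsInducing (orbitPretrivializationAt EG EM F E hW b ∘ TotalSpace.mk b) := by
  let _ := orbitFiberTopology EG EM F E hW b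
  have h1 : IsInducing (fun y : OrbitFiber G F E b ↦
      (orbitPretrivializationAt EG EM F E hW b ⟨b, y⟩).2) := ⟨rfl⟩
  have h2 : IsInducing (fun v : F ↦ (b, v)) := isInducing_prodMkRight b
  have h3 := h2.comp h1
  have h4 : (fun v : F ↦ (b, v)) ∘ (fun y : OrbitFiber G F E b ↦
      (orbitPretrivializationAt EG EM F E hW b ⟨b, y⟩).2) =
      orbitPretrivializationAt EG EM F E hW b ∘ TotalSpace.mk b := funext fun y ↦
    Prod.ext ((orbitPretrivializationAt EG EM F E hW b).coe_fst' (x := ⟨b, y⟩)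
      (mem_baseSet_orbitPretrivializationAt hW b)).symm rfl
  exact h4 ▸ h3

end OrbitBundle

/-- The transition function of two linear pretrivializations. -/
theorem exists_coordChange_of_isLinear {𝕜 : Type*} [NontriviallyNormedField 𝕜] [CompleteSpace 𝕜]
    {B : Type*} [TopologicalSpace B] {F : Type*} [NormedAddCommGroup F] [NormedSpace 𝕜 F]
    [FiniteDimensional 𝕜 F] {V : B → Type*} [∀ b, AddCommGroup (V b)] [∀ b, Module 𝕜 (V b)]
    (e e' : Pretrivialization F (π F V)) [e.IsLinear 𝕜] [e'.IsLinear 𝕜] :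
    ∃ f : B → F →L[𝕜] F, ∀ b ∈ e.baseSet ∩ e'.baseSet, ∀ v, f b v = (e' ⟨b, e.symm b v⟩).2 := by
  refine ⟨fun b ↦ LinearMap.toContinuousLinearMap (e'.linearMapAt 𝕜 b ∘ₗ e.symmₗ 𝕜 b),
    fun b hb v ↦ ?_⟩
  simp only [LinearMap.coe_toContinuousLinearMap', LinearMap.comp_apply]
  rw [e'.coe_linearMapAt_of_mem hb.2]
  exact congrArg (fun y ↦ (e' ⟨b, y⟩).2) (e.symmₗ_apply (R := 𝕜) hb.1 v)

/-! ### The prebundles of `E/G` and smoothness of `E → E/G`. -/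

section OrbitBundle

attribute [local instance] orbitFiberAddCommGroup orbitFiberModule

variable {EG : Type*} [NormedAddCommGroup EG] [NormedSpace ℝ EG] [FiniteDimensional ℝ EG]
    {G : Type*} [TopologicalSpace G] [ChartedSpace EG G] [Group G] [LieGroup 𝓘(ℝ, EG) ∞ G]
    {EM : Type*} [NormedAddCommGroup EM] [NormedSpace ℝ EM] [FiniteDimensional ℝ EM]
    {M : Type*} [TopologicalSpace M] [T2Space M] [ChartedSpace EM M] [IsManifold 𝓘(ℝ, EM) ∞ M]
    [MulAction G M] [ContMDiffSMul 𝓘(ℝ, EG) 𝓘(ℝ, EM) ∞ G M] [ProperSMul G M] [IsCancelSMul G M]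
    {W : Type*} [NormedAddCommGroup W] [NormedSpace ℝ W] [FiniteDimensional ℝ W]
    {F : Type*} [NormedAddCommGroup F] [NormedSpace ℂ F] [FiniteDimensional ℂ F]
    {E : M → Type*} [∀ x, AddCommGroup (E x)] [∀ x, Module ℂ (E x)]
    [∀ x, TopologicalSpace (E x)]
    [TopologicalSpace (TotalSpace F E)] [FiberBundle F E]
    [VectorBundle ℂ F E] [VectorBundle ℝ F E] [ContMDiffVectorBundle ∞ F E 𝓘(ℝ, EM)]
    [MulAction G (TotalSpace F E)] [IsEquivariantBundle G F E]
    [ContMDiffSMul 𝓘(ℝ, EG) (𝓘(ℝ, EM).prod 𝓘(ℝ, F)) ∞ G (TotalSpace F E)]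


variable [ChartedSpace W (MulAction.orbitRel.Quotient G M)]
    [IsManifold 𝓘(ℝ, W) ∞ (MulAction.orbitRel.Quotient G M)]

theorem exists_orbitCoordChange_real
    (hchart : ∀ S : Slice EG G EM M W, S.orbitChart ∈
      IsManifold.maximalAtlas 𝓘(ℝ, W) ∞ (MulAction.orbitRel.Quotient G M))
    {e e' : Pretrivialization F (π F (OrbitFiber G F E))}
    (he : e ∈ orbitPretrivializations EG EM W F E)
    (he' : e' ∈ orbitPretrivializations EG EM W F E) :
    ∃ f : MulAction.orbitRel.Quotient G M → F →L[ℝ] F,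
      ContMDiffOn 𝓘(ℝ, W) 𝓘(ℝ, F →L[ℝ] F) ∞ f (e.baseSet ∩ e'.baseSet) ∧
        ∀ b ∈ e.baseSet ∩ e'.baseSet, ∀ v, f b v = (e' ⟨b, e.symm b v⟩).2 := by
  have := isLinear_real_of_mem he
  have := isLinear_real_of_mem he'
  have : FiniteDimensional ℝ F := FiniteDimensional.complexToReal F
  obtain ⟨f, hf⟩ := exists_coordChange_of_isLinear (𝕜 := ℝ) e e'
  refine ⟨f, fun b hb ↦ contMDiffWithinAt_clm_of_apply fun v ↦ ?_, hf⟩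
  exact (contMDiffOn_transition_of_mem hchart he he' v b hb).congr
    (fun b hb ↦ hf b hb v) (hf b hb v)

/-- The real version provides the smooth structure. Over the complex numbers, continuity of the
linear coordinate changes is all that a vector bundle asks for. -/
theorem exists_orbitCoordChange_complex
    (hchart : ∀ S : Slice EG G EM M W, S.orbitChart ∈
      IsManifold.maximalAtlas 𝓘(ℝ, W) ∞ (MulAction.orbitRel.Quotient G M))
    {e e' : Pretrivialization F (π F (OrbitFiber G F E))}
    (he : e ∈ orbitPretrivializations EG EM W F E)
    (he' : e' ∈ orbitPretrivializations EG EM W F E) :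
    ∃ f : MulAction.orbitRel.Quotient G M → F →L[ℂ] F,
      ContinuousOn f (e.baseSet ∩ e'.baseSet) ∧
        ∀ b ∈ e.baseSet ∩ e'.baseSet, ∀ v, f b v = (e' ⟨b, e.symm b v⟩).2 := by
  have := isLinear_complex_of_mem he
  have := isLinear_complex_of_mem he'
  obtain ⟨f, hf⟩ := exists_coordChange_of_isLinear (𝕜 := ℂ) e e'
  refine ⟨f, continuousOn_clm_apply.2 fun v ↦ ?_, hf⟩
  exact (contMDiffOn_transition_of_mem hchart he he' v).continuousOn.congr fun b hb ↦ hf b hb v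

variable (EG EM F E) in
/-- The prebundle of `E/G` over the reals. -/
def orbitPrebundleReal
    (hW : Module.finrank ℝ W = Module.finrank ℝ EM - Module.finrank ℝ EG)
    (hchart : ∀ S : Slice EG G EM M W, S.orbitChart ∈
      IsManifold.maximalAtlas 𝓘(ℝ, W) ∞ (MulAction.orbitRel.Quotient G M)) :
    letI := orbitFiberTopology EG EM (G := G) F E hW
    VectorPrebundle ℝ F (OrbitFiber G F E) :=
  letI := orbitFiberTopology EG EM (G := G) F E hW
  { pretrivializationAtlas := orbitPretrivializations EG EM W F E
    pretrivialization_linear' _ he := isLinear_real_of_mem he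
    pretrivializationAt := orbitPretrivializationAt EG EM F E hW
    mem_base_pretrivializationAt := mem_baseSet_orbitPretrivializationAt hW
    pretrivialization_mem_atlas := orbitPretrivializationAt_mem hW
    exists_coordChange _ he _ he' :=
      (exists_orbitCoordChange_real hchart he he').imp fun _ h ↦ ⟨h.1.continuousOn, h.2⟩
    totalSpaceMk_isInducing := isInducing_orbitPretrivializationAt hW }

variable (EG EM F E) in
/-- The prebundle of `E/G` over the complex numbers. -/
def orbitPrebundleComplex
    (hW : Module.finrank ℝ W = Module.finrank ℝ EM - Module.finrank ℝ EG)
    (hchart : ∀ S : Slice EG G EM M W, S.orbitChart ∈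
      IsManifold.maximalAtlas 𝓘(ℝ, W) ∞ (MulAction.orbitRel.Quotient G M)) :
    letI := orbitFiberTopology EG EM (G := G) F E hW
    VectorPrebundle ℂ F (OrbitFiber G F E) :=
  letI := orbitFiberTopology EG EM (G := G) F E hW
  { pretrivializationAtlas := orbitPretrivializations EG EM W F E
    pretrivialization_linear' _ he := isLinear_complex_of_mem he
    pretrivializationAt := orbitPretrivializationAt EG EM F E hW
    mem_base_pretrivializationAt := mem_baseSet_orbitPretrivializationAt hW
    pretrivialization_mem_atlas := orbitPretrivializationAt_mem hW
    exists_coordChange _ he _ he' := exists_orbitCoordChange_complex hchart he he'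
    totalSpaceMk_isInducing := isInducing_orbitPretrivializationAt hW }

theorem isContMDiff_orbitPrebundleReal
    (hW : Module.finrank ℝ W = Module.finrank ℝ EM - Module.finrank ℝ EG)
    (hchart : ∀ S : Slice EG G EM M W, S.orbitChart ∈
      IsManifold.maximalAtlas 𝓘(ℝ, W) ∞ (MulAction.orbitRel.Quotient G M)) :
    letI := orbitFiberTopology EG EM (G := G) F E hW
    (orbitPrebundleReal EG EM F E hW hchart).IsContMDiff 𝓘(ℝ, W) ∞ :=
  letI := orbitFiberTopology EG EM (G := G) F E hW
  { exists_contMDiffCoordChange := fun _ he _ he' ↦ exists_orbitCoordChange_real hchart he he' }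

/-- The quotient map `E → E/G` is smooth. -/
theorem contMDiff_fiberMk_orbitPrebundleReal
    (hW : Module.finrank ℝ W = Module.finrank ℝ EM - Module.finrank ℝ EG)
    (hchart : ∀ S : Slice EG G EM M W, S.orbitChart ∈
      IsManifold.maximalAtlas 𝓘(ℝ, W) ∞ (MulAction.orbitRel.Quotient G M))
    (hq : ContMDiff 𝓘(ℝ, EM) 𝓘(ℝ, W) ∞ (orbitMk G : M → MulAction.orbitRel.Quotient G M)) :
    letI := orbitFiberTopology EG EM (G := G) F E hW
    letI := (orbitPrebundleReal EG EM F E hW hchart).totalSpaceTopology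
    letI := (orbitPrebundleReal EG EM F E hW hchart).toFiberBundle
    ContMDiff (𝓘(ℝ, EM).prod 𝓘(ℝ, F)) (𝓘(ℝ, W).prod 𝓘(ℝ, F)) ∞
      (fun p : TotalSpace F E ↦
        (⟨orbitMk G p.proj, fiberMk G F p.snd⟩ : TotalSpace F (OrbitFiber G F E))) := by
  let _ := orbitFiberTopology EG EM (G := G) F E hW
  let _ := (orbitPrebundleReal EG EM F E hW hchart).totalSpaceTopology
  let _ := (orbitPrebundleReal EG EM F E hW hchart).toFiberBundle
  have := (orbitPrebundleReal EG EM F E hW hchart).toVectorBundle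
  have := isContMDiff_orbitPrebundleReal (E := E) (F := F) hW hchart
  have := (orbitPrebundleReal EG EM F E hW hchart).contMDiffVectorBundle (n := ∞) 𝓘(ℝ, W)
  intro p
  have hb := mem_baseSet_orbitPretrivializationAt (EG := EG) (EM := EM) (F := F) (E := E) hW
    (orbitMk G p.proj)
  have hmem := orbitPretrivializationAt_mem (EG := EG) (EM := EM) (F := F) (E := E) hW
    (orbitMk G p.proj)
  rw [Bundle.contMDiffAt_totalSpace]
  refine ⟨(hq.contMDiffAt).comp p (contMDiff_proj E).contMDiffAt, ?_⟩
  obtain ⟨S, m, hS, he⟩ := hmem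
  have hp : p.proj ∈ S.saturation := by
    rw [he] at hb
    rwa [← S.orbitMk_preimage_image]
  have h1 := (S.contMDiffOn_fiberCoord (trivializationAt F E m) hS).contMDiffAt
    ((S.isOpen_saturation.preimage (FiberBundle.continuous_proj F E)).mem_nhds hp)
  refine h1.congr_of_eventuallyEq ?_
  filter_upwards [(S.isOpen_saturation.preimage (FiberBundle.continuous_proj F E)).mem_nhds hp]
    with x hx
  change (orbitPretrivializationAt EG EM F E hW (orbitMk G p.proj)
    ⟨orbitMk G x.proj, fiberMk G F x.snd⟩).2 = _
  rw [he]
  exact S.pretrivialization_mk _ hS hx x.snd rfl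

end OrbitBundle

/-! ### Existence of the quotient bundle. -/

section Existence

variable (EG : Type*) [NormedAddCommGroup EG] [NormedSpace ℝ EG] [FiniteDimensional ℝ EG]
    (G : Type*) [TopologicalSpace G] [ChartedSpace EG G] [Group G] [LieGroup 𝓘(ℝ, EG) ∞ G]
    (EM : Type*) [NormedAddCommGroup EM] [NormedSpace ℝ EM] [FiniteDimensional ℝ EM]
    {M : Type*} [TopologicalSpace M] [T2Space M] [ChartedSpace EM M] [IsManifold 𝓘(ℝ, EM) ∞ M]
    [MulAction G M] [ContMDiffSMul 𝓘(ℝ, EG) 𝓘(ℝ, EM) ∞ G M] [ProperSMul G M] [IsCancelSMul G M]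
    (F : Type*) [NormedAddCommGroup F] [NormedSpace ℂ F] [FiniteDimensional ℂ F]
    (E : M → Type*) [∀ x, AddCommGroup (E x)] [∀ x, Module ℂ (E x)]
    [∀ x, TopologicalSpace (E x)]
    [TopologicalSpace (TotalSpace F E)] [FiberBundle F E]
    [VectorBundle ℂ F E] [VectorBundle ℝ F E] [ContMDiffVectorBundle ∞ F E 𝓘(ℝ, EM)]
    [MulAction G (TotalSpace F E)] [IsEquivariantBundle G F E]
    [ContMDiffSMul 𝓘(ℝ, EG) (𝓘(ℝ, EM).prod 𝓘(ℝ, F)) ∞ G (TotalSpace F E)]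

/-- The orbit spaces of a free and proper action form a smooth vector bundle. -/
theorem nonempty_quotientBundle : Nonempty (QuotientBundle EG G EM F E) := by
  let W := EuclideanSpace ℝ (Fin (Module.finrank ℝ EM - Module.finrank ℝ EG))
  have hW : Module.finrank ℝ W = Module.finrank ℝ EM - Module.finrank ℝ EG := by simp [W]
  let cs := orbitChartedSpace EG G EM M W hW
  have mf := isManifold_orbitChartedSpace (EG := EG) (G := G) (EM := EM) (M := M) hW
  have hchart : ∀ S : Slice EG G EM M W, S.orbitChart ∈
      IsManifold.maximalAtlas 𝓘(ℝ, W) ∞ (MulAction.orbitRel.Quotient G M) := fun S ↦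
    IsManifold.subset_maximalAtlas ⟨S, rfl⟩
  have hq := isSubmersion_orbitMk (EG := EG) (G := G) (EM := EM) (M := M) hW
  let ag := orbitFiberAddCommGroup G F E
  let md := orbitFiberModule G F E
  let ft := orbitFiberTopology EG EM (G := G) F E hW
  let a := orbitPrebundleReal EG EM F E hW hchart
  let tt := a.totalSpaceTopology
  let fb := a.toFiberBundle
  have vr := a.toVectorBundle
  -- The real and complex prebundles have the same pretrivializations and fiber topologies, so the
  -- topology and fiber bundle of the real one serve both.
  have vc : VectorBundle ℂ F (OrbitFiber G F E) :=
    (orbitPrebundleComplex EG EM F E hW hchart).toVectorBundle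
  have := isContMDiff_orbitPrebundleReal (E := E) (F := F) hW hchart
  have sb := a.contMDiffVectorBundle (n := ∞) 𝓘(ℝ, W)
  have tg := orbitFiber_isTopologicalAddGroup (F := F) (E := E) (G := G) (EG := EG) (EM := EM) hW
  have cm := orbitFiber_continuousSMul (F := F) (E := E) (G := G) (EG := EG) (EM := EM) hW
  exact ⟨{
    chartedSpace := cs, isManifold := mf, addCommGroup := ag, module := md, topologicalSpace := ft
    isTopologicalAddGroup := tg, continuousSMul := cm, totalTopology := tt, fiberBundle := fb
    vectorBundleComplex := vc, vectorBundleReal := vr, smoothBundle := sb, isSubmersion := hq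
    fiberMk_add := fun m v w ↦ fiberMkAt_add rfl v w
    fiberMk_smul := fun m c v ↦ fiberMkAt_smul rfl c v
    contMDiff_fiberMk := contMDiff_fiberMk_orbitPrebundleReal hW hchart hq.contMDiff }⟩

end Existence

/-! ### Local sections of submersions. -/

section Submersion

variable {EM : Type*} [NormedAddCommGroup EM] [NormedSpace ℝ EM]
    {M : Type*} [TopologicalSpace M] [ChartedSpace EM M] [IsManifold 𝓘(ℝ, EM) ∞ M]
    {EB : Type*} [NormedAddCommGroup EB] [NormedSpace ℝ EB]
    {B : Type*} [TopologicalSpace B] [ChartedSpace EB B] [IsManifold 𝓘(ℝ, EB) ∞ B]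
    {q : M → B}

/-- A submersion has local sections through every point. -/
theorem exists_localSection (hq : Manifold.IsSubmersion 𝓘(ℝ, EM) 𝓘(ℝ, EB) ∞ q) (m : M) :
    ∃ (ς : B → M) (U : Set B), IsOpen U ∧ q m ∈ U ∧ ContMDiffOn 𝓘(ℝ, EB) 𝓘(ℝ, EM) ∞ ς U ∧
      ς (q m) = m ∧ ∀ b ∈ U, q (ς b) = b := by
  have h := hq.isSubmersionAt m
  -- In submersion charts `q` is a projection. The section keeps the complementary coordinate frozen
  -- at its value `c` at `m`.
  let c := (h.equiv (h.domChart m)).2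
  have hw : ∀ y ∈ h.domChart.target, h.codChart (q (h.domChart.symm y)) = (h.equiv y).1 := by
    intro y hy
    have hy' : y ∈ (h.domChart.extend 𝓘(ℝ, EM)).target := by simpa using hy
    have := h.writtenInCharts hy'
    simpa using this
  have hm := h.mem_domChart_source
  have hqm : (h.equiv (h.domChart m)).1 = h.codChart (q m) := by
    rw [← hw _ (h.domChart.map_source hm), h.domChart.left_inv hm]
  let θ : B → EM := fun b ↦ h.equiv.symm (h.codChart b, c)
  have hθ : ContMDiffOn 𝓘(ℝ, EB) 𝓘(ℝ, EM) ∞ θ h.codChart.source := by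
    refine h.equiv.symm.contDiff.contMDiff.comp_contMDiffOn (ContMDiffOn.prodMk_space ?_ ?_)
    · exact contMDiffOn_of_mem_maximalAtlas h.codChart_mem_maximalAtlas
    · exact contMDiffOn_const
  have hθm : θ (q m) = h.domChart m := by
    simp only [θ, c, ← hqm, Prod.mk.eta, ContinuousLinearEquiv.symm_apply_apply]
  refine ⟨fun b ↦ h.domChart.symm (θ b), h.codChart.source ∩ θ ⁻¹' h.domChart.target,
    hθ.continuousOn.isOpen_inter_preimage h.codChart.open_source h.domChart.open_target,
    ⟨h.mem_codChart_source, ?_⟩, ?_, ?_, ?_⟩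
  · rw [Set.mem_preimage, hθm]
    exact h.domChart.map_source hm
  · exact (contMDiffOn_symm_of_mem_maximalAtlas h.domChart_mem_maximalAtlas).comp
      (hθ.mono Set.inter_subset_left) fun b hb ↦ hb.2
  · change h.domChart.symm (θ (q m)) = m
    rw [hθm, h.domChart.left_inv hm]
  · rintro b ⟨hb, hb'⟩
    refine h.codChart.injOn (h.source_subset_preimage_source (h.domChart.map_target hb')) hb ?_
    rw [hw _ hb']
    simp [θ]

/-- The chain rule for `q ∘ ς = id` near `b`. The ascription to `EB` bridges the tangent spaces at
`q (ς b)` and `b`. -/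
theorem mfderiv_comp_localSection (hq : Manifold.IsSubmersion 𝓘(ℝ, EM) 𝓘(ℝ, EB) ∞ q)
    {ς : B → M} {U : Set B} (hU : IsOpen U) (hς : ContMDiffOn 𝓘(ℝ, EB) 𝓘(ℝ, EM) ∞ ς U)
    (hqς : ∀ b ∈ U, q (ς b) = b) {b : B} (hb : b ∈ U) (u : TangentSpace 𝓘(ℝ, EB) b) :
    (show EB from mfderiv 𝓘(ℝ, EM) 𝓘(ℝ, EB) q (ς b) (mfderiv 𝓘(ℝ, EB) 𝓘(ℝ, EM) ς b u)) = u := by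
  have h1 : MDifferentiableAt 𝓘(ℝ, EB) 𝓘(ℝ, EM) ς b :=
    (hς.contMDiffAt (hU.mem_nhds hb)).mdifferentiableAt (by simp)
  have h2 : MDifferentiableAt 𝓘(ℝ, EM) 𝓘(ℝ, EB) q (ς b) :=
    (hq.contMDiff _).mdifferentiableAt (by simp)
  have h3 : HasMFDerivAt 𝓘(ℝ, EB) 𝓘(ℝ, EB) (q ∘ ς) b
      (ContinuousLinearMap.id ℝ (TangentSpace 𝓘(ℝ, EB) b)) :=
    (hasMFDerivAt_id b).congr_of_eventuallyEq (by
      filter_upwards [hU.mem_nhds hb] with x hx using hqς x hx)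
  exact DFunLike.congr_fun (hasMFDerivAt_unique (h2.hasMFDerivAt.comp b h1.hasMFDerivAt) h3) u

theorem mfderiv_surjective_of_isSubmersion (hq : Manifold.IsSubmersion 𝓘(ℝ, EM) 𝓘(ℝ, EB) ∞ q)
    (m : M) : Function.Surjective (mfderiv 𝓘(ℝ, EM) 𝓘(ℝ, EB) q m) := by
  obtain ⟨ς, U, hU, hm, hς, hςm, hqς⟩ := exists_localSection hq m
  intro u
  have := mfderiv_comp_localSection hq hU hς hqς hm u
  rw [hςm] at this
  exact ⟨_, this⟩

end Submersion

/-- A field of linear maps is smooth if it maps vectors that are constant in a trivialization to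
smooth sections. -/
theorem contMDiffAt_hom_of_apply
    {EB : Type*} [NormedAddCommGroup EB] [NormedSpace ℝ EB]
    {B : Type*} [TopologicalSpace B] [ChartedSpace EB B]
    {F₁ F₂ : Type*} [NormedAddCommGroup F₁] [NormedSpace ℝ F₁] [FiniteDimensional ℝ F₁]
    [NormedAddCommGroup F₂] [NormedSpace ℝ F₂]
    {E₁ E₂ : B → Type*} [∀ b, AddCommGroup (E₁ b)] [∀ b, Module ℝ (E₁ b)]
    [∀ b, AddCommGroup (E₂ b)] [∀ b, Module ℝ (E₂ b)]
    [TopologicalSpace (TotalSpace F₁ E₁)] [∀ b, TopologicalSpace (E₁ b)]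
    [TopologicalSpace (TotalSpace F₂ E₂)] [∀ b, TopologicalSpace (E₂ b)]
    [∀ b, IsTopologicalAddGroup (E₂ b)] [∀ b, ContinuousSMul ℝ (E₂ b)]
    [FiberBundle F₁ E₁] [VectorBundle ℝ F₁ E₁] [FiberBundle F₂ E₂] [VectorBundle ℝ F₂ E₂]
    {n : ℕ∞ω} [ContMDiffVectorBundle n F₂ E₂ 𝓘(ℝ, EB)]
    {φ : ∀ b, E₁ b →L[ℝ] E₂ b} {b₀ : B}
    (h : ∀ v : F₁, ContMDiffAt 𝓘(ℝ, EB) (𝓘(ℝ, EB).prod 𝓘(ℝ, F₂)) n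
      (fun b ↦ TotalSpace.mk' F₂ b (φ b ((trivializationAt F₁ E₁ b₀).symm b v))) b₀) :
    ContMDiffAt 𝓘(ℝ, EB) (𝓘(ℝ, EB).prod 𝓘(ℝ, F₁ →L[ℝ] F₂)) n
      (fun b ↦ TotalSpace.mk' (F₁ →L[ℝ] F₂) (E := fun b ↦ E₁ b →L[ℝ] E₂ b) b (φ b)) b₀ := by
  rw [contMDiffAt_hom_bundle]
  refine ⟨contMDiffAt_id, contMDiffWithinAt_clm_of_apply fun v ↦ ?_⟩
  rw [contMDiffWithinAt_univ]
  have h1 := ((trivializationAt F₂ E₂ b₀).contMDiffAt_section_iff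
    (mem_baseSet_trivializationAt F₂ E₂ b₀)).1 (h v)
  refine h1.congr_of_eventuallyEq ?_
  filter_upwards [(trivializationAt F₁ E₁ b₀).open_baseSet.mem_nhds
    (mem_baseSet_trivializationAt F₁ E₁ b₀), (trivializationAt F₂ E₂ b₀).open_baseSet.mem_nhds
    (mem_baseSet_trivializationAt F₂ E₂ b₀)] with b hb hb'
  simp only [ContinuousLinearMap.inCoordinates_eq hb hb']
  simp

/-! ### Pull-back of sections along a fiberwise isomorphism. -/

section Pullback

variable {EM : Type*} [NormedAddCommGroup EM] [NormedSpace ℝ EM]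
    {M : Type*} [TopologicalSpace M] [ChartedSpace EM M] [IsManifold 𝓘(ℝ, EM) ∞ M]
    {EB : Type*} [NormedAddCommGroup EB] [NormedSpace ℝ EB]
    {B : Type*} [TopologicalSpace B] [ChartedSpace EB B] [IsManifold 𝓘(ℝ, EB) ∞ B]
    {F : Type*} [NormedAddCommGroup F] [NormedSpace ℂ F] [FiniteDimensional ℂ F]
    {E : M → Type*} [∀ x, AddCommGroup (E x)] [∀ x, Module ℂ (E x)]
    [∀ x, TopologicalSpace (E x)] [TopologicalSpace (TotalSpace F E)]
    [FiberBundle F E] [VectorBundle ℝ F E] [ContMDiffVectorBundle ∞ F E 𝓘(ℝ, EM)]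
    {V : B → Type*} [∀ x, AddCommGroup (V x)] [∀ x, Module ℂ (V x)]
    [∀ x, TopologicalSpace (V x)] [TopologicalSpace (TotalSpace F V)]
    [FiberBundle F V] [VectorBundle ℝ F V] [ContMDiffVectorBundle ∞ F V 𝓘(ℝ, EB)]
    {q : M → B} (f : ∀ (m : M) (b : B), q m = b → E m ≃ₗ[ℂ] V b)

/-- The pull-back of a section of `V` to a section of `E ≅ q^* V`. -/
def pullbackSection (s : ∀ b, V b) (m : M) : E m := (f _ _ rfl).symm (s (q m))

/-- In trivializations, the inverse of a smooth fiberwise isomorphism is smooth. -/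
theorem exists_smooth_symm (hq : ContMDiff 𝓘(ℝ, EM) 𝓘(ℝ, EB) ∞ q)
    (hf : ContMDiff (𝓘(ℝ, EM).prod 𝓘(ℝ, F)) (𝓘(ℝ, EB).prod 𝓘(ℝ, F)) ∞
      (fun p : TotalSpace F E ↦ (⟨q p.proj, f _ _ rfl p.2⟩ : TotalSpace F V))) (m : M) :
    ∃ A : M → F →L[ℝ] F, ContMDiffAt 𝓘(ℝ, EM) 𝓘(ℝ, F →L[ℝ] F) ∞ A m ∧
      ∀ᶠ x in 𝓝 m, ∀ v : V (q x), (trivializationAt F E m ⟨x, (f _ _ rfl).symm v⟩).2 =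
        A x (trivializationAt F V (q m) ⟨q x, v⟩).2 := by
  have : FiniteDimensional ℝ F := FiniteDimensional.complexToReal F
  have : CompleteSpace F := FiniteDimensional.complete ℝ F
  let t := trivializationAt F E m
  let t' := trivializationAt F V (q m)
  let U := t.baseSet ∩ q ⁻¹' t'.baseSet
  have hU : IsOpen U := t.open_baseSet.inter (t'.open_baseSet.preimage hq.continuous)
  have hmU : m ∈ U := ⟨mem_baseSet_trivializationAt F E m, mem_baseSet_trivializationAt F V (q m)⟩
  let L : M → F →L[ℝ] F := fun x ↦ LinearMap.toContinuousLinearMap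
    (t'.linearMapAt ℝ (q x) ∘ₗ ((f x _ rfl).toLinearMap.restrictScalars ℝ) ∘ₗ
      t.symmₗ ℝ x)
  have hLU : ∀ x ∈ U, ∀ w, L x w = (t' ⟨q x, f _ _ rfl (t.symm x w)⟩).2 := by
    intro x hx w
    have h1 : t.symmₗ ℝ x w = t.symm x w := t.symmₗ_apply hx.1 w
    simp only [L, LinearMap.coe_toContinuousLinearMap', LinearMap.comp_apply, h1]
    rw [t'.coe_linearMapAt_of_mem hx.2]
    rfl
  have hL : ContMDiffAt 𝓘(ℝ, EM) 𝓘(ℝ, F →L[ℝ] F) ∞ L m := by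
    refine contMDiffWithinAt_clm_of_apply fun w ↦ ?_
    rw [contMDiffWithinAt_univ]
    have h1 : ContMDiffOn 𝓘(ℝ, EM) (𝓘(ℝ, EM).prod 𝓘(ℝ, F)) ∞
        (fun x ↦ t.toOpenPartialHomeomorph.symm (x, w)) U :=
      t.contMDiffOn_symm.comp (contMDiffOn_id.prodMk contMDiffOn_const) fun x hx ↦
        t.mem_target.2 hx.1
    have h2 := contMDiff_snd.comp_contMDiffOn (t'.contMDiffOn.comp (hf.comp_contMDiffOn h1)
      fun x hx ↦ by
        change _ ∈ t'.source
        rw [t'.mem_source]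
        change q (t.toOpenPartialHomeomorph.symm (x, w)).proj ∈ _
        rw [t.proj_symm_apply' hx.1]
        exact hx.2)
    refine (h2.contMDiffAt (hU.mem_nhds hmU)).congr_of_eventuallyEq ?_
    filter_upwards [hU.mem_nhds hmU] with x hx
    rw [hLU x hx]
    have h3 : t.toOpenPartialHomeomorph.symm (x, w) = ⟨x, t.symm x w⟩ := (t.mk_symm hx.1 w).symm
    exact congrArg (fun p : TotalSpace F E ↦ (t' ⟨q p.proj, f _ _ rfl p.2⟩).2) h3.symm
  have hinv : ∀ x ∈ U, ∀ v : V (q x), L x (t ⟨x, (f _ _ rfl).symm v⟩).2 = (t' ⟨q x, v⟩).2 := by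
    intro x hx v
    rw [hLU x hx, t.symm_apply_apply_mk hx.1, LinearEquiv.apply_symm_apply]
  -- The coordinate expression is onto, hence bijective in finite dimension. Inversion of operators
  -- is smooth near an invertible one, which gives the smooth `A`.
  have hbij : ∀ x ∈ U, ∃ e : F ≃L[ℝ] F, (e : F →L[ℝ] F) = L x := by
    intro x hx
    have hsurj : Function.Surjective (L x) := by
      intro w
      refine ⟨(t ⟨x, (f _ _ rfl).symm (t'.symm (q x) w)⟩).2, ?_⟩
      rw [hinv x hx, t'.apply_mk_symm hx.2]
    exact ⟨(LinearEquiv.ofBijective (L x).toLinearMap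
      ⟨LinearMap.injective_iff_surjective.2 hsurj, hsurj⟩).toContinuousLinearEquiv, rfl⟩
  refine ⟨fun x ↦ (L x).inverse, ?_, ?_⟩
  · obtain ⟨e, he⟩ := hbij m hmU
    have h1 : ContDiffAt ℝ ∞ ContinuousLinearMap.inverse (L m) := he ▸ contDiffAt_map_inverse e
    exact h1.contMDiffAt.comp m hL
  · filter_upwards [hU.mem_nhds hmU] with x hx v
    obtain ⟨e, he⟩ := hbij x hx
    change (t ⟨x, (f _ _ rfl).symm v⟩).2 = (L x).inverse (t' ⟨q x, v⟩).2
    rw [← hinv x hx v, ← he, ContinuousLinearMap.inverse_equiv]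
    simp

theorem contMDiffAt_pullbackSection (hq : ContMDiff 𝓘(ℝ, EM) 𝓘(ℝ, EB) ∞ q)
    (hf : ContMDiff (𝓘(ℝ, EM).prod 𝓘(ℝ, F)) (𝓘(ℝ, EB).prod 𝓘(ℝ, F)) ∞
      (fun p : TotalSpace F E ↦ (⟨q p.proj, f _ _ rfl p.2⟩ : TotalSpace F V)))
    {s : ∀ b, V b} {m : M}
    (hs : ContMDiffAt 𝓘(ℝ, EB) (𝓘(ℝ, EB).prod 𝓘(ℝ, F)) ∞ (fun b ↦ TotalSpace.mk' F b (s b))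
      (q m)) :
    ContMDiffAt 𝓘(ℝ, EM) (𝓘(ℝ, EM).prod 𝓘(ℝ, F)) ∞
      (fun x : M ↦ (TotalSpace.mk' F x (pullbackSection f s x) : TotalSpace F E)) m := by
  obtain ⟨A, hA, hAs⟩ := exists_smooth_symm f hq hf m
  rw [(trivializationAt F E m).contMDiffAt_section_iff (mem_baseSet_trivializationAt F E m)]
  rw [(trivializationAt F V (q m)).contMDiffAt_section_iff
    (mem_baseSet_trivializationAt F V (q m))] at hs
  refine (hA.clm_apply (hs.comp m hq.contMDiffAt)).congr_of_eventuallyEq ?_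
  filter_upwards [hAs] with x hx using hx _

theorem mdifferentiableAt_pullbackSection (hq : ContMDiff 𝓘(ℝ, EM) 𝓘(ℝ, EB) ∞ q)
    (hf : ContMDiff (𝓘(ℝ, EM).prod 𝓘(ℝ, F)) (𝓘(ℝ, EB).prod 𝓘(ℝ, F)) ∞
      (fun p : TotalSpace F E ↦ (⟨q p.proj, f _ _ rfl p.2⟩ : TotalSpace F V)))
    {s : ∀ b, V b} {m : M}
    (hs : MDifferentiableAt 𝓘(ℝ, EB) (𝓘(ℝ, EB).prod 𝓘(ℝ, F)) (fun b ↦ TotalSpace.mk' F b (s b))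
      (q m)) :
    MDifferentiableAt 𝓘(ℝ, EM) (𝓘(ℝ, EM).prod 𝓘(ℝ, F))
      (fun x : M ↦ (TotalSpace.mk' F x (pullbackSection f s x) : TotalSpace F E)) m := by
  obtain ⟨A, hA, hAs⟩ := exists_smooth_symm f hq hf m
  rw [(trivializationAt F E m).mdifferentiableAt_section_iff _ _
    (mem_baseSet_trivializationAt F E m)]
  rw [(trivializationAt F V (q m)).mdifferentiableAt_section_iff _ _
    (mem_baseSet_trivializationAt F V (q m))] at hs
  refine ((hA.mdifferentiableAt (by simp)).clm_apply
    (hs.comp m (hq.mdifferentiableAt (by simp)))).congr_of_eventuallyEq ?_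
  filter_upwards [hAs] with x hx using hx _

end Pullback

/-- Complex multiples of differentiable sections are differentiable. -/
theorem mdifferentiableAt_complex_smul_section
    {EM : Type*} [NormedAddCommGroup EM] [NormedSpace ℝ EM]
    {M : Type*} [TopologicalSpace M] [ChartedSpace EM M]
    {F : Type*} [NormedAddCommGroup F] [NormedSpace ℂ F]
    {E : M → Type*} [∀ x, AddCommGroup (E x)] [∀ x, Module ℂ (E x)]
    [∀ x, TopologicalSpace (E x)] [TopologicalSpace (TotalSpace F E)]
    [FiberBundle F E] [VectorBundle ℂ F E] [VectorBundle ℝ F E]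
    [ContMDiffVectorBundle ∞ F E 𝓘(ℝ, EM)] {φ : ∀ x, E x} {m : M}
    (hφ : MDifferentiableAt 𝓘(ℝ, EM) (𝓘(ℝ, EM).prod 𝓘(ℝ, F))
      (fun x ↦ TotalSpace.mk' F x (φ x)) m) (c : ℂ) :
    MDifferentiableAt 𝓘(ℝ, EM) (𝓘(ℝ, EM).prod 𝓘(ℝ, F))
      (fun x ↦ TotalSpace.mk' F x (c • φ x)) m := by
  have hm := mem_baseSet_trivializationAt F E m
  rw [(trivializationAt F E m).mdifferentiableAt_section_iff _ _ hm] at hφ ⊢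
  have h1 : MDifferentiableAt 𝓘(ℝ, F) 𝓘(ℝ, F) (c • ContinuousLinearMap.id ℝ F)
      (trivializationAt F E m (φ m)).2 := (ContinuousLinearMap.mdifferentiable _) _
  refine (h1.comp m hφ).congr_of_eventuallyEq ?_
  filter_upwards [(trivializationAt F E m).open_baseSet.mem_nhds hm] with x hx
  exact ((trivializationAt F E m).linear ℂ hx).map_smul c (φ x)

/-! ### Descent of a connection along a submersion. -/

section Descent

variable {EM : Type*} [NormedAddCommGroup EM] [NormedSpace ℝ EM]
    {M : Type*} [TopologicalSpace M] [ChartedSpace EM M] [IsManifold 𝓘(ℝ, EM) ∞ M]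
    {EB : Type*} [NormedAddCommGroup EB] [NormedSpace ℝ EB] [FiniteDimensional ℝ EB]
    {B : Type*} [TopologicalSpace B] [ChartedSpace EB B] [IsManifold 𝓘(ℝ, EB) ∞ B]
    {F : Type*} [NormedAddCommGroup F] [NormedSpace ℂ F] [FiniteDimensional ℂ F]
    {E : M → Type*} [∀ x, AddCommGroup (E x)] [∀ x, Module ℂ (E x)]
    [∀ x, TopologicalSpace (E x)] [∀ x, IsTopologicalAddGroup (E x)]
    [∀ x, ContinuousSMul ℝ (E x)] [TopologicalSpace (TotalSpace F E)]
    [FiberBundle F E] [VectorBundle ℝ F E] [ContMDiffVectorBundle ∞ F E 𝓘(ℝ, EM)]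
    {V : B → Type*} [∀ x, AddCommGroup (V x)] [∀ x, Module ℂ (V x)]
    [∀ x, TopologicalSpace (V x)] [∀ x, IsTopologicalAddGroup (V x)]
    [∀ x, ContinuousSMul ℝ (V x)] [TopologicalSpace (TotalSpace F V)]
    [FiberBundle F V] [VectorBundle ℂ F V] [VectorBundle ℝ F V] [ContMDiffVectorBundle ∞ F V 𝓘(ℝ, EB)]
    {q : M → B} (f : ∀ (m : M) (b : B), q m = b → E m ≃ₗ[ℂ] V b)


/-- The linear map obtained from a connection by descent at the orbit of `m`. -/
def descentAt (cov : CovariantDerivative 𝓘(ℝ, EM) F E) (s : ∀ b, V b) {m : M} {b : B}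
    (h : q m = b) (R : EB →L[ℝ] EM) : TangentSpace 𝓘(ℝ, EB) b →L[ℝ] V b :=
  show EB →L[ℝ] V b from LinearMap.toContinuousLinearMap
    (((f _ _ h).toLinearMap.restrictScalars ℝ) ∘ₗ (cov (pullbackSection f s) m).toLinearMap ∘ₗ
      (R.toLinearMap : EB →ₗ[ℝ] EM))

/-- A connection descends along a submersion if its values on pull-backs of sections only depend on
the image of the direction. -/
theorem exists_descent (cov : CovariantDerivative 𝓘(ℝ, EM) F E)
    (hcov : IsSmoothComplexConnection cov) (hsurj : Function.Surjective q)
    (hq : Manifold.IsSubmersion 𝓘(ℝ, EM) 𝓘(ℝ, EB) ∞ q)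
    (hf : ContMDiff (𝓘(ℝ, EM).prod 𝓘(ℝ, F)) (𝓘(ℝ, EB).prod 𝓘(ℝ, F)) ∞
      (fun p : TotalSpace F E ↦ (⟨q p.proj, f _ _ rfl p.2⟩ : TotalSpace F V)))
    (hindep : ∀ (s : ∀ b, V b) (b : B), MDifferentiableAt 𝓘(ℝ, EB) (𝓘(ℝ, EB).prod 𝓘(ℝ, F))
        (fun b ↦ TotalSpace.mk' F b (s b)) b →
      ∀ (m m' : M) (h : q m = b) (h' : q m' = b) (v : TangentSpace 𝓘(ℝ, EM) m)
        (v' : TangentSpace 𝓘(ℝ, EM) m'),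
        (show EB from mfderiv 𝓘(ℝ, EM) 𝓘(ℝ, EB) q m v) =
          (show EB from mfderiv 𝓘(ℝ, EM) 𝓘(ℝ, EB) q m' v') →
        f _ _ h (cov (pullbackSection f s) m v) = f _ _ h' (cov (pullbackSection f s) m' v')) :
    ∃ cov' : CovariantDerivative 𝓘(ℝ, EB) F V, IsSmoothComplexConnection cov' ∧
      ∀ (s : ∀ b, V b) (m : M), MDifferentiableAt 𝓘(ℝ, EB) (𝓘(ℝ, EB).prod 𝓘(ℝ, F))
        (fun b ↦ TotalSpace.mk' F b (s b)) (q m) →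
        ∀ v : TangentSpace 𝓘(ℝ, EM) m, f _ _ rfl (cov (pullbackSection f s) m v) =
          cov' s (q m) (mfderiv 𝓘(ℝ, EM) 𝓘(ℝ, EB) q m v) := by
  -- The representatives and the right inverses of `dq` need no continuity: by `hindep` the result
  -- does not depend on them.
  choose rep hrep using hsurj
  have hR : ∀ b, ∃ R : EB →L[ℝ] EM, ∀ u : EB,
      (show EB from mfderiv 𝓘(ℝ, EM) 𝓘(ℝ, EB) q (rep b) (R u)) = u := by
    intro b
    obtain ⟨R, hR⟩ := (mfderiv 𝓘(ℝ, EM) 𝓘(ℝ, EB) q (rep b)).toLinearMap.exists_rightInverse_of_surjective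
      (LinearMap.range_eq_top.2 (mfderiv_surjective_of_isSubmersion hq _))
    exact ⟨LinearMap.toContinuousLinearMap (show EB →ₗ[ℝ] EM from R), fun u ↦
      DFunLike.congr_fun hR u⟩
  choose R hR using hR
  let D : (∀ b, V b) → ∀ b, TangentSpace 𝓘(ℝ, EB) b →L[ℝ] V b := fun s b ↦
    descentAt f cov s (hrep b) (R b)
  let MD : (∀ b, V b) → B → Prop := fun s b ↦ MDifferentiableAt 𝓘(ℝ, EB) (𝓘(ℝ, EB).prod 𝓘(ℝ, F))
    (fun b ↦ TotalSpace.mk' F b (s b)) b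
  have key : ∀ (s : ∀ b, V b) (m : M), MDifferentiableAt 𝓘(ℝ, EB) (𝓘(ℝ, EB).prod 𝓘(ℝ, F))
        (fun b ↦ TotalSpace.mk' F b (s b)) (q m) →
        ∀ v : TangentSpace 𝓘(ℝ, EM) m, f _ _ rfl (cov (pullbackSection f s) m v) =
          D s (q m) (mfderiv 𝓘(ℝ, EM) 𝓘(ℝ, EB) q m v) := by
    intro s m hs v
    exact hindep s (q m) hs m _ rfl (hrep _) v _ (hR _ _).symm
  -- Every tangent vector of `B` is some `dq(v)`, so identities for `D` need only be checked there,
  -- where `key` replaces `D` by `cov`.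
  have hsur : ∀ (P : ∀ b, TangentSpace 𝓘(ℝ, EB) b → Prop),
      (∀ (m : M) (v : TangentSpace 𝓘(ℝ, EM) m), P (q m) (mfderiv 𝓘(ℝ, EM) 𝓘(ℝ, EB) q m v)) →
        ∀ b u, P b u := by
    intro P hP b u
    have aux : ∀ (m : M) (b : B) (u : TangentSpace 𝓘(ℝ, EB) b) (v : TangentSpace 𝓘(ℝ, EM) m),
        q m = b → (show EB from mfderiv 𝓘(ℝ, EM) 𝓘(ℝ, EB) q m v) = u → P b u := by
      rintro m _ _ v rfl rfl
      exact hP m v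
    exact aux (rep b) b u _ (hrep b) (hR b u)
  have hD : IsCovariantDerivativeOn F D := by
    constructor
    · intro s s' b hs hs' _
      ext u
      refine hsur (fun b u ↦ MD s b → MD s' b → D (s + s') b u = (D s b + D s' b) u) ?_ b u hs hs'
      intro m v hs hs'
      have hσ := mdifferentiableAt_pullbackSection f hq.contMDiff hf hs
      have hσ' := mdifferentiableAt_pullbackSection f hq.contMDiff hf hs'
      have hadd : pullbackSection f (s + s') = pullbackSection f s + pullbackSection f s' :=
        funext fun x ↦ map_add (f _ _ rfl).symm _ _
      rw [add_apply, ← key _ _ hs, ← key _ _ hs', ← key _ _ (mdifferentiableAt_add_section hs hs'), hadd,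
        cov.isCovariantDerivativeOnUniv.add hσ hσ', add_apply, map_add]
    · intro s g b hs hg _
      ext u
      refine hsur (fun b u ↦ MD s b → MDifferentiableAt 𝓘(ℝ, EB) 𝓘(ℝ, ℝ) g b → D (g • s) b u =
        (g b • D s b + (mvfderiv 𝓘(ℝ, EB) g b).smulRight (s b) : TangentSpace 𝓘(ℝ, EB) b →L[ℝ] V b) u)
        ?_ b u hs hg
      intro m v hs hg
      have hσ := mdifferentiableAt_pullbackSection f hq.contMDiff hf hs
      have hqm : MDifferentiableAt 𝓘(ℝ, EM) 𝓘(ℝ, EB) q m := (hq.contMDiff m).mdifferentiableAt (by simp)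
      have hsmul : pullbackSection f (g • s) = (g ∘ q) • pullbackSection f s :=
        funext fun x ↦ map_smul (f x _ rfl).symm (g (q x) : ℂ) (s (q x))
      have h1 : f _ _ rfl (pullbackSection f s m) = s (q m) := (f _ _ rfl).apply_symm_apply _
      rw [add_apply, smul_apply, ← key _ _ hs,
        ← key _ _ (hg.smul_section hs), hsmul,
        cov.isCovariantDerivativeOnUniv.leibniz hσ (hg.comp m hqm), add_apply,
        map_add, smul_apply, ContinuousLinearMap.smulRight_apply,
        ContinuousLinearMap.smulRight_apply, mvfderiv_comp_apply m hg hqm]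
      refine congrArg₂ (· + ·) (map_smul ((f _ _ rfl).toLinearMap.restrictScalars ℝ) _ _)
        ((map_smul ((f _ _ rfl).toLinearMap.restrictScalars ℝ) _ _).trans ?_)
      exact congrArg _ h1
  refine ⟨⟨D, hD⟩, ⟨⟨⟨?_⟩⟩, ?_⟩, key⟩
  · intro s hs
    have hσ : ContMDiffOn 𝓘(ℝ, EM) (𝓘(ℝ, EM).prod 𝓘(ℝ, F)) (∞ + 1)
        (fun x : M ↦ (TotalSpace.mk' F x (pullbackSection f s x) : TotalSpace F E)) Set.univ :=
      fun m _ ↦ (contMDiffAt_pullbackSection f hq.contMDiff hf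
        ((hs (q m) trivial).contMDiffAt Filter.univ_mem)).contMDiffWithinAt
    have hcovσ := hcov.smooth.contMDiff.contMDiff hσ
    intro b _
    refine ContMDiffAt.contMDiffWithinAt (contMDiffAt_hom_of_apply fun u ↦ ?_)
    obtain ⟨m, rfl⟩ : ∃ m, q m = b := ⟨rep b, hrep b⟩
    -- Smoothness uses a smooth lift: near `q m`, `D s b u` is the image under `f` of the derivative
    -- of the pull-back at `ς b` along `dς(u)`.
    obtain ⟨ς, U, hU, hm, hς, hςm, hqς⟩ := exists_localSection hq m
    have h1 : ContMDiffAt 𝓘(ℝ, EB) (𝓘(ℝ, EB).prod 𝓘(ℝ, EB)) ∞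
        (fun b ↦ (⟨b, (trivializationAt EB (TangentSpace 𝓘(ℝ, EB)) (q m)).symm b u⟩ :
          TangentBundle 𝓘(ℝ, EB) B)) (q m) := by
      rw [(trivializationAt EB (TangentSpace 𝓘(ℝ, EB)) (q m)).contMDiffAt_section_iff
        (mem_baseSet_trivializationAt EB (TangentSpace 𝓘(ℝ, EB)) (q m))]
      refine contMDiffAt_const (c := u) |>.congr_of_eventuallyEq ?_
      filter_upwards [(trivializationAt EB (TangentSpace 𝓘(ℝ, EB)) (q m)).open_baseSet.mem_nhds
        (mem_baseSet_trivializationAt EB (TangentSpace 𝓘(ℝ, EB)) (q m))] with x hx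
      exact congrArg Prod.snd (Trivialization.apply_mk_symm _ hx u)
    have h2 : ContMDiffAt 𝓘(ℝ, EB) (𝓘(ℝ, EM).prod 𝓘(ℝ, EM)) ∞
        (fun b ↦ (⟨ς b, mfderiv 𝓘(ℝ, EB) 𝓘(ℝ, EM) ς b
          ((trivializationAt EB (TangentSpace 𝓘(ℝ, EB)) (q m)).symm b u)⟩ :
          TangentBundle 𝓘(ℝ, EM) M)) (q m) := by
      have h3 := ((hς.contMDiffOn_tangentMapWithin (m := ∞) (by exact_mod_cast le_top)
        hU.uniqueMDiffOn).contMDiffAt ((hU.preimage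
          (FiberBundle.continuous_proj EB (TangentSpace 𝓘(ℝ, EB)))).mem_nhds hm)).comp (q m) h1
      refine h3.congr_of_eventuallyEq ?_
      filter_upwards [hU.mem_nhds hm] with x hx
      simp only [Function.comp_apply, tangentMapWithin, mfderivWithin_of_isOpen hU hx]
    have h3 : ContMDiffAt 𝓘(ℝ, EB) (𝓘(ℝ, EM).prod 𝓘(ℝ, EM →L[ℝ] F)) ∞
        (fun b ↦ (⟨ς b, cov (pullbackSection f s) (ς b)⟩ :
          TotalSpace (EM →L[ℝ] F) fun x ↦ TangentSpace 𝓘(ℝ, EM) x →L[ℝ] E x)) (q m) :=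
      ContMDiffAt.comp (q m) ((hcovσ _ trivial).contMDiffAt Filter.univ_mem)
        (hς.contMDiffAt (hU.mem_nhds hm))
    have h4 := hf.contMDiffAt.comp (q m) (h3.clm_bundle_apply h2)
    -- The points `b` and `q (ς b)` are only propositionally equal, so the values are compared in
    -- the total space.
    have aux : ∀ (b b' : B) (u : TangentSpace 𝓘(ℝ, EB) b) (u' : TangentSpace 𝓘(ℝ, EB) b'),
        b = b' → (show EB from u) = u' →
          TotalSpace.mk' F b (D s b u) = TotalSpace.mk' F b' (D s b' u') := by
      rintro b _ u _ rfl rfl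
      rfl
    refine h4.congr_of_eventuallyEq ?_
    filter_upwards [hU.mem_nhds hm] with x hx
    refine (aux _ _ _ _ (hqς x hx) (mfderiv_comp_localSection hq hU hς hqς hx _)).symm.trans ?_
    refine congrArg (TotalSpace.mk' F _) (key s (ς x) ?_ _).symm
    exact ((hs _ trivial).contMDiffAt Filter.univ_mem).mdifferentiableAt (by simp)
  · intro c s b hs u
    refine hsur (fun b u ↦ MD s b → D (fun x ↦ c • s x) b u = c • D s b u) ?_ b u hs
    intro m v hs
    have hσ := mdifferentiableAt_pullbackSection f hq.contMDiff hf hs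
    have hsmul : pullbackSection f (fun x ↦ c • s x) = fun x ↦ c • pullbackSection f s x :=
      funext fun x ↦ map_smul (f _ _ rfl).symm _ _
    rw [← key _ _ hs, ← key _ _ (mdifferentiableAt_complex_smul_section hs c), hsmul,
      hcov.complex_smul c _ m hσ, map_smul]

end Descent

/-! ### The action on sections. -/

section SectionAct

variable {G : Type*} [Group G] {M : Type*} [MulAction G M]
  {F : Type*} {E : M → Type*} [∀ x, AddCommGroup (E x)] [∀ x, Module ℂ (E x)]
  [MulAction G (TotalSpace F E)] [IsEquivariantBundle G F E]

variable (F E) in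
theorem exists_linearMap_of_smul_eq (g : G) {x m : M} (h : g • x = m) :
    ∃ A : E x →ₗ[ℂ] E m, ∀ v : E x, g • (⟨x, v⟩ : TotalSpace F E) = ⟨m, A v⟩ := by
  subst h
  exact IsEquivariantBundle.exists_linearMap g x

/-- In the total space the transport along `g • g⁻¹ • m = m` hidden in `sectionAct` disappears. -/
theorem mk_sectionAct (g : G) (φ : Π x, E x) (m : M) :
    (⟨m, sectionAct (F := F) g φ m⟩ : TotalSpace F E) = g • ⟨g⁻¹ • m, φ (g⁻¹ • m)⟩ := by
  have aux : ∀ (p : TotalSpace F E) (h : p.proj = m), (⟨m, h ▸ p.snd⟩ : TotalSpace F E) = p := by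
    rintro p rfl
    rfl
  exact aux _ _

variable (F E) in
theorem exists_linearMap_sectionAct (g : G) (m : M) :
    ∃ A : E (g⁻¹ • m) →ₗ[ℂ] E m,
      (∀ v, g • (⟨g⁻¹ • m, v⟩ : TotalSpace F E) = ⟨m, A v⟩) ∧
      ∀ φ : Π x, E x, sectionAct (F := F) g φ m = A (φ (g⁻¹ • m)) := by
  obtain ⟨A, hA⟩ := exists_linearMap_of_smul_eq F E g (smul_inv_smul g m)
  exact ⟨A, hA, fun φ ↦ TotalSpace.mk_inj.1 ((mk_sectionAct g φ m).trans (hA _))⟩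

variable (F) in
theorem sectionAct_one (φ : Π x, E x) (m : M) : sectionAct (F := F) (1 : G) φ m = φ m := by
  have h := mk_sectionAct (F := F) (1 : G) φ m
  have aux : ∀ y : M, y = m → (⟨y, φ y⟩ : TotalSpace F E) = ⟨m, φ m⟩ := by
    rintro _ rfl
    rfl
  rw [one_smul, aux _ (by simp)] at h
  exact TotalSpace.mk_inj.1 h

theorem sectionAct_add (g : G) (φ ψ : Π x, E x) (m : M) :
    sectionAct (F := F) g (φ + ψ) m = sectionAct (F := F) g φ m + sectionAct (F := F) g ψ m := by
  obtain ⟨A, -, hA⟩ := exists_linearMap_sectionAct F E g m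
  rw [hA, hA, hA, Pi.add_apply, map_add]

theorem sectionAct_smul (g : G) (f : M → ℂ) (φ : Π x, E x) (m : M) :
    sectionAct (F := F) g (fun x ↦ f x • φ x) m = f (g⁻¹ • m) • sectionAct (F := F) g φ m := by
  obtain ⟨A, -, hA⟩ := exists_linearMap_sectionAct F E g m
  rw [hA, hA, map_smul]

end SectionAct

/-! ### The moment map is a tensor. -/

section Moment

variable {EG : Type*} [NormedAddCommGroup EG] [NormedSpace ℝ EG]
    {G : Type*} [TopologicalSpace G] [ChartedSpace EG G] [Group G] [LieGroup 𝓘(ℝ, EG) ∞ G]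
    {EM : Type*} [NormedAddCommGroup EM] [NormedSpace ℝ EM]
    {M : Type*} [TopologicalSpace M] [ChartedSpace EM M] [IsManifold 𝓘(ℝ, EM) ∞ M]
    [MulAction G M] [ContMDiffSMul 𝓘(ℝ, EG) 𝓘(ℝ, EM) ∞ G M]

theorem mdifferentiableAt_inv_smul (m : M) (g : G) :
    MDifferentiableAt 𝓘(ℝ, EG) 𝓘(ℝ, EM) (fun g : G ↦ g⁻¹ • m) g := by
  have h : ContMDiff 𝓘(ℝ, EG) 𝓘(ℝ, EM) ∞ (fun g : G ↦ g⁻¹ • m) :=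
    (contMDiff_inv 𝓘(ℝ, EG) ∞).smul contMDiff_const
  exact h.mdifferentiableAt (by simp)

/-- The derivative of `g ↦ g⁻¹ m` at the identity is `-X^♯`. -/
theorem mfderiv_inv_smul (m : M) (X : GroupLieAlgebra 𝓘(ℝ, EG) G) :
    (show EM from mfderiv 𝓘(ℝ, EG) 𝓘(ℝ, EM) (fun g : G ↦ g⁻¹ • m) 1 X) =
      -(show EM from fundamentalField (EM := EM) X m) := by
  have hs : MDifferentiableAt (𝓘(ℝ, EG).prod 𝓘(ℝ, EM)) 𝓘(ℝ, EM)
      (fun p : G × M ↦ p.1 • p.2) ((1 : G), m) :=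
    (contMDiff_smul (n := ∞) (I := 𝓘(ℝ, EG)) (I' := 𝓘(ℝ, EM))).mdifferentiableAt (by simp)
  have hi := mdifferentiableAt_inv_smul (EG := EG) (EM := EM) m (1 : G)
  have hp : MDifferentiableAt 𝓘(ℝ, EG) (𝓘(ℝ, EG).prod 𝓘(ℝ, EM))
      (fun g : G ↦ (g, g⁻¹ • m)) 1 := mdifferentiableAt_id.prodMk hi
  let D : EM := mfderiv 𝓘(ℝ, EG) 𝓘(ℝ, EM) (fun g : G ↦ g⁻¹ • m) 1 X
  let L : EG × EM →L[ℝ] EM := mfderiv (𝓘(ℝ, EG).prod 𝓘(ℝ, EM)) 𝓘(ℝ, EM)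
    (fun p : G × M ↦ p.1 • p.2) ((1 : G), m)
  -- The constant map `g ↦ g • (g⁻¹ • m)` is differentiated by the product rule. Its two terms are
  -- `X^♯` and the derivative sought.
  have h1 : mfderiv 𝓘(ℝ, EG) 𝓘(ℝ, EM)
      ((fun p : G × M ↦ p.1 • p.2) ∘ fun g : G ↦ (g, g⁻¹ • m)) 1 X =
      L (mfderiv 𝓘(ℝ, EG) (𝓘(ℝ, EG).prod 𝓘(ℝ, EM)) (fun g : G ↦ (g, g⁻¹ • m)) 1 X) :=
    mfderiv_comp_apply_of_eq (1 : G) hs hp (by simp) X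
  have h2 : (fun p : G × M ↦ p.1 • p.2) ∘ (fun g : G ↦ (g, g⁻¹ • m)) = fun _ ↦ m := by
    funext g
    simp
  have h3 : (show EM from mfderiv 𝓘(ℝ, EG) 𝓘(ℝ, EM)
      ((fun p : G × M ↦ p.1 • p.2) ∘ fun g : G ↦ (g, g⁻¹ • m)) 1 X) = 0 := by
    rw [h2]
    exact DFunLike.congr_fun (mfderiv_const (c := m)) X
  have h4 : (mfderiv 𝓘(ℝ, EG) (𝓘(ℝ, EG).prod 𝓘(ℝ, EM)) (fun g : G ↦ (g, g⁻¹ • m)) 1 X) =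
      ((X, D) : EG × EM) :=
    DFunLike.congr_fun ((hasMFDerivAt_id (1 : G)).prodMk hi.hasMFDerivAt).mfderiv X
  have h5 : L (X, D) = (show EM from mfderiv 𝓘(ℝ, EG) 𝓘(ℝ, EM) (fun g : G ↦ g • m) 1 X) +
      (show EM from mfderiv 𝓘(ℝ, EM) 𝓘(ℝ, EM) (fun x : M ↦ (1 : G) • x) m D) :=
    mfderiv_prod_eq_add_apply (v := ((X, D) : EG × EM)) hs
  have h6 : (show EM from mfderiv 𝓘(ℝ, EM) 𝓘(ℝ, EM) (fun x : M ↦ (1 : G) • x) m D) = D := by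
    have : (fun x : M ↦ (1 : G) • x) = id := funext fun x ↦ one_smul G x
    rw [this]
    exact DFunLike.congr_fun (mfderiv_id (x := m)) D
  have h7 : L (X, D) = 0 := (congrArg L h4.symm).trans (h1.symm.trans h3)
  rw [h6, h7] at h5
  exact eq_neg_of_add_eq_zero_right h5.symm

theorem mvfderiv_comp_inv_smul {A : Type*} [NormedAddCommGroup A] [NormedSpace ℝ A] {f : M → A}
    {m : M} (hf : MDifferentiableAt 𝓘(ℝ, EM) 𝓘(ℝ, A) f m) (X : GroupLieAlgebra 𝓘(ℝ, EG) G) :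
    mvfderiv 𝓘(ℝ, EG) (fun g : G ↦ f (g⁻¹ • m)) 1 X =
      -mvfderiv 𝓘(ℝ, EM) f m (fundamentalField (EM := EM) X m) := by
  let D : EM →L[ℝ] A := mvfderiv 𝓘(ℝ, EM) f m
  have h1 : mvfderiv 𝓘(ℝ, EG) (fun g : G ↦ f (g⁻¹ • m)) 1 X =
      D (show EM from mfderiv 𝓘(ℝ, EG) 𝓘(ℝ, EM) (fun g : G ↦ g⁻¹ • m) 1 X) :=
    mfderiv_comp_apply_of_eq (f := fun g : G ↦ g⁻¹ • m) (1 : G) hf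
      (mdifferentiableAt_inv_smul (EG := EG) (EM := EM) m (1 : G)) (by simp) X
  rw [h1, mfderiv_inv_smul]
  exact D.map_neg _

variable {F : Type*} [NormedAddCommGroup F] [NormedSpace ℂ F] [FiniteDimensional ℂ F]
    {E : M → Type*} [∀ x, NormedAddCommGroup (E x)] [∀ x, InnerProductSpace ℂ (E x)]
    [TopologicalSpace (TotalSpace F E)] [FiberBundle F E] [VectorBundle ℂ F E] [VectorBundle ℝ F E]
    [ContMDiffVectorBundle ∞ F E 𝓘(ℝ, EM)]
    [MulAction G (TotalSpace F E)] [IsEquivariantBundle G F E]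
    [ContMDiffSMul 𝓘(ℝ, EG) (𝓘(ℝ, EM).prod 𝓘(ℝ, F)) ∞ G (TotalSpace F E)]

/-- A differentiable section is differentiable along the group. -/
theorem mdifferentiableAt_sectionAct {φ : Π x, E x} {m : M}
    (hφ : MDifferentiableAt 𝓘(ℝ, EM) (𝓘(ℝ, EM).prod 𝓘(ℝ, F))
      (fun x ↦ TotalSpace.mk' F x (φ x)) m) :
    MDifferentiableAt 𝓘(ℝ, EG) 𝓘(ℝ, E m) (fun g : G ↦ sectionAct (F := F) g φ m) 1 := by
  have h1 : MDifferentiableAt 𝓘(ℝ, EG) (𝓘(ℝ, EM).prod 𝓘(ℝ, F))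
      (fun g : G ↦ TotalSpace.mk' F (g⁻¹ • m) (φ (g⁻¹ • m))) 1 :=
    MDifferentiableAt.comp_of_eq (f := fun g : G ↦ g⁻¹ • m) (1 : G) hφ
      (mdifferentiableAt_inv_smul m 1) (by simp)
  have h2 : MDifferentiableAt 𝓘(ℝ, EG) (𝓘(ℝ, EM).prod 𝓘(ℝ, F))
      (fun g : G ↦ g • TotalSpace.mk' F (g⁻¹ • m) (φ (g⁻¹ • m))) 1 :=
    MDifferentiableAt.comp (1 : G) (g := fun p : G × TotalSpace F E ↦ p.1 • p.2)
      ((contMDiff_smul (n := ∞) (I := 𝓘(ℝ, EG))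
        (I' := 𝓘(ℝ, EM).prod 𝓘(ℝ, F))).mdifferentiableAt (by simp))
      (mdifferentiableAt_id.prodMk h1)
  let t := trivializationAt F E m
  have hm : m ∈ t.baseSet := mem_baseSet_trivializationAt F E m
  have h3 : MDifferentiableAt 𝓘(ℝ, EG) 𝓘(ℝ, F)
      (fun g : G ↦ (t ⟨m, sectionAct (F := F) g φ m⟩).2) 1 := by
    have h4 : (fun g : G ↦ (⟨m, sectionAct (F := F) g φ m⟩ : TotalSpace F E)) =
        fun g : G ↦ g • TotalSpace.mk' F (g⁻¹ • m) (φ (g⁻¹ • m)) :=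
      funext fun g ↦ mk_sectionAct g φ m
    rw [← h4, t.mdifferentiableAt_totalSpace_iff 𝓘(ℝ, EM)] at h2
    · exact h2.2
    · exact (t.mem_source).2 hm
  -- All the vectors lie in the one fiber `E m`, which the trivialization identifies linearly and
  -- continuously with `F`.
  have h5 : (fun g : G ↦ sectionAct (F := F) g φ m) = (t.continuousLinearEquivAt ℝ m hm).symm ∘
      fun g : G ↦ (t ⟨m, sectionAct (F := F) g φ m⟩).2 := by
    funext g
    exact ((t.continuousLinearEquivAt ℝ m hm).symm_apply_apply _).symm
  rw [h5]
  exact (ContinuousLinearMap.mdifferentiableAt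
    ((t.continuousLinearEquivAt ℝ m hm).symm : F →L[ℝ] E m)).comp 1 h3

theorem momentOp_add (cov : CovariantDerivative 𝓘(ℝ, EM) F E) (X : GroupLieAlgebra 𝓘(ℝ, EG) G)
    {φ ψ : Π x, E x} {m : M}
    (hφ : MDifferentiableAt 𝓘(ℝ, EM) (𝓘(ℝ, EM).prod 𝓘(ℝ, F)) (fun x ↦ TotalSpace.mk' F x (φ x)) m)
    (hψ : MDifferentiableAt 𝓘(ℝ, EM) (𝓘(ℝ, EM).prod 𝓘(ℝ, F)) (fun x ↦ TotalSpace.mk' F x (ψ x)) m) :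
    momentOp cov X (φ + ψ) m = momentOp cov X φ m + momentOp cov X ψ m := by
  have h1 : (fun g : G ↦ sectionAct (F := F) g (φ + ψ) m) =
      (fun g : G ↦ sectionAct (F := F) g φ m) + fun g : G ↦ sectionAct (F := F) g ψ m :=
    funext fun g ↦ sectionAct_add g φ ψ m
  have h2 := DFunLike.congr_fun (cov.isCovariantDerivativeOnUniv.add hφ hψ)
    (fundamentalField (EM := EM) X m)
  have h3 := DFunLike.congr_fun (mvfderiv_add (mdifferentiableAt_sectionAct (G := G) (EG := EG) hφ)
    (mdifferentiableAt_sectionAct (G := G) (EG := EG) hψ)) X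
  rw [momentOp, momentOp, momentOp, h1]
  refine (congrArg₂ (· + ·) h2 h3).trans ?_
  rw [add_apply, add_apply]
  abel

/-- The Leibniz rule of `∇` contributes `df(X^♯) φ` and the Lie derivative contributes its negative,
since `f` is evaluated at `g⁻¹ • m`. The two cancel. -/
theorem momentOp_smul (cov : CovariantDerivative 𝓘(ℝ, EM) F E) (X : GroupLieAlgebra 𝓘(ℝ, EG) G)
    {f : M → ℝ} {φ : Π x, E x} {m : M} (hf : MDifferentiableAt 𝓘(ℝ, EM) 𝓘(ℝ, ℝ) f m)
    (hφ : MDifferentiableAt 𝓘(ℝ, EM) (𝓘(ℝ, EM).prod 𝓘(ℝ, F))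
      (fun x ↦ TotalSpace.mk' F x (φ x)) m) :
    momentOp cov X (f • φ) m = f m • momentOp cov X φ m := by
  have hi := mdifferentiableAt_inv_smul (EG := EG) (EM := EM) m (1 : G)
  have h1 : (fun g : G ↦ sectionAct (F := F) g (f • φ) m) =
      (fun g : G ↦ f (g⁻¹ • m)) • fun g : G ↦ sectionAct (F := F) g φ m :=
    funext fun g ↦ sectionAct_smul g (fun x ↦ (f x : ℂ)) φ m
  have hfi : MDifferentiableAt 𝓘(ℝ, EG) 𝓘(ℝ, ℝ) (fun g : G ↦ f (g⁻¹ • m)) 1 :=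
    MDifferentiableAt.comp_of_eq (f := fun g : G ↦ g⁻¹ • m) (1 : G) hf hi (by simp)
  have hd : mvfderiv 𝓘(ℝ, EG) (fun g : G ↦ f (g⁻¹ • m)) 1 X =
      -mvfderiv 𝓘(ℝ, EM) f m (fundamentalField (EM := EM) X m) :=
    mvfderiv_comp_inv_smul hf X
  have h2 := DFunLike.congr_fun (cov.isCovariantDerivativeOnUniv.leibniz hφ hf)
    (fundamentalField (EM := EM) X m)
  have h3 := DFunLike.congr_fun (mvfderiv_smul hfi
    (mdifferentiableAt_sectionAct (G := G) (EG := EG) hφ)) X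
  rw [momentOp, momentOp, h1]
  refine (congrArg₂ (· + ·) h2 h3).trans ?_
  rw [add_apply, add_apply, smul_apply, smul_apply, ContinuousLinearMap.smulRight_apply,
    ContinuousLinearMap.smulRight_apply, hd, sectionAct_one, inv_one, one_smul, neg_smul, smul_add]
  abel

theorem momentOp_complex_smul (cov : CovariantDerivative 𝓘(ℝ, EM) F E)
    (hcov : IsSmoothComplexConnection cov) (X : GroupLieAlgebra 𝓘(ℝ, EG) G)
    (c : ℂ) {φ : Π x, E x} {m : M}
    (hφ : MDifferentiableAt 𝓘(ℝ, EM) (𝓘(ℝ, EM).prod 𝓘(ℝ, F))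
      (fun x ↦ TotalSpace.mk' F x (φ x)) m) :
    momentOp cov X (fun x ↦ c • φ x) m = c • momentOp cov X φ m := by
  have h1 : (fun g : G ↦ sectionAct (F := F) g (fun x ↦ c • φ x) m) =
      (c • ContinuousLinearMap.id ℝ (E m)) ∘ fun g : G ↦ sectionAct (F := F) g φ m :=
    funext fun g ↦ sectionAct_smul g (fun _ ↦ c) φ m
  have h3 := mfderiv_comp_apply (1 : G)
    ((c • ContinuousLinearMap.id ℝ (E m)).mdifferentiableAt (x := sectionAct (F := F) (1 : G) φ m))
    (mdifferentiableAt_sectionAct (G := G) (EG := EG) hφ) X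
  have h4 : mfderiv 𝓘(ℝ, E m) 𝓘(ℝ, E m) (c • ContinuousLinearMap.id ℝ (E m))
      (sectionAct (F := F) (1 : G) φ m) = c • ContinuousLinearMap.id ℝ (E m) :=
    ContinuousLinearMap.mfderiv_eq _
  have h5 : mvfderiv 𝓘(ℝ, EG) ((c • ContinuousLinearMap.id ℝ (E m)) ∘
      fun g : G ↦ sectionAct (F := F) g φ m) 1 X =
      c • mvfderiv 𝓘(ℝ, EG) (fun g : G ↦ sectionAct (F := F) g φ m) 1 X :=
    h3.trans (DFunLike.congr_fun h4 _)
  rw [momentOp, momentOp, h1, hcov.complex_smul c φ m hφ, h5, smul_add]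

/-- The moment map of a connection is characterized by `μ(X) φ = ∇_{X^♯} φ + L_X φ`. -/
theorem momentMap_apply [FiniteDimensional ℝ EM] (cov : CovariantDerivative 𝓘(ℝ, EM) F E)
    (hcov : IsSmoothComplexConnection cov) (X : GroupLieAlgebra 𝓘(ℝ, EG) G) {φ : Π x, E x} {m : M}
    (hφ : MDifferentiableAt 𝓘(ℝ, EM) (𝓘(ℝ, EM).prod 𝓘(ℝ, F))
      (fun x ↦ TotalSpace.mk' F x (φ x)) m) :
    momentMap cov X m (φ m) = momentOp cov X φ m := by
  have : FiniteDimensional ℝ F := FiniteDimensional.complexToReal F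
  -- Tensoriality over real functions makes the value depend only on `φ m`. Complex homogeneity is
  -- added in `L`, so that it agrees with the map defined on a complex basis.
  have hΦ : TensorialAt 𝓘(ℝ, EM) F (fun φ ↦ momentOp cov X φ m) m :=
    ⟨fun hf hφ ↦ momentOp_smul cov X hf hφ, fun hφ hψ ↦ momentOp_add cov X hφ hψ⟩
  have hext : ∀ v : E m, MDifferentiableAt 𝓘(ℝ, EM) (𝓘(ℝ, EM).prod 𝓘(ℝ, F))
      (fun x ↦ TotalSpace.mk' F x (FiberBundle.extend F v x)) m := fun v ↦
    FiberBundle.mdifferentiableAt_extend 𝓘(ℝ, EM) F v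
  let L : E m →ₗ[ℂ] E m :=
    { toFun := fun v ↦ momentOp cov X (FiberBundle.extend F v) m
      map_add' := fun v w ↦ (hΦ.mkHom _ m).map_add v w
      map_smul' := fun c v ↦ by
        rw [RingHom.id_apply, ← momentOp_complex_smul cov hcov X c (hext v)]
        exact hΦ.pointwise (hext _) (mdifferentiableAt_complex_smul_section (hext v) c) (by simp) }
  have hL : momentMap cov X m = L := by
    refine (fiberBasis F E m).ext fun j ↦ ?_
    rw [momentMap, Module.Basis.constr_basis]
    rfl
  rw [hL]
  exact hΦ.pointwise (hext _) hφ (by simp)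

end Moment

/-! ### Skew-hermitian endomorphisms and determinants. -/

section LinearAlgebra

variable {V : Type*} [NormedAddCommGroup V] [InnerProductSpace ℂ V] [FiniteDimensional ℂ V]

/-- A skew-hermitian endomorphism `A` with `det (1 + A) = 1` vanishes. -/
theorem eq_zero_of_det_one_add_eq_one {A : V →ₗ[ℂ] V}
    (hA : ∀ v w : V, inner ℂ (A v) w + inner ℂ v (A w) = 0) (hdet : LinearMap.det (1 + A) = 1) :
    A = 0 := by
  have hadj : ∀ v w : V, inner ℂ (A v) w = -inner ℂ v (A w) := fun v w ↦
    eq_neg_of_add_eq_zero_left (hA v w)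
  have h1 : LinearMap.adjoint (1 + A) = 1 - A := by
    refine ((LinearMap.eq_adjoint_iff _ _).2 fun v w ↦ ?_).symm
    simp [inner_sub_left, inner_add_right, hadj]
  have h2 : LinearMap.det (1 - A) = 1 := by
    let e := stdOrthonormalBasis ℂ V
    rw [← h1, ← LinearMap.det_toMatrix e.toBasis, LinearMap.toMatrix_adjoint e e,
      Matrix.det_conjTranspose, LinearMap.det_toMatrix, hdet, star_one]
  -- This is `1 + A*A`: symmetric, of determinant 1, with eigenvalue `1 + ‖A b‖²` on each unit
  -- eigenvector `b`.
  let T : V →ₗ[ℂ] V := (1 + A) * (1 - A)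
  have hT : ∀ v w, inner ℂ (T v) w = inner ℂ v w + inner ℂ (A v) (A w) := by
    intro v w
    simp [T, hadj, sub_eq_add_neg]
  have hTs : T.IsSymmetric := by
    intro v w
    rw [hT, ← inner_conj_symm v (T w), hT, map_add, inner_conj_symm, inner_conj_symm]
  have hTd : LinearMap.det T = 1 := by
    simp [T, hdet, h2]
  let b := hTs.eigenvectorBasis (rfl : Module.finrank ℂ V = _)
  have hev : ∀ i, hTs.eigenvalues rfl i = 1 + ‖A (b i)‖ ^ 2 := by
    intro i
    have h := hT (b i) (b i)
    rw [hTs.apply_eigenvectorBasis rfl i, inner_smul_left, inner_self_eq_norm_sq_to_K,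
      inner_self_eq_norm_sq_to_K, b.norm_eq_one] at h
    have h' : ((hTs.eigenvalues rfl i : ℝ) : ℂ) = ((1 + ‖A (b i)‖ ^ 2 : ℝ) : ℂ) := by
      simpa using h
    exact_mod_cast h'
  have hprod : ∏ i, (1 + ‖A (b i)‖ ^ 2) = 1 := by
    have h := hTs.det_eq_prod_eigenvalues rfl
    rw [hTd] at h
    simp only [hev] at h
    norm_cast at h
    exact Complex.ofReal_injective (h.symm.trans Complex.ofReal_one.symm)
  have hzero : ∀ i, A (b i) = 0 := by
    intro i
    by_contra hi
    -- A single nonzero `A (b i)` would make the product of these factors exceed 1.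
    refine (Finset.prod_lt_prod (s := Finset.univ) (f := fun _ ↦ (1 : ℝ))
      (g := fun i ↦ 1 + ‖A (b i)‖ ^ 2) (fun _ _ ↦ one_pos)
      (fun i _ ↦ le_add_of_nonneg_right (sq_nonneg _)) ⟨i, Finset.mem_univ i, ?_⟩).ne ?_
    · have := norm_pos_iff.2 hi
      exact lt_add_of_pos_right 1 (by positivity)
    · rw [hprod, Finset.prod_const_one]
  exact b.toBasis.ext fun i ↦ by simpa using hzero i

end LinearAlgebra

/-! ### The moment map is skew-hermitian. -/

section Hermitian

variable {EG : Type*} [NormedAddCommGroup EG] [NormedSpace ℝ EG]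
    {G : Type*} [TopologicalSpace G] [ChartedSpace EG G] [Group G] [LieGroup 𝓘(ℝ, EG) ∞ G]
    {EM : Type*} [NormedAddCommGroup EM] [NormedSpace ℝ EM]
    {M : Type*} [TopologicalSpace M] [ChartedSpace EM M] [IsManifold 𝓘(ℝ, EM) ∞ M]
    [MulAction G M] [ContMDiffSMul 𝓘(ℝ, EG) 𝓘(ℝ, EM) ∞ G M]

theorem mvfderiv_inner {V : Type*} [NormedAddCommGroup V] [InnerProductSpace ℂ V]
    {a b : M → V} {m : M} (ha : MDifferentiableAt 𝓘(ℝ, EM) 𝓘(ℝ, V) a m)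
    (hb : MDifferentiableAt 𝓘(ℝ, EM) 𝓘(ℝ, V) b m) (u : TangentSpace 𝓘(ℝ, EM) m) :
    mvfderiv 𝓘(ℝ, EM) (fun x ↦ inner ℂ (a x) (b x)) m u =
      inner ℂ (mvfderiv 𝓘(ℝ, EM) a m u) (b m) + inner ℂ (a m) (mvfderiv 𝓘(ℝ, EM) b m u) := by
  have h : HasMFDerivAt 𝓘(ℝ, EM) 𝓘(ℝ, ℂ) (fun x ↦ inner ℂ (a x) (b x)) m
      ((fderivInnerCLM ℂ (a m, b m)).comp ((mvfderiv 𝓘(ℝ, EM) a m).prod (mvfderiv 𝓘(ℝ, EM) b m))) := by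
    refine ⟨ha.continuousAt.inner hb.continuousAt, ?_⟩
    have h1 := HasFDerivWithinAt.inner ℂ ha.hasMFDerivAt.2 hb.hasMFDerivAt.2
    simp only [mfld_simps] at h1 ⊢
    exact h1
  have h2 := DFunLike.congr_fun h.mfderiv u
  refine h2.trans ?_
  exact add_comm _ _

variable {F : Type*} [NormedAddCommGroup F] [NormedSpace ℂ F] [FiniteDimensional ℂ F]
    {E : M → Type*} [∀ x, NormedAddCommGroup (E x)] [∀ x, InnerProductSpace ℂ (E x)]
    [TopologicalSpace (TotalSpace F E)] [FiberBundle F E] [VectorBundle ℂ F E] [VectorBundle ℝ F E]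
    [ContMDiffVectorBundle ∞ F E 𝓘(ℝ, EM)]
    [MulAction G (TotalSpace F E)] [IsEquivariantBundle G F E]
    [ContMDiffSMul 𝓘(ℝ, EG) (𝓘(ℝ, EM).prod 𝓘(ℝ, F)) ∞ G (TotalSpace F E)]

theorem inner_sectionAct (hisometric : IsInvariantHermitian G F E) (g : G) (φ ψ : Π x, E x)
    (m : M) : inner ℂ (sectionAct (F := F) g φ m) (sectionAct (F := F) g ψ m) =
      inner ℂ (φ (g⁻¹ • m)) (ψ (g⁻¹ • m)) := by
  have aux : ∀ (x y : M) (v w : E x) (v' w' : E y), g • x = y →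
      g • (⟨x, v⟩ : TotalSpace F E) = ⟨y, v'⟩ → g • (⟨x, w⟩ : TotalSpace F E) = ⟨y, w'⟩ →
      inner ℂ v' w' = inner ℂ v w := by
    rintro x _ v w v' w' rfl
    exact hisometric g x v w v' w'
  exact aux _ _ _ _ _ _ (smul_inv_smul g m) (mk_sectionAct g φ m).symm (mk_sectionAct g ψ m).symm

/-- The moment map of a hermitian connection is skew-hermitian. -/
theorem inner_momentMap [FiniteDimensional ℝ EM] (hmetric : IsSmoothHermitian EM F E)
    (hisometric : IsInvariantHermitian G F E) (cov : CovariantDerivative 𝓘(ℝ, EM) F E)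
    (hcov : IsSmoothComplexConnection cov) (hhermitian : IsHermitianConnection cov)
    (X : GroupLieAlgebra 𝓘(ℝ, EG) G) (m : M) (v w : E m) :
    inner ℂ (momentMap cov X m v) w + inner ℂ v (momentMap cov X m w) = 0 := by
  have : FiniteDimensional ℝ F := FiniteDimensional.complexToReal F
  let φ := FiberBundle.extend F v
  let ψ := FiberBundle.extend F w
  have hv : φ m = v := by simp [φ]
  have hw : ψ m = w := by simp [ψ]
  have hφ : MDifferentiableAt 𝓘(ℝ, EM) (𝓘(ℝ, EM).prod 𝓘(ℝ, F))
      (fun x ↦ TotalSpace.mk' F x (φ x)) m := FiberBundle.mdifferentiableAt_extend 𝓘(ℝ, EM) F v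
  have hψ : MDifferentiableAt 𝓘(ℝ, EM) (𝓘(ℝ, EM).prod 𝓘(ℝ, F))
      (fun x ↦ TotalSpace.mk' F x (ψ x)) m := FiberBundle.mdifferentiableAt_extend 𝓘(ℝ, EM) F w
  have hinner : MDifferentiableAt 𝓘(ℝ, EM) 𝓘(ℝ, ℂ) (fun x ↦ inner ℂ (φ x) (ψ x)) m := by
    obtain ⟨s, hs, hs'⟩ := FiberBundle.exists_contMDiffOn_extend (k := ∞) 𝓘(ℝ, EM) F v
    obtain ⟨t, ht, ht'⟩ := FiberBundle.exists_contMDiffOn_extend (k := ∞) 𝓘(ℝ, EM) F w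
    have h1 := hmetric (interior (s ∩ t)) φ ψ isOpen_interior
      (hs'.mono (interior_subset.trans Set.inter_subset_left))
      (ht'.mono (interior_subset.trans Set.inter_subset_right))
    exact (h1.contMDiffAt (isOpen_interior.mem_nhds
      (mem_interior_iff_mem_nhds.2 (Filter.inter_mem hs ht)))).mdifferentiableAt (by simp)
  -- The derivative of `⟨φ, ψ⟩` along the orbit is computed twice: by isometry it gives the Lie
  -- derivatives with a minus sign, by compatibility the covariant ones. Their sum is the claim.
  have h1 := mvfderiv_comp_inv_smul (G := G) (EG := EG) hinner X
  have h2 : (fun g : G ↦ inner ℂ (φ (g⁻¹ • m)) (ψ (g⁻¹ • m))) = fun g : G ↦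
      inner ℂ (sectionAct (F := F) g φ m) (sectionAct (F := F) g ψ m) :=
    funext fun g ↦ (inner_sectionAct hisometric g φ ψ m).symm
  have h3 := mvfderiv_inner (mdifferentiableAt_sectionAct (G := G) (EG := EG) hφ)
    (mdifferentiableAt_sectionAct (G := G) (EG := EG) hψ) X
  rw [← h2] at h3
  have h4 := hhermitian φ ψ m hφ hψ (fundamentalField (EM := EM) X m)
  rw [h1, h4, sectionAct_one, sectionAct_one] at h3
  rw [← hv, ← hw, momentMap_apply cov hcov X hφ, momentMap_apply cov hcov X hψ, momentOp, momentOp,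
    inner_add_left, inner_add_right]
  linear_combination -h3

end Hermitian

/-! ### The Chern form of a flat connection. -/

section ChernForm

variable {EG : Type*} [NormedAddCommGroup EG] [NormedSpace ℝ EG]
  {G : Type*} [TopologicalSpace G] [ChartedSpace EG G] [Group G]
  {EM : Type*} [NormedAddCommGroup EM] [NormedSpace ℝ EM] [FiniteDimensional ℝ EM]
  {M : Type*} [TopologicalSpace M] [ChartedSpace EM M] [IsManifold 𝓘(ℝ, EM) ∞ M] [MulAction G M]
  {F : Type*} [NormedAddCommGroup F] [NormedSpace ℂ F] [FiniteDimensional ℂ F]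
  {E : M → Type*} [∀ x, NormedAddCommGroup (E x)] [∀ x, InnerProductSpace ℂ (E x)]
  [TopologicalSpace (TotalSpace F E)] [FiberBundle F E] [VectorBundle ℂ F E]
  [MulAction G (TotalSpace F E)] [IsEquivariantBundle G F E]

/-- Scalars are recovered as the degree-zero part of a form. So an identity of Chern forms becomes
one of determinants. -/
theorem algebraMap_center_forms_injective (T : Type*) [AddCommGroup T] [Module ℝ T] :
    Function.Injective (algebraMap ℂ (Subalgebra.center ℂ (Forms T))) := by
  intro x y h
  exact (ExteriorAlgebra.algebraMap_leftInverse (R := ℂ) (T →ₗ[ℝ] ℂ)).injective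
    (congrArg Subtype.val h)

/-- For a flat connection, the total equivariant Chern form is the function `det (1 + μ(X))`. -/
theorem totalEquivariantChernForm_of_flat (cov : CovariantDerivative 𝓘(ℝ, EM) F E)
    (X : GroupLieAlgebra 𝓘(ℝ, EG) G) (m : M)
    (hflat : ∀ u v : TangentSpace 𝓘(ℝ, EM) m, curvature cov m u v = 0) :
    totalEquivariantChernForm cov X m =
      algebraMap ℂ _ (LinearMap.det (1 + momentMap cov X m)) := by
  have h1 : (Matrix.of fun i j ↦ (2 * Real.pi * Complex.I : ℂ)⁻¹ • twoForm fun u v ↦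
      LinearMap.toMatrix (fiberBasis F E m) (fiberBasis F E m) (curvature cov m u v) i j) = 0 := by
    ext i j : 1
    simp [hflat, twoForm]
  rw [totalEquivariantChernForm, h1, add_zero, ← LinearMap.det_toMatrix (fiberBasis F E m),
    RingHom.map_det, map_add, LinearMap.toMatrix_one, RingHom.mapMatrix_apply, Matrix.map_add,
    Matrix.map_one]
  all_goals simp

/-- For a flat connection with skew-hermitian moment map, the total equivariant Chern form is trivial
if and only if the moment map vanishes. -/
theorem totalEquivariantChernForm_eq_one_iff (cov : CovariantDerivative 𝓘(ℝ, EM) F E)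
    (X : GroupLieAlgebra 𝓘(ℝ, EG) G) (m : M)
    (hflat : ∀ u v : TangentSpace 𝓘(ℝ, EM) m, curvature cov m u v = 0)
    (hskew : ∀ v w : E m, inner ℂ (momentMap cov X m v) w + inner ℂ v (momentMap cov X m w) = 0) :
    totalEquivariantChernForm cov X m = 1 ↔ momentMap cov X m = 0 := by
  have : FiniteDimensional ℂ (E m) := (fiberBasis F E m).finiteDimensional_of_finite
  rw [totalEquivariantChernForm_of_flat cov X m hflat]
  constructor
  · intro h
    refine eq_zero_of_det_one_add_eq_one hskew
      (algebraMap_center_forms_injective (TangentSpace 𝓘(ℝ, EM) m) ?_)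
    rw [h, map_one]
  · intro h
    rw [h, add_zero, map_one, map_one]

end ChernForm

/-! ### Descent to the orbit space and the moment map. -/

section OrbitDescent

variable {EG : Type*} [NormedAddCommGroup EG] [NormedSpace ℝ EG] [FiniteDimensional ℝ EG]
    {G : Type*} [TopologicalSpace G] [ChartedSpace EG G] [Group G] [LieGroup 𝓘(ℝ, EG) ∞ G]
    {EM : Type*} [NormedAddCommGroup EM] [NormedSpace ℝ EM] [FiniteDimensional ℝ EM]
    {M : Type*} [TopologicalSpace M] [T2Space M] [ChartedSpace EM M] [IsManifold 𝓘(ℝ, EM) ∞ M]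
    [MulAction G M] [ContMDiffSMul 𝓘(ℝ, EG) 𝓘(ℝ, EM) ∞ G M] [IsCancelSMul G M]
    {EB : Type*} [NormedAddCommGroup EB] [NormedSpace ℝ EB] [FiniteDimensional ℝ EB]
    [ChartedSpace EB (MulAction.orbitRel.Quotient G M)]
    [IsManifold 𝓘(ℝ, EB) ∞ (MulAction.orbitRel.Quotient G M)]

/-- The composite of `q` with an orbit map is constant. -/
theorem mfderiv_orbitMk_fundamentalField
    (hq : Manifold.IsSubmersion 𝓘(ℝ, EM) 𝓘(ℝ, EB) ∞
      (orbitMk G : M → MulAction.orbitRel.Quotient G M))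
    (X : GroupLieAlgebra 𝓘(ℝ, EG) G) (m : M) :
    mfderiv 𝓘(ℝ, EM) 𝓘(ℝ, EB) (orbitMk G : M → MulAction.orbitRel.Quotient G M) m
      (fundamentalField X m) = 0 := by
  have h1 : MDifferentiableAt 𝓘(ℝ, EG) 𝓘(ℝ, EM) (fun g : G ↦ g • m) 1 :=
    (contMDiff_orbitMap EG EM m).mdifferentiableAt (by simp)
  have h2 : MDifferentiableAt 𝓘(ℝ, EM) 𝓘(ℝ, EB)
      (orbitMk G : M → MulAction.orbitRel.Quotient G M) m :=
    (hq.contMDiff m).mdifferentiableAt (by simp)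
  have h3 := mfderiv_comp_apply_of_eq (1 : G) h2 h1 (one_smul G m) X
  have h4 : (orbitMk G : M → MulAction.orbitRel.Quotient G M) ∘ (fun g : G ↦ g • m) =
      fun _ ↦ orbitMk G m := funext fun g ↦ Quotient.sound' ⟨g, rfl⟩
  have h5 : (show EB from mfderiv 𝓘(ℝ, EG) 𝓘(ℝ, EB)
      ((orbitMk G : M → MulAction.orbitRel.Quotient G M) ∘ (fun g : G ↦ g • m)) 1 X) = 0 := by
    rw [h4]
    exact DFunLike.congr_fun mfderiv_const X
  exact h3.symm.trans h5

theorem mfderiv_orbitMk_smul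
    (hq : Manifold.IsSubmersion 𝓘(ℝ, EM) 𝓘(ℝ, EB) ∞
      (orbitMk G : M → MulAction.orbitRel.Quotient G M))
    (g : G) {m : M} (v : TangentSpace 𝓘(ℝ, EM) m)
    (hg : MDifferentiableAt 𝓘(ℝ, EM) 𝓘(ℝ, EM) (fun x : M ↦ g • x) m) :
    (show EB from mfderiv 𝓘(ℝ, EM) 𝓘(ℝ, EB)
      (orbitMk G : M → MulAction.orbitRel.Quotient G M) (g • m)
        (mfderiv 𝓘(ℝ, EM) 𝓘(ℝ, EM) (fun x : M ↦ g • x) m v)) =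
      mfderiv 𝓘(ℝ, EM) 𝓘(ℝ, EB) (orbitMk G : M → MulAction.orbitRel.Quotient G M) m v := by
  have h2 : MDifferentiableAt 𝓘(ℝ, EM) 𝓘(ℝ, EB)
      (orbitMk G : M → MulAction.orbitRel.Quotient G M) (g • m) :=
    (hq.contMDiff _).mdifferentiableAt (by simp)
  have h3 := mfderiv_comp_apply m h2 hg v
  have h4 : (orbitMk G : M → MulAction.orbitRel.Quotient G M) ∘ (fun x : M ↦ g • x) =
      orbitMk G := funext fun x ↦ Quotient.sound' ⟨g, rfl⟩
  have h5 : (show EB from mfderiv 𝓘(ℝ, EM) 𝓘(ℝ, EB)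
      ((orbitMk G : M → MulAction.orbitRel.Quotient G M) ∘ (fun x : M ↦ g • x)) m v) =
      mfderiv 𝓘(ℝ, EM) 𝓘(ℝ, EB) (orbitMk G : M → MulAction.orbitRel.Quotient G M) m v := by
    rw [h4]
  exact h3.symm.trans h5

/-- The vertical vectors are the values of the fundamental vector fields. -/
theorem exists_fundamentalField_eq
    (hEB : Module.finrank ℝ EB = Module.finrank ℝ EM - Module.finrank ℝ EG)
    (hq : Manifold.IsSubmersion 𝓘(ℝ, EM) 𝓘(ℝ, EB) ∞
      (orbitMk G : M → MulAction.orbitRel.Quotient G M))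
    {m : M} {v : TangentSpace 𝓘(ℝ, EM) m}
    (hv : mfderiv 𝓘(ℝ, EM) 𝓘(ℝ, EB) (orbitMk G : M → MulAction.orbitRel.Quotient G M) m v = 0) :
    ∃ X : GroupLieAlgebra 𝓘(ℝ, EG) G, fundamentalField X m = v := by
  let Λ : EG →ₗ[ℝ] EM := (mfderiv 𝓘(ℝ, EG) 𝓘(ℝ, EM) (fun g : G ↦ g • m) 1).toLinearMap
  let D : EM →ₗ[ℝ] EB := (mfderiv 𝓘(ℝ, EM) 𝓘(ℝ, EB)
    (orbitMk G : M → MulAction.orbitRel.Quotient G M) m).toLinearMap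
  have hΛ : Function.Injective Λ := mfderiv_orbitMap_injective m
  have hD : Function.Surjective D := mfderiv_surjective_of_isSubmersion hq m
  have hle : LinearMap.range Λ ≤ LinearMap.ker D := by
    rintro _ ⟨X, rfl⟩
    exact mfderiv_orbitMk_fundamentalField hq X m
  have h1 : Module.finrank ℝ (LinearMap.range Λ) = Module.finrank ℝ EG :=
    LinearMap.finrank_range_of_inj hΛ
  have h2 := D.finrank_range_add_finrank_ker
  rw [LinearMap.range_eq_top.2 hD, finrank_top, hEB] at h2
  have h3 : Module.finrank ℝ EG ≤ Module.finrank ℝ EM := LinearMap.finrank_le_finrank_of_injective hΛ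
  -- Fundamental vectors are vertical, and both spaces have dimension `finrank EG` by injectivity of
  -- `Λ` and surjectivity of `D`.
  have heq : LinearMap.range Λ = LinearMap.ker D :=
    Submodule.eq_of_le_of_finrank_eq hle (by omega)
  have hmem : (v : EM) ∈ LinearMap.range Λ := by
    rw [heq]
    exact hv
  exact hmem

variable {F : Type*} [NormedAddCommGroup F] [NormedSpace ℂ F] [FiniteDimensional ℂ F]
    {E : M → Type*} [∀ x, NormedAddCommGroup (E x)] [∀ x, InnerProductSpace ℂ (E x)]
    [TopologicalSpace (TotalSpace F E)] [FiberBundle F E] [VectorBundle ℂ F E] [VectorBundle ℝ F E]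
    [ContMDiffVectorBundle ∞ F E 𝓘(ℝ, EM)]
    [MulAction G (TotalSpace F E)] [IsEquivariantBundle G F E]
    [ContMDiffSMul 𝓘(ℝ, EG) (𝓘(ℝ, EM).prod 𝓘(ℝ, F)) ∞ G (TotalSpace F E)]
    [∀ b, AddCommGroup (OrbitFiber G F E b)] [∀ b, Module ℂ (OrbitFiber G F E b)]

/-- The fiberwise isomorphism of `E` with the pull-back of `E/G`. -/
def orbitFiberEquiv
    (hadd : ∀ (m : M) (v w : E m), fiberMk G F (v + w) = fiberMk G F v + fiberMk G F w)
    (hsmul : ∀ (m : M) (c : ℂ) (v : E m), fiberMk G F (c • v) = c • fiberMk G F v)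
    (m : M) (b : MulAction.orbitRel.Quotient G M) (h : orbitMk G m = b) :
    E m ≃ₗ[ℂ] OrbitFiber G F E b :=
  LinearEquiv.ofBijective
    { toFun := fiberMkAt F h
      map_add' := by subst h; exact hadd m
      map_smul' := by subst h; exact hsmul m }
    ⟨fiberMkAt_injective h, fiberMkAt_surjective h⟩

variable (hadd : ∀ (m : M) (v w : E m), fiberMk G F (v + w) = fiberMk G F v + fiberMk G F w)
    (hsmul : ∀ (m : M) (c : ℂ) (v : E m), fiberMk G F (c • v) = c • fiberMk G F v)

theorem fiberMk_pullbackSection (s : Π b, OrbitFiber G F E b) (m : M) :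
    fiberMk G F (pullbackSection (orbitFiberEquiv hadd hsmul) s m) = s (orbitMk G m) :=
  (orbitFiberEquiv hadd hsmul m _ rfl).apply_symm_apply _

theorem eq_pullbackSection {s : Π b, OrbitFiber G F E b} {σ : Π m, E m}
    (hσ : ∀ m, fiberMk G F (σ m) = s (orbitMk G m)) :
    σ = pullbackSection (orbitFiberEquiv hadd hsmul) s :=
  funext fun m ↦ fiberMkAt_injective (G := G) (F := F) rfl
    ((hσ m).trans (fiberMk_pullbackSection hadd hsmul s m).symm)

/-- Pull-backs of sections of `E/G` are invariant. -/
theorem sectionAct_pullbackSection (s : Π b, OrbitFiber G F E b) (g : G) :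
    sectionAct (F := F) g (pullbackSection (orbitFiberEquiv hadd hsmul) s) =
      pullbackSection (orbitFiberEquiv hadd hsmul) s := by
  refine eq_pullbackSection hadd hsmul fun m ↦ Subtype.ext ?_
  have h1 : orbitMk G (g⁻¹ • m) = orbitMk G m := Quotient.sound' ⟨g⁻¹, rfl⟩
  have h2 := congrArg Subtype.val (fiberMk_pullbackSection hadd hsmul s (g⁻¹ • m))
  refine Eq.trans (Quotient.sound' ⟨g, ?_⟩) (h2.trans (congrArg (fun b ↦ (s b).1) h1))
  exact (mk_sectionAct g _ m).symm

/-- The section is invariant, so `g ↦ (g σ)(m)` is constant and the Lie derivative drops out. -/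
theorem momentOp_pullbackSection (cov : CovariantDerivative 𝓘(ℝ, EM) F E)
    (X : GroupLieAlgebra 𝓘(ℝ, EG) G) (s : Π b, OrbitFiber G F E b) (m : M) :
    momentOp cov X (pullbackSection (orbitFiberEquiv hadd hsmul) s) m =
      cov (pullbackSection (orbitFiberEquiv hadd hsmul) s) m (fundamentalField (EM := EM) X m) := by
  rw [momentOp]
  simp only [sectionAct_pullbackSection hadd hsmul s]
  rw [mvfderiv_const]
  exact add_zero _

variable [∀ b, TopologicalSpace (OrbitFiber G F E b)]
    [∀ b, IsTopologicalAddGroup (OrbitFiber G F E b)] [∀ b, ContinuousSMul ℝ (OrbitFiber G F E b)]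
    [TopologicalSpace (TotalSpace F (OrbitFiber G F E))] [FiberBundle F (OrbitFiber G F E)]
    [VectorBundle ℂ F (OrbitFiber G F E)] [VectorBundle ℝ F (OrbitFiber G F E)]
    [ContMDiffVectorBundle ∞ F (OrbitFiber G F E) 𝓘(ℝ, EB)]

/-- A connection descends to the orbit space if and only if its moment map vanishes. -/
theorem descends_iff_momentMap_eq_zero
    (hEB : Module.finrank ℝ EB = Module.finrank ℝ EM - Module.finrank ℝ EG)
    (hq : Manifold.IsSubmersion 𝓘(ℝ, EM) 𝓘(ℝ, EB) ∞
      (orbitMk G : M → MulAction.orbitRel.Quotient G M))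
    (hadd : ∀ (m : M) (v w : E m), fiberMk G F (v + w) = fiberMk G F v + fiberMk G F w)
    (hsmul : ∀ (m : M) (c : ℂ) (v : E m), fiberMk G F (c • v) = c • fiberMk G F v)
    (hf : ContMDiff (𝓘(ℝ, EM).prod 𝓘(ℝ, F)) (𝓘(ℝ, EB).prod 𝓘(ℝ, F)) ∞
      (fun p : TotalSpace F E ↦
        (⟨orbitMk G p.proj, fiberMk G F p.snd⟩ : TotalSpace F (OrbitFiber G F E))))
    (cov : CovariantDerivative 𝓘(ℝ, EM) F E) (hcov : IsSmoothComplexConnection cov)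
    (hinvariant : IsInvariantConnection G F E cov) :
    (∃ cov' : CovariantDerivative 𝓘(ℝ, EB) F (OrbitFiber G F E),
      IsSmoothComplexConnection cov' ∧
      ∀ (U : Set (MulAction.orbitRel.Quotient G M)) (s : Π b, OrbitFiber G F E b) (σ : Π m, E m),
        IsOpen U →
        ContMDiffOn 𝓘(ℝ, EB) (𝓘(ℝ, EB).prod 𝓘(ℝ, F)) ∞
          (fun b ↦ (⟨b, s b⟩ : TotalSpace F (OrbitFiber G F E))) U →
        (∀ m, fiberMk G F (σ m) = s (orbitMk G m)) →
        ∀ (m : M) (v : TangentSpace 𝓘(ℝ, EM) m), orbitMk G m ∈ U →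
          fiberMk G F (cov σ m v) = cov' s (orbitMk G m)
            (mfderiv 𝓘(ℝ, EM) 𝓘(ℝ, EB) (orbitMk G : M → MulAction.orbitRel.Quotient G M) m v)) ↔
    ∀ (X : GroupLieAlgebra 𝓘(ℝ, EG) G) (m : M), momentMap cov X m = 0 := by
  have : FiniteDimensional ℝ F := FiniteDimensional.complexToReal F
  constructor
  · rintro ⟨cov', -, h⟩ X m
    ext v
    -- A local section of `E/G` through the class of `v` pulls back to an invariant section through
    -- `v`. Its derivative along `X^♯` is computed below, where `dq(X^♯) = 0`.
    let s := FiberBundle.extend F (fiberMk G F v)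
    let σ := pullbackSection (orbitFiberEquiv hadd hsmul) s
    obtain ⟨U, hU, hs⟩ := FiberBundle.exists_contMDiffOn_extend (k := ∞) 𝓘(ℝ, EB) F (fiberMk G F v)
    have hsm : MDifferentiableAt 𝓘(ℝ, EB) (𝓘(ℝ, EB).prod 𝓘(ℝ, F))
        (fun b ↦ TotalSpace.mk' F b (s b)) (orbitMk G m) :=
      FiberBundle.mdifferentiableAt_extend 𝓘(ℝ, EB) F (fiberMk G F v)
    have hσ := mdifferentiableAt_pullbackSection (orbitFiberEquiv hadd hsmul) hq.contMDiff hf hsm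
    have h1 := h (interior U) s σ isOpen_interior (hs.mono interior_subset)
      (fiberMk_pullbackSection hadd hsmul s) m (fundamentalField X m)
      (mem_interior_iff_mem_nhds.2 hU)
    have h2 : cov σ m (fundamentalField (EM := EM) X m) = 0 := by
      refine (orbitFiberEquiv hadd hsmul m _ rfl).injective (h1.trans ?_)
      rw [map_zero, mfderiv_orbitMk_fundamentalField hq]
      exact map_zero _
    have h3 : σ m = v := by
      refine (orbitFiberEquiv hadd hsmul m _ rfl).injective
        ((fiberMk_pullbackSection hadd hsmul s m).trans ?_)
      simp only [s, FiberBundle.extend_apply_self]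
      rfl
    rw [← h3, momentMap_apply cov hcov X hσ, momentOp_pullbackSection]
    exact h2
  · intro h
    have hvert : ∀ (s : Π b, OrbitFiber G F E b) (m : M),
        MDifferentiableAt 𝓘(ℝ, EB) (𝓘(ℝ, EB).prod 𝓘(ℝ, F)) (fun b ↦ TotalSpace.mk' F b (s b))
          (orbitMk G m) → ∀ v v' : TangentSpace 𝓘(ℝ, EM) m,
        mfderiv 𝓘(ℝ, EM) 𝓘(ℝ, EB) (orbitMk G : M → MulAction.orbitRel.Quotient G M) m v =
          mfderiv 𝓘(ℝ, EM) 𝓘(ℝ, EB) (orbitMk G : M → MulAction.orbitRel.Quotient G M) m v' →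
        cov (pullbackSection (orbitFiberEquiv hadd hsmul) s) m v =
          cov (pullbackSection (orbitFiberEquiv hadd hsmul) s) m v' := by
      intro s m hs v v' hvv'
      have hσ := mdifferentiableAt_pullbackSection (orbitFiberEquiv hadd hsmul) hq.contMDiff hf hs
      -- Two lifts of the same direction differ by a vertical vector `X^♯`, along which `∇` of an
      -- invariant section is `μ(X)` of it, hence zero.
      obtain ⟨X, hX⟩ := exists_fundamentalField_eq (EG := EG) (G := G) hEB hq (v := v - v')
        (by rw [map_sub, hvv', sub_self])
      have h1 := momentMap_apply cov hcov X hσ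
      rw [h X m, momentOp_pullbackSection, hX, map_sub] at h1
      exact (sub_eq_zero.1 h1.symm)
    obtain ⟨cov', hcov', hkey⟩ := exists_descent (orbitFiberEquiv hadd hsmul) cov hcov
      Quotient.mk''_surjective hq hf (by
        intro s b hs m m' hm hm' v v' hvv'
        obtain ⟨g, rfl⟩ := exists_smul_of_orbitMk_eq (hm'.trans hm.symm)
        subst hm
        have hσ := mdifferentiableAt_pullbackSection (orbitFiberEquiv hadd hsmul) hq.contMDiff hf hs
        have h1 := hinvariant g _ m hσ v
        rw [sectionAct_pullbackSection] at h1
        have h2 : (show EB from mfderiv 𝓘(ℝ, EM) 𝓘(ℝ, EB)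
            (orbitMk G : M → MulAction.orbitRel.Quotient G M) (g • m)
              (mfderiv 𝓘(ℝ, EM) 𝓘(ℝ, EM) (fun x : M ↦ g • x) m v)) =
            mfderiv 𝓘(ℝ, EM) 𝓘(ℝ, EB) (orbitMk G : M → MulAction.orbitRel.Quotient G M) m v :=
          mfderiv_orbitMk_smul hq g v
            ((ContMDiffSMul.contMDiff_const_smul (I := 𝓘(ℝ, EG)) (n := ∞) g).mdifferentiable
              (by simp) m)
        -- Invariance has moved the derivative from `m` to `g • m`. There `dg(v)` and `v'` have the
        -- same image under `dq`, so `hvert` compares them.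
        have h3 := hvert s (g • m) (hm' ▸ hs) _ v' (h2.trans hvv')
        rw [← h3]
        exact Subtype.ext (Quotient.sound' ⟨g⁻¹, by simp only [h1, inv_smul_smul]⟩))
    refine ⟨cov', hcov', fun U s σ hU hs hσ m v hm ↦ ?_⟩
    rw [eq_pullbackSection hadd hsmul hσ]
    exact hkey s m ((hs.contMDiffAt (hU.mem_nhds hm)).mdifferentiableAt (by simp)) v

end OrbitDescent

end EquivariantChern

end

/-! ### The equivalence. -/

open EquivariantChern in
theorem mainTheorem12
    -- a Lie group `G`
    {EG : Type*} [NormedAddCommGroup EG] [NormedSpace ℝ EG] [FiniteDimensional ℝ EG]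
    {G : Type*} [TopologicalSpace G] [ChartedSpace EG G] [Group G] [LieGroup 𝓘(ℝ, EG) ∞ G]
    -- a smooth manifold `M`
    {EM : Type*} [NormedAddCommGroup EM] [NormedSpace ℝ EM] [FiniteDimensional ℝ EM]
    {M : Type*} [TopologicalSpace M] [T2Space M] [ChartedSpace EM M] [IsManifold 𝓘(ℝ, EM) ∞ M]
    -- a free and proper smooth action of `G` on `M`
    [MulAction G M] [ContMDiffSMul 𝓘(ℝ, EG) 𝓘(ℝ, EM) ∞ G M] [ProperSMul G M] [IsCancelSMul G M]
    -- a smooth complex vector bundle `E` over `M` of finite rank, with a hermitian metric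
    {F : Type*} [NormedAddCommGroup F] [NormedSpace ℂ F] [FiniteDimensional ℂ F]
    {E : M → Type*} [∀ x, NormedAddCommGroup (E x)] [∀ x, InnerProductSpace ℂ (E x)]
    [TopologicalSpace (TotalSpace F E)] [FiberBundle F E] [VectorBundle ℂ F E] [VectorBundle ℝ F E]
    [ContMDiffVectorBundle ∞ F E 𝓘(ℝ, EM)]
    (hmetric : IsSmoothHermitian EM F E)
    -- a smooth action of `G` on `E` by hermitian bundle maps over the action on `M`
    [MulAction G (TotalSpace F E)] [IsEquivariantBundle G F E]
    [ContMDiffSMul 𝓘(ℝ, EG) (𝓘(ℝ, EM).prod 𝓘(ℝ, F)) ∞ G (TotalSpace F E)]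
    (hisometric : IsInvariantHermitian G F E)
    -- a `G`-invariant, flat, hermitian connection on `E`
    (cov : CovariantDerivative 𝓘(ℝ, EM) F E)
    (hsmooth : IsSmoothComplexConnection cov)
    (hinvariant : IsInvariantConnection G F E cov)
    (hhermitian : IsHermitianConnection cov)
    (hflat : ∀ (m : M) (u v : TangentSpace 𝓘(ℝ, EM) m), curvature cov m u v = 0) :
    -- `E/G → M/G` is a smooth vector bundle, and `∇` descends to it iff the Chern form is trivial
    Nonempty (QuotientBundle EG G EM F E) ∧
      ∀ Q : QuotientBundle EG G EM F E,
        Descends Q cov ↔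
          ∀ (X : GroupLieAlgebra 𝓘(ℝ, EG) G) (m : M), totalEquivariantChernForm cov X m = 1 := by
  refine ⟨nonempty_quotientBundle EG G EM F E, fun Q ↦ ?_⟩
  let _ := Q.chartedSpace
  let _ := Q.addCommGroup
  let _ := Q.module
  let _ := Q.topologicalSpace
  let _ := Q.totalTopology
  let _ := Q.fiberBundle
  have := Q.isManifold
  have := Q.isTopologicalAddGroup
  have := Q.continuousSMul
  have := Q.vectorBundleComplex
  have := Q.vectorBundleReal
  have := Q.smoothBundle
  -- Both conditions are compared with the vanishing of the moment map; flatness and the metric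
  -- enter only through the Chern form.
  refine (descends_iff_momentMap_eq_zero finrank_euclideanSpace_fin Q.isSubmersion Q.fiberMk_add Q.fiberMk_smul
    Q.contMDiff_fiberMk cov hsmooth hinvariant).trans ?_
  exact forall₂_congr fun X m ↦ (totalEquivariantChernForm_eq_one_iff cov X m (hflat m)
    (inner_momentMap hmetric hisometric cov hsmooth hhermitian X m)).symm
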